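/- Let $\mathbb T^2=\mathbb R^2/\mathbb Z^2$ and let $L^2$, $H^s$ denote the spaces of real-valued functions $L^2(\mathbb T^2)$, $W^{s,2}(\mathbb T^2)$, with $H^{-1}$ the dual of $H^1$. Let $\mathcal V$ be the set of $\mathbb R^2$-valued, divergence-free, periodic trigonometric polynomials with zero average, let $H$ and $V$ be the closures of $\mathcal V$ in $L^2(\mathbb T^2)^2$ and $H^1(\mathbb T^2)^2$, and let $P_\sigma$ be the orthogonal projection of $L^2(\mathbb T^2)^2$ onto $H$. Write $\nabla\times b=\partial_1b_2-\partial_2b_1$ and $\vec e_2=(0,1)$. Let $\nu,\mu,\kappa,g>0$, $\alpha\in\mathbb R$ and $\epsilon>0$, and let $\zeta^\epsilon:\mathbb R\to\mathbb R$ be a calming function: $\zeta^\epsilon$ is Lipschitz, there is $M_\epsilon>0$ with $|\zeta^\epsilon(x)|+|(\zeta^\epsilon)'(x)|\le M_\epsilon$ (wherever the derivative exists), and there are $C,\gamma>0$ and $\beta\ge1$ with $|x-\zeta^\epsilon(x)|\le C\epsilon^\gamma|x|^\beta$ for all $x\in\mathbb R$. Theorem. For every $T>0$ and all initial data $(u_0,b_0,\theta_0)\in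 V\times V\times L^2$ there exists a semi-strong solution $(u,b,\theta)$ on $[0,T]$ of the calmed MHD–Boussinesq system $$\begin{aligned} &\partial_tu-\nu\Delta u+(u\cdot\nabla)u+\nabla p=(b\cdot\nabla)b+g\theta\vec e_2,\\ &\partial_tb-\mu\Delta b+(u\cdot\nabla)b=(b\cdot\nabla)u,\\ &\partial_t\theta-\kappa\Delta\theta+(u\cdot\nabla)\theta=\alpha\mu\,\zeta^\epsilon(|\nabla\times b|)\,|\nabla\times b|,\qquad \nabla\cdot u=0=\nabla\cdot b, \end{aligned}$$ that is, functions with $$u,b\in C([0,T];V)\cap L^2(0,T;H^2\cap V),\quad \partial_tu,\partial_tb\in L^2(0,T;H),$$ $$\theta\in C([0,T];L^2)\cap L^2(0,T;H^1),\quad \partial_t\theta\in L^2(0,T;H^{-1}),$$ with $u(0)=u_0$ in $V$, $b(0)=b_0$ in $V$, $\theta(0)=\theta_0$ in $L^2$, such that for almost every $t\in(0,T)$ the projected momentum equation $$\partial_tu-\nu P_\sigma\Delta u+P_\sigma((u\cdot\nabla)u)=P_\sigma((b\cdot\nabla)b)+gP_\sigma(\theta\vec e_2)$$ holds in $H$,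 the magnetic equation holds in $L^2(\mathbb T^2)^2$ (equivalently in $H$), and the temperature equation holds in $H^{-1}$. -/

import Mathlib

open MeasureTheory Set Filter Topology
open scoped ContDiff ENNReal NNReal

namespace CalmedMHD

/-! ### The periodic square and the Sobolev spaces on it -/

/-- The torus `ℝ² / ℤ²`. -/
abbrev T2 : Type := UnitAddTorus (Fin 2)

/-- Lebesgue measure on the torus `ℝ² / ℤ²` (total mass one). -/
noncomputable abbrev vol : Measure T2 := Measure.pi fun _ => AddCircle.haarAddCircle

/-- The quotient map `ℝ² → ℝ² / ℤ²`. -/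
def toTorus (y : Fin 2 → ℝ) : T2 := fun i => (y i : UnitAddCircle)

/-- Smooth functions on the torus, i.e. smooth periodic functions on `ℝ²`. -/
def IsSmooth (φ : T2 → ℝ) : Prop := ContDiff ℝ ∞ (φ ∘ toTorus)

/-- The classical partial derivative `∂φ/∂x_j`. -/
noncomputable def pderiv (j : Fin 2) (φ : T2 → ℝ) (x : T2) : ℝ :=
  deriv (fun s : ℝ => φ (x + Pi.single j (s : UnitAddCircle))) 0

lemma isOpenQuotientMap_toTorus : IsOpenQuotientMap toTorus :=
  IsOpenQuotientMap.piMap (f := fun (_ : Fin 2) (s : ℝ) => (s : UnitAddCircle))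
    fun _ => QuotientAddGroup.isOpenQuotientMap_mk

lemma IsSmooth.continuous {φ : T2 → ℝ} (h : IsSmooth φ) : Continuous φ :=
  isOpenQuotientMap_toTorus.isQuotientMap.continuous_iff.2 (ContDiff.continuous h)

lemma toTorus_add_smul (y : Fin 2 → ℝ) (j : Fin 2) (s : ℝ) :
    toTorus (y + s • Pi.single j (1 : ℝ)) = toTorus y + Pi.single j (s : UnitAddCircle) := by
  funext i
  by_cases h : i = j
  · subst h; simp [toTorus]
  · simp [toTorus, h]

lemma IsSmooth.continuous_pderiv {φ : T2 → ℝ} (h : IsSmooth φ) (j : Fin 2) :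
    Continuous (pderiv j φ) := by
  refine isOpenQuotientMap_toTorus.isQuotientMap.continuous_iff.2 ?_
  have hd : Differentiable ℝ (φ ∘ toTorus) := ContDiff.differentiable h (by simp)
  have h2 : pderiv j φ ∘ toTorus
      = fun y => fderiv ℝ (φ ∘ toTorus) y (Pi.single j (1 : ℝ)) := by
    funext y
    have h3 := ((hd y).lineDeriv_eq_fderiv (v := Pi.single j (1 : ℝ)))
    rw [← h3]
    simp only [pderiv, lineDeriv, Function.comp, toTorus_add_smul]
  rw [h2]
  exact (ContDiff.continuous_fderiv h (by simp)).clm_apply continuous_const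

/-- `L²(𝕋²)`, real valued. -/
abbrev L2 : Type := Lp ℝ 2 vol

/-- `L²(𝕋²)²`, with the inner product `∑ i, ∫ u_i v_i`. -/
abbrev L2Vec : Type := PiLp 2 fun _ : Fin 2 => L2

/-- `g` is the weak partial derivative `∂f/∂x_j`. -/
def IsWeakPartial (j : Fin 2) (f g : L2) : Prop :=
  ∀ φ : T2 → ℝ, IsSmooth φ →
    ∫ x, f x * pderiv j φ x ∂vol = -∫ x, g x * φ x ∂vol

lemma integrable_mul (f : L2) {φ : T2 → ℝ} (h : Continuous φ) :
    Integrable (fun x => f x * φ x) vol := by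
  obtain ⟨C, hC⟩ := isCompact_univ.exists_bound_of_continuousOn h.continuousOn
  exact ((Lp.memLp f).integrable (by norm_num)).mul_bdd
    h.aestronglyMeasurable (Eventually.of_forall fun x => hC x (mem_univ x))

lemma IsWeakPartial.zero (j : Fin 2) : IsWeakPartial j 0 0 := by
  intro φ _
  have h0 : ∀ ψ : T2 → ℝ, ∫ x, (0 : L2) x * ψ x ∂vol = 0 := by
    intro ψ
    rw [← integral_zero T2 ℝ]
    refine integral_congr_ae ?_
    filter_upwards [Lp.coeFn_zero ℝ 2 vol] with x hx
    rw [hx, Pi.zero_apply, zero_mul]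
  rw [h0, h0, neg_zero]

lemma IsWeakPartial.add {j : Fin 2} {f g f' g' : L2} (h : IsWeakPartial j f g)
    (h' : IsWeakPartial j f' g') : IsWeakPartial j (f + f') (g + g') := by
  intro φ hφ
  have key : ∀ (a b : L2) {ψ : T2 → ℝ}, Continuous ψ →
      ∫ x, (a + b) x * ψ x ∂vol = ∫ x, a x * ψ x ∂vol + ∫ x, b x * ψ x ∂vol := by
    intro a b ψ hψ
    rw [← integral_add (integrable_mul a hψ) (integrable_mul b hψ)]
    refine integral_congr_ae ?_
    filter_upwards [Lp.coeFn_add a b] with x hx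
    rw [hx, Pi.add_apply, add_mul]
  rw [key _ _ (hφ.continuous_pderiv j), key _ _ hφ.continuous, h φ hφ, h' φ hφ]
  ring

lemma IsWeakPartial.smul {j : Fin 2} {f g : L2} (c : ℝ) (h : IsWeakPartial j f g) :
    IsWeakPartial j (c • f) (c • g) := by
  intro φ hφ
  have key : ∀ (a : L2) (ψ : T2 → ℝ),
      ∫ x, (c • a) x * ψ x ∂vol = c * ∫ x, a x * ψ x ∂vol := by
    intro a ψ
    rw [← integral_const_mul]
    refine integral_congr_ae ?_
    filter_upwards [Lp.coeFn_smul c a] with x hx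
    simp [hx, mul_assoc]
  rw [key, key, h φ hφ]
  ring

/-- The graph `{(f, ∇f)}` of the weak gradient, inside `L² × (L²)²`. -/
def H1Graph : Submodule ℝ (WithLp 2 (L2 × L2Vec)) where
  carrier := {w | ∀ j, IsWeakPartial j w.fst (w.snd j)}
  zero_mem' := fun j => IsWeakPartial.zero j
  add_mem' := fun ha hb j => (ha j).add (hb j)
  smul_mem' := fun c _ ha j => (ha j).smul c

/-- `H¹(𝕋²) = W^{1,2}(𝕋²)`, with norm `‖f‖² + ‖∇f‖²` (square rooted).
An element is stored together with its weak gradient, which it determines. -/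
abbrev H1 : Type := H1Graph

/-- The inclusion `H¹ → L²`. -/
noncomputable def H1.fn : H1 →L[ℝ] L2 :=
  (WithLp.fstL 2 ℝ L2 L2Vec).comp H1Graph.subtypeL

/-- The weak gradient `H¹ → (L²)²`. -/
noncomputable def H1.grad : H1 →L[ℝ] L2Vec :=
  (WithLp.sndL 2 ℝ L2 L2Vec).comp H1Graph.subtypeL

/-- The graph `{(f, (∂₁f, ∂₂f))}` of the weak gradient, inside `L² × (H¹)²`. -/
def H2Graph : Submodule ℝ (WithLp 2 (L2 × PiLp 2 fun _ : Fin 2 => H1)) where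
  carrier := {w | ∀ j, IsWeakPartial j w.fst (H1.fn (w.snd j))}
  zero_mem' := fun j => by simpa using IsWeakPartial.zero j
  add_mem' := fun ha hb j => by simpa using (ha j).add (hb j)
  smul_mem' := fun c _ ha j => by simpa using (ha j).smul c

/-- `H²(𝕋²) = W^{2,2}(𝕋²)`: the functions in `L²` with weak partial derivatives in `H¹`,
with norm `‖f‖² + ∑ j, ‖∂_j f‖²_{H¹}` (square rooted). -/
abbrev H2 : Type := H2Graph

/-- The `L²` function underlying an element of `H²`. -/
def H2.fn (f : H2) : L2 := f.1.fst

/-- The weak Laplacian `∑ j, ∂_j ∂_j f`. -/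
noncomputable def H2.lap (f : H2) : L2 := ∑ j, H1.grad (f.1.snd j) j

/-- `H^{-1}(𝕋²)`, the dual of `H¹(𝕋²)`, with the dual norm. -/
abbrev Hneg1 : Type := StrongDual ℝ H1

/-- The embedding `L² → H^{-1}`, `f ↦ (ψ ↦ ∫ f ψ)`. -/
noncomputable def L2.toHneg1 (f : L2) : Hneg1 := (innerSL ℝ f).comp H1.fn

/-- `-Δ : H¹ → H^{-1}`, `f ↦ (ψ ↦ ∫ ∇f · ∇ψ)`. -/
noncomputable def H1.negLap (f : H1) : Hneg1 := (innerSL ℝ (H1.grad f)).comp H1.grad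

/-- `H¹(𝕋²)²`. -/
abbrev H1Vec : Type := PiLp 2 fun _ : Fin 2 => H1

/-- `H²(𝕋²)²`. -/
abbrev H2Vec : Type := PiLp 2 fun _ : Fin 2 => H2

/-- The `L²` field underlying an `H¹` field. -/
noncomputable def H1Vec.fn (w : H1Vec) : L2Vec := WithLp.toLp 2 fun i => H1.fn (w i)

/-- The `L²` field underlying an `H²` field. -/
def H2Vec.fn (w : H2Vec) : L2Vec := WithLp.toLp 2 fun i => H2.fn (w i)

/-- The componentwise weak Laplacian of an `H²` field. -/
noncomputable def H2Vec.lap (w : H2Vec) : L2Vec := WithLp.toLp 2 fun i => H2.lap (w i)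

/-! ### Solenoidal fields -/

/-- Real trigonometric polynomials on the torus. -/
def IsTrigPoly (φ : T2 → ℝ) : Prop :=
  ∃ (S : Finset (Fin 2 → ℤ)) (c : (Fin 2 → ℤ) → ℂ),
    ∀ x, (φ x : ℂ) = ∑ k ∈ S, c k * UnitAddTorus.mFourier k x

/-- `𝒱`: divergence free vector-valued trigonometric polynomials with zero average. -/
def trigSolenoidal : Set (Fin 2 → T2 → ℝ) :=
  {φ | (∀ i, IsTrigPoly (φ i)) ∧ (∀ x, ∑ j, pderiv j (φ j) x = 0) ∧ ∀ i, ∫ x, φ i x ∂vol = 0}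

/-- The space `H`: the closure of `𝒱` in `L²(𝕋²)²`. -/
noncomputable abbrev HSpace : Submodule ℝ L2Vec :=
  (Submodule.span ℝ
    {w : L2Vec | ∃ φ ∈ trigSolenoidal, ∀ i, w i =ᵐ[vol] φ i}).topologicalClosure

/-- The space `V`: the closure of `𝒱` in `H¹(𝕋²)²`. -/
noncomputable abbrev VSpace : Submodule ℝ H1Vec :=
  (Submodule.span ℝ
    {w : H1Vec | ∃ φ ∈ trigSolenoidal, ∀ i, H1.fn (w i) =ᵐ[vol] φ i}).topologicalClosure

/-- The Leray–Helmholtz projector `P_σ`: the orthogonal projection of `L²(𝕋²)²` onto `H`. -/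
noncomputable def leray : L2Vec →L[ℝ] L2Vec := HSpace.starProjection

/-! ### Terms of the system -/

/-- `N = u · G` almost everywhere; with `G = ∇f` this says `N = (u · ∇) f`. -/
def IsAdvection (u G : L2Vec) (N : L2) : Prop :=
  N =ᵐ[vol] fun x => ∑ j, u j x * G j x

/-- `N = (u · ∇) w` almost everywhere, for a vector field `w`. -/
def IsAdvectionVec (u : L2Vec) (w : H1Vec) (N : L2Vec) : Prop :=
  ∀ i, IsAdvection u (H1.grad (w i)) (N i)

/-- The scalar curl `∂₁ w₂ - ∂₂ w₁`. -/
noncomputable def curl (w : H1Vec) : L2 := H1.grad (w 1) 0 - H1.grad (w 0) 1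

/-- The buoyancy direction: the field `θ e₂ = (0, θ)`. -/
noncomputable def buoyancy (θ : L2) : L2Vec := WithLp.toLp 2 ![0, θ]

/-- `J = ζ(|∇ × b|) |∇ × b|` almost everywhere. -/
def IsCalmedOhmic (ζ : ℝ → ℝ) (b : H1Vec) (J : L2) : Prop :=
  J =ᵐ[vol] fun x => ζ |curl b x| * |curl b x|

/-- Calming functions with parameter `ε`. A Lipschitz function is differentiable almost everywhere,
and only there does the bound on `deriv ζ` say anything: `deriv ζ x = 0` at the other points.
No further smoothness is required. -/
structure IsCalming (ε : ℝ) (ζ : ℝ → ℝ) : Prop where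
  lipschitz : ∃ L : ℝ≥0, LipschitzWith L ζ
  bounded : ∃ M : ℝ, 0 < M ∧ ∀ x, |ζ x| + |deriv ζ x| ≤ M
  approx : ∃ C γ β : ℝ, 0 < C ∧ 0 < γ ∧ 1 ≤ β ∧ ∀ x, |x - ζ x| ≤ C * ε ^ γ * |x| ^ β

/-! ### Semi-strong solutions -/

/-- `F ∈ L²(0,T;X)`. -/
def MemL2Time {X : Type*} [NormedAddCommGroup X] (T : ℝ) (F : ℝ → X) : Prop :=
  MemLp F 2 (volume.restrict (Ioo 0 T))

/-- `F'` is the time derivative of `F` in the sense of `X`-valued distributions on `(0,T)`. -/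
def IsTimeDeriv {X : Type*} [NormedAddCommGroup X] [NormedSpace ℝ X] (T : ℝ) (F F' : ℝ → X) :
    Prop :=
  ∀ η : ℝ → ℝ, ContDiff ℝ ∞ η → HasCompactSupport η → tsupport η ⊆ Ioo 0 T →
    ∫ t in Ioo 0 T, deriv η t • F t = -∫ t in Ioo 0 T, η t • F' t

/-- `(u, b, θ)` is a semi-strong solution on `[0,T]` of the calmed system with initial data
`(u₀, b₀, θ₀)`. Here `U`, `B`, `Θ` are `u`, `b`, `θ` as elements of `L²(0,T;H²)`, `L²(0,T;H²)`,
`L²(0,T;H¹)`, and `u'`, `b'`, `θ'` are the time derivatives. The momentum equation holds in `H`,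
the pressure being removed by the projector `P_σ`, the magnetic equation holds in `L²(𝕋²)²`, and
the temperature equation holds in `H^{-1}`, each for almost every `t`. -/
structure IsSemiStrongSolution (ν μ κ g α : ℝ) (ζ : ℝ → ℝ) (T : ℝ)
    (u₀ b₀ : VSpace) (θ₀ : L2) (u b : ℝ → VSpace) (θ : ℝ → L2) : Prop where
  continuous_u : ContinuousOn u (Icc 0 T)
  continuous_b : ContinuousOn b (Icc 0 T)
  continuous_θ : ContinuousOn θ (Icc 0 T)
  initial_u : u 0 = u₀
  initial_b : b 0 = b₀
  initial_θ : θ 0 = θ₀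
  equations : ∃ (U B : ℝ → H2Vec) (Θ : ℝ → H1) (u' b' : ℝ → HSpace) (θ' : ℝ → Hneg1),
    (MemL2Time T U ∧ ∀ᵐ t ∂volume.restrict (Ioo 0 T), H2Vec.fn (U t) = H1Vec.fn (u t).1) ∧
    (MemL2Time T B ∧ ∀ᵐ t ∂volume.restrict (Ioo 0 T), H2Vec.fn (B t) = H1Vec.fn (b t).1) ∧
    (MemL2Time T Θ ∧ ∀ᵐ t ∂volume.restrict (Ioo 0 T), H1.fn (Θ t) = θ t) ∧
    (MemL2Time T u' ∧ IsTimeDeriv T (fun t => H1Vec.fn (u t).1) (fun t => (u' t : L2Vec))) ∧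
    (MemL2Time T b' ∧ IsTimeDeriv T (fun t => H1Vec.fn (b t).1) (fun t => (b' t : L2Vec))) ∧
    (MemL2Time T θ' ∧ IsTimeDeriv T (fun t => L2.toHneg1 (θ t)) θ') ∧
    (∀ᵐ t ∂volume.restrict (Ioo 0 T), ∃ N M : L2Vec,
      IsAdvectionVec (H1Vec.fn (u t).1) (u t).1 N ∧
      IsAdvectionVec (H1Vec.fn (b t).1) (b t).1 M ∧
      (u' t : L2Vec) - ν • leray (H2Vec.lap (U t)) + leray N
        = leray M + g • leray (buoyancy (θ t))) ∧
    (∀ᵐ t ∂volume.restrict (Ioo 0 T), ∃ N M : L2Vec,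
      IsAdvectionVec (H1Vec.fn (u t).1) (b t).1 N ∧
      IsAdvectionVec (H1Vec.fn (b t).1) (u t).1 M ∧
      (b' t : L2Vec) - μ • H2Vec.lap (B t) + N = M) ∧
    (∀ᵐ t ∂volume.restrict (Ioo 0 T), ∃ N J : L2,
      IsAdvection (H1Vec.fn (u t).1) (H1.grad (Θ t)) N ∧
      IsCalmedOhmic ζ (b t).1 J ∧
      θ' t + κ • H1.negLap (Θ t) + L2.toHneg1 N = (α * μ) • L2.toHneg1 J)

end CalmedMHD

namespace CalmedMHD

open UnitAddTorus

/-! ### Smooth functions on the torus -/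

/-! The system is treated as one abstract parabolic equation, and what matters is how many powers of
Λ = 1 - Δ each term costs. Put x = (Λ^{1/2} u, Λ^{1/2} b, θ) and ξ = Λ^{1/2} x. With the compact
multiplier K = Λ^{-1/2} one has K ξ = x, and the system reads (K x)' = F(ξ) - N ξ. Here N is the
diagonal of viscosities, and F collects the nonlinear terms, the buoyancy and the lower-order terms
that turn Λ back into -Δ. The norm of x is that of V × V × L²; the norm of ξ is the one that the
viscosities control.

A priori bounds. Test with (u, b, θ): the transport terms vanish, the two magnetic stretching terms
cancel, and the bound on ζ makes the heating linear in ∇ × b, so that the magnetic dissipation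
absorbs it. Hence the energy e stays bounded and Y, the squared H¹ norm of (u, b), is integrable in
time (`energyRate_le`). Testing the first two equations with Λ u and Λ b and using Ladyzhenskaya's
inequality gives Y' ≤ A (1 + e) (1 + Y)² (`enstrophyRate_le`), so log (1 + Y) stays bounded because
the integral of Y does (`exists_bound_of_energy`).

Compactness. On sets where K ξ is bounded, F is subcritical: ‖F ξ - F η‖² ≤ C ‖K (ξ - η)‖ (1 + ‖ξ‖ +
‖η‖); this follows from `isTame_force`. For Galerkin solutions x_n the curves K x_n are
equicontinuous with values in a compact set, so a subsequence converges uniformly. Interpolating K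
ξ_n between K² ξ_n and ξ_n makes x_n Cauchy in mean square, subcriticality then makes F(ξ_n) Cauchy,
and the energy inequality for differences makes x_n uniformly Cauchy and ξ_n Cauchy in mean square.
All convergence is strong, and continuity in time comes from uniform convergence
(`GalerkinScale.exists_solution`).

The magnetic equation needs no projector because (b·∇)u - (u·∇)b is itself solenoidal
(`adv_sub_adv_mem`). -/

lemma IsSmooth.hasDerivAt {φ : T2 → ℝ} (h : IsSmooth φ) (j : Fin 2) (x : T2) (s : ℝ) :
    HasDerivAt (fun r : ℝ => φ (x + Pi.single j (r : UnitAddCircle)))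
      (pderiv j φ (x + Pi.single j (s : UnitAddCircle))) s := by
  obtain ⟨y, rfl⟩ := isOpenQuotientMap_toTorus.surjective x
  have hd : Differentiable ℝ (φ ∘ toTorus) := ContDiff.differentiable h (by simp)
  have hc : Differentiable ℝ
      (fun r : ℝ => φ (toTorus y + Pi.single j (r : UnitAddCircle))) := by
    have : (fun r : ℝ => φ (toTorus y + Pi.single j (r : UnitAddCircle)))
        = (φ ∘ toTorus) ∘ fun r : ℝ => y + r • Pi.single j (1 : ℝ) := by
      funext r; simp only [Function.comp, toTorus_add_smul]
    rw [this]
    exact hd.comp (by fun_prop)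
  have h1 := (hc s).hasDerivAt
  have h2 : deriv (fun r : ℝ => φ (toTorus y + Pi.single j (r : UnitAddCircle))) s
      = pderiv j φ (toTorus y + Pi.single j (s : UnitAddCircle)) := by
    have h3 := deriv_comp_const_add
      (fun r : ℝ => φ (toTorus y + Pi.single j (r : UnitAddCircle))) s 0
    rw [add_zero] at h3
    rw [← h3, pderiv]
    congr 1
    funext r
    simp only [AddCircle.coe_add, Pi.single_add, add_assoc]
  rwa [h2] at h1

lemma pderiv_eq_of_hasDerivAt {φ : T2 → ℝ} {j : Fin 2} {x : T2} {a : ℝ}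
    (h : HasDerivAt (fun r : ℝ => φ (x + Pi.single j (r : UnitAddCircle))) a 0) :
    pderiv j φ x = a := h.deriv

lemma IsSmooth.hasDerivAt_zero {φ : T2 → ℝ} (h : IsSmooth φ) (j : Fin 2) (x : T2) :
    HasDerivAt (fun r : ℝ => φ (x + Pi.single j (r : UnitAddCircle))) (pderiv j φ x) 0 := by
  simpa using h.hasDerivAt j x 0

lemma IsSmooth.mul {φ ψ : T2 → ℝ} (h : IsSmooth φ) (h' : IsSmooth ψ) :
    IsSmooth (fun x => φ x * ψ x) := ContDiff.mul h h'

lemma IsSmooth.const_mul {φ : T2 → ℝ} (c : ℝ) (h : IsSmooth φ) :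
    IsSmooth (fun x => c * φ x) := ContDiff.mul contDiff_const h

lemma IsSmooth.sum {ι : Type*} {s : Finset ι} {φ : ι → T2 → ℝ} (h : ∀ i, IsSmooth (φ i)) :
    IsSmooth (fun x => ∑ i ∈ s, φ i x) := ContDiff.sum fun i _ => h i

lemma pderiv_mul {φ ψ : T2 → ℝ} (h : IsSmooth φ) (h' : IsSmooth ψ) (j : Fin 2) (x : T2) :
    pderiv j (fun x => φ x * ψ x) x = pderiv j φ x * ψ x + φ x * pderiv j ψ x := by
  apply pderiv_eq_of_hasDerivAt
  have := (h.hasDerivAt_zero j x).mul (h'.hasDerivAt_zero j x)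
  simp only [AddCircle.coe_zero, Pi.single_zero, add_zero] at this
  exact this

lemma pderiv_const_mul {φ : T2 → ℝ} (c : ℝ) (h : IsSmooth φ) (j : Fin 2) (x : T2) :
    pderiv j (fun x => c * φ x) x = c * pderiv j φ x :=
  pderiv_eq_of_hasDerivAt ((h.hasDerivAt_zero j x).const_mul c)

lemma pderiv_sum {ι : Type*} {s : Finset ι} {φ : ι → T2 → ℝ} (h : ∀ i, IsSmooth (φ i))
    (j : Fin 2) (x : T2) :
    pderiv j (fun x => ∑ i ∈ s, φ i x) x = ∑ i ∈ s, pderiv j (φ i) x :=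
  pderiv_eq_of_hasDerivAt (HasDerivAt.fun_sum fun i _ => (h i).hasDerivAt_zero j x)

lemma integrable_of_continuous {φ : T2 → ℝ} (h : Continuous φ) : Integrable φ vol := by
  obtain ⟨C, hC⟩ := isCompact_univ.exists_bound_of_continuousOn h.continuousOn
  exact Integrable.of_bound h.aestronglyMeasurable C
    (Eventually.of_forall fun x => hC x (mem_univ x))

/-- Haar measure is translation invariant, so s ↦ ∫ φ(x + s e_j) is constant; differentiate under
the integral at s = 0. -/
lemma integral_pderiv {φ : T2 → ℝ} (h : IsSmooth φ) (j : Fin 2) :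
    ∫ x, pderiv j φ x ∂vol = 0 := by
  obtain ⟨C, hC⟩ := isCompact_univ.exists_bound_of_continuousOn (h.continuous_pderiv j).continuousOn
  have key := hasDerivAt_integral_of_dominated_loc_of_deriv_le (μ := vol) (x₀ := (0 : ℝ))
    (F := fun (s : ℝ) x => φ (x + Pi.single j (s : UnitAddCircle)))
    (F' := fun (s : ℝ) x => pderiv j φ (x + Pi.single j (s : UnitAddCircle)))
    (s := univ) (bound := fun _ => C) univ_mem
    (Eventually.of_forall fun s => (h.continuous.comp (by fun_prop)).aestronglyMeasurable)
    (integrable_of_continuous (h.continuous.comp (by fun_prop)))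
    ((h.continuous_pderiv j).comp (by fun_prop)).aestronglyMeasurable
    (Eventually.of_forall fun x s _ => hC _ (mem_univ _)) (integrable_const C)
    (Eventually.of_forall fun x s _ => h.hasDerivAt j x s)
  have h1 : ∀ s : ℝ, ∫ x, φ (x + Pi.single j (s : UnitAddCircle)) ∂vol = ∫ x, φ x ∂vol :=
    fun s => integral_add_right_eq_self φ _
  have h2 := key.2
  simp only [h1] at h2
  have h3 := h2.unique (hasDerivAt_const (0 : ℝ) (∫ x, φ x ∂vol))
  simpa using h3

lemma integral_mul_pderiv {φ ψ : T2 → ℝ} (h : IsSmooth φ) (h' : IsSmooth ψ) (j : Fin 2) :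
    ∫ x, φ x * pderiv j ψ x ∂vol = -∫ x, pderiv j φ x * ψ x ∂vol := by
  have h0 := integral_pderiv (h.mul h') j
  simp only [pderiv_mul h h'] at h0
  rw [integral_add (f := fun x => pderiv j φ x * ψ x) (g := fun x => φ x * pderiv j ψ x)
    (integrable_of_continuous ((h.continuous_pderiv j).mul h'.continuous))
    (integrable_of_continuous (h.continuous.mul (h'.continuous_pderiv j)))] at h0
  linarith

/-! ### The real Fourier basis -/

/-- The function `cos (2π k·x) + sin (2π k·x)`. -/
noncomputable def cas (k : Fin 2 → ℤ) (x : T2) : ℝ := (mFourier k x).re + (mFourier k x).im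

lemma continuous_cas (k : Fin 2 → ℤ) : Continuous (cas k) :=
  (Complex.continuous_re.comp (mFourier k).continuous).add
    (Complex.continuous_im.comp (mFourier k).continuous)

lemma cas_neg (k : Fin 2 → ℤ) (x : T2) :
    cas (-k) x = (mFourier k x).re - (mFourier k x).im := by
  simp [cas, mFourier_neg, sub_eq_add_neg]

lemma mFourier_toTorus (k : Fin 2 → ℤ) (y : Fin 2 → ℝ) :
    mFourier k (toTorus y) = ∏ i, Complex.exp (2 * Real.pi * Complex.I * k i * y i) := by
  simp only [mFourier, toTorus, ContinuousMap.coe_mk, fourier_coe_apply]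
  simp

lemma contDiff_mFourier_toTorus (k : Fin 2 → ℤ) :
    ContDiff ℝ ∞ (fun y => mFourier k (toTorus y)) := by
  simp only [mFourier_toTorus]
  refine contDiff_prod fun i _ => ContDiff.cexp (ContDiff.mul contDiff_const ?_)
  exact Complex.ofRealCLM.contDiff.comp (contDiff_apply ℝ ℝ i)

lemma isSmooth_cas (k : Fin 2 → ℤ) : IsSmooth (cas k) :=
  (Complex.reCLM.contDiff.comp (contDiff_mFourier_toTorus k)).add
    (Complex.imCLM.contDiff.comp (contDiff_mFourier_toTorus k))

lemma mFourier_add_apply (k : Fin 2 → ℤ) (x y : T2) :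
    mFourier k (x + y) = mFourier k x * mFourier k y := by
  simp only [mFourier, ContinuousMap.coe_mk, Pi.add_apply, ← Finset.prod_mul_distrib]
  refine Finset.prod_congr rfl fun i _ => ?_
  simp [fourier_apply, smul_add, AddCircle.toCircle_add]

lemma mFourier_pi_single (k : Fin 2 → ℤ) (j : Fin 2) (s : ℝ) :
    mFourier k (Pi.single j (s : UnitAddCircle)) = Complex.exp (2 * Real.pi * Complex.I * k j * s) := by
  have := mFourier_toTorus k (Pi.single j s)
  have h2 : toTorus (Pi.single j s) = Pi.single j (s : UnitAddCircle) := by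
    have := toTorus_add_smul 0 j s
    rw [← Pi.single_smul, smul_eq_mul, mul_one, zero_add] at this
    rw [this]
    have h0 : toTorus 0 = 0 := by funext i; simp [toTorus]
    rw [h0, zero_add]
  rw [h2] at this
  rw [this, Finset.prod_eq_single j]
  · simp
  · intro i _ hi; simp [hi]
  · simp

/-- Differentiating cos + sin gives cos - sin, the same function at frequency -k. In this real basis
∂_j is therefore a multiplier composed with k ↦ -k, which is why `Equiv.neg` keeps appearing. -/
lemma pderiv_cas (k : Fin 2 → ℤ) (j : Fin 2) (x : T2) :
    pderiv j (cas k) x = 2 * Real.pi * k j * cas (-k) x := by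
  apply pderiv_eq_of_hasDerivAt
  have h1 : HasDerivAt (fun r : ℝ => mFourier k (x + Pi.single j (r : UnitAddCircle)))
      (mFourier k x * (2 * Real.pi * Complex.I * k j)) 0 := by
    simp only [mFourier_add_apply, mFourier_pi_single]
    have h2 : HasDerivAt (fun r : ℝ => 2 * Real.pi * Complex.I * (k j : ℂ) * (r : ℂ))
        (2 * Real.pi * Complex.I * k j) 0 := by
      simpa using (Complex.ofRealCLM.hasDerivAt (x := (0 : ℝ))).const_mul
        (2 * Real.pi * Complex.I * (k j : ℂ))
    simpa using (h2.cexp).const_mul (mFourier k x)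
  have h3 := (Complex.reCLM.hasFDerivAt.comp_hasDerivAt 0 h1).add
    (Complex.imCLM.hasFDerivAt.comp_hasDerivAt 0 h1)
  refine h3.congr_deriv ?_
  rw [cas_neg]
  simp
  ring

lemma integral_mFourier (k : Fin 2 → ℤ) : ∫ x, mFourier k x ∂vol = if k = 0 then 1 else 0 := by
  have := orthonormal_iff_ite.1 (orthonormal_mFourier (d := Fin 2)) 0 k
  simp only [mFourierLp, ContinuousMap.inner_toLp, ← mFourier_neg, ← mFourier_add] at this
  rw [neg_zero, add_zero] at this
  refine this.trans ?_
  simp [eq_comm]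

lemma integrable_mFourier (k : Fin 2 → ℤ) : Integrable (fun x => mFourier k x) vol := by
  refine Integrable.of_bound (mFourier k).continuous.aestronglyMeasurable 1
    (Eventually.of_forall fun x => ?_)
  simpa [mFourier_norm] using (mFourier k).norm_coe_le_norm x

lemma integral_cas_mul_cas (k l : Fin 2 → ℤ) :
    ∫ x, cas k x * cas l x ∂vol = if k = l then 1 else 0 := by
  -- Product-to-sum formula. The second term integrates to zero because the mean of a character is
  -- real.
  have h : ∀ x, cas k x * cas l x = (mFourier (k + -l) x).re + (mFourier (k + l) x).im := by
    intro x
    simp only [cas, mFourier_add, mFourier_neg, Complex.mul_re, Complex.mul_im, Complex.conj_re,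
      Complex.conj_im]
    ring
  simp only [h]
  have e1 : ∫ x, (mFourier (k + -l) x).re ∂vol = (∫ x, mFourier (k + -l) x ∂vol).re :=
    Complex.reCLM.integral_comp_comm (integrable_mFourier (k + -l))
  have e2 : ∫ x, (mFourier (k + l) x).im ∂vol = (∫ x, mFourier (k + l) x ∂vol).im :=
    Complex.imCLM.integral_comp_comm (integrable_mFourier (k + l))
  rw [integral_add (f := fun x => (mFourier (k + -l) x).re) (g := fun x => (mFourier (k + l) x).im)
    (integrable_mFourier _).re (integrable_mFourier _).im, e1, e2, integral_mFourier, integral_mFourier]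
  have : k + -l = 0 ↔ k = l := by rw [← sub_eq_add_neg, sub_eq_zero]
  simp only [this]
  split_ifs <;> simp

/-- `cas k` as an element of `C(𝕋²)`. -/
noncomputable def casC (k : Fin 2 → ℤ) : C(T2, ℝ) := ⟨cas k, continuous_cas k⟩

/-- `cas k` as an element of `L²`. -/
noncomputable def casL (k : Fin 2 → ℤ) : L2 := ContinuousMap.toLp 2 vol ℝ (casC k)

lemma coeFn_casL (k : Fin 2 → ℤ) : casL k =ᵐ[vol] cas k := ContinuousMap.coeFn_toLp vol (casC k)

lemma inner_casL (k : Fin 2 → ℤ) (f : L2) : inner ℝ (casL k) f = ∫ x, f x * cas k x ∂vol := by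
  rw [L2.inner_def]
  refine integral_congr_ae ?_
  filter_upwards [coeFn_casL k] with x hx
  simp [hx]

lemma orthonormal_casL : Orthonormal ℝ casL := by
  rw [orthonormal_iff_ite]
  intro k l
  rw [inner_casL, ← integral_cas_mul_cas]
  refine integral_congr_ae ?_
  filter_upwards [coeFn_casL l] with x hx
  rw [hx, mul_comm]

/-- Since `cas k` and `cas (-k)` are the sum and the difference of the real and imaginary parts of
one character, orthogonality to all of them kills every complex Fourier coefficient, and the complex
basis is complete. -/
lemma eq_zero_of_inner_casL (f : L2) (h : ∀ k, inner ℝ (casL k) f = 0) : f = 0 := by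
  have hm : MemLp (fun x => (f x : ℂ)) 2 vol := (Lp.memLp f).ofReal
  let g : Lp ℂ 2 vol := hm.toLp
  have hg : g =ᵐ[vol] fun x => (f x : ℂ) := hm.coeFn_toLp
  have h1 : ∀ k, ∫ x, f x * (mFourier k x).re ∂vol = 0 ∧ ∫ x, f x * (mFourier k x).im ∂vol = 0 := by
    intro k
    have a1 := h k
    have a2 := h (-k)
    rw [inner_casL] at a1 a2
    have i1 : Integrable (fun x => f x * (mFourier k x).re) vol :=
      integrable_mul f (Complex.continuous_re.comp (mFourier k).continuous)
    have i2 : Integrable (fun x => f x * (mFourier k x).im) vol :=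
      integrable_mul f (Complex.continuous_im.comp (mFourier k).continuous)
    simp only [cas, mul_add] at a1
    simp only [cas_neg, mul_sub] at a2
    rw [integral_add i1 i2] at a1
    rw [integral_sub i1 i2] at a2
    constructor <;> linarith
  have h2 : ∀ k, (mFourierBasis (d := Fin 2)).repr g k = 0 := by
    intro k
    rw [mFourierBasis_repr, mFourierCoeff]
    have e : ∫ x, mFourier (-k) x • g x ∂vol = ∫ x, (f x : ℂ) * mFourier (-k) x ∂vol := by
      refine integral_congr_ae ?_
      filter_upwards [hg] with x hx
      rw [hx, smul_eq_mul, mul_comm]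
    have hint : Integrable (fun x => (f x : ℂ) * mFourier (-k) x) vol := by
      refine (((Lp.memLp f).integrable (by norm_num)).ofReal).mul_bdd (c := 1)
        (mFourier (-k)).continuous.aestronglyMeasurable (Eventually.of_forall fun x => ?_)
      simpa [mFourier_norm] using (mFourier (-k)).norm_coe_le_norm x
    refine e.trans ?_
    apply Complex.ext
    · have := Complex.reCLM.integral_comp_comm hint
      simp only [Complex.reCLM_apply] at this
      rw [← this, Complex.zero_re, ← (h1 (-k)).1]
      simp
    · have := Complex.imCLM.integral_comp_comm hint
      simp only [Complex.imCLM_apply] at this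
      rw [← this, Complex.zero_im, ← (h1 (-k)).2]
      simp
  have h3 : g = 0 := by
    apply (mFourierBasis (d := Fin 2)).repr.injective
    rw [map_zero]
    ext k
    exact h2 k
  have h4 : (fun x => (f x : ℂ)) =ᵐ[vol] 0 := by
    refine hg.symm.trans ?_
    rw [h3]
    exact Lp.coeFn_zero _ _ _
  rw [Lp.eq_zero_iff_ae_eq_zero]
  filter_upwards [h4] with x hx
  simpa using hx

/-- The Hilbert basis `cas k` of `L²(𝕋²)`. -/
noncomputable def casBasis : HilbertBasis (Fin 2 → ℤ) ℝ L2 :=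
  HilbertBasis.mkOfOrthogonalEqBot orthonormal_casL <| by
    rw [Submodule.eq_bot_iff]
    intro f hf
    apply eq_zero_of_inner_casL
    intro k
    exact hf _ (Submodule.subset_span ⟨k, rfl⟩)

lemma coe_casBasis : ⇑casBasis = casL := HilbertBasis.coe_mkOfOrthogonalEqBot _ _

/-- The Fourier coefficients of `f` with respect to `cas`. -/
noncomputable def coef (k : Fin 2 → ℤ) : L2 →L[ℝ] ℝ := innerSL ℝ (casL k)

lemma coef_eq_inner (k : Fin 2 → ℤ) (f : L2) : coef k f = inner ℝ (casL k) f := rfl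

lemma coef_eq_integral (k : Fin 2 → ℤ) (f : L2) : coef k f = ∫ x, f x * cas k x ∂vol :=
  inner_casL k f

lemma coef_eq_repr (k : Fin 2 → ℤ) (f : L2) : coef k f = casBasis.repr f k := by
  rw [HilbertBasis.repr_apply_apply, coe_casBasis, coef_eq_inner]

lemma coef_casL (k l : Fin 2 → ℤ) : coef k (casL l) = if k = l then 1 else 0 :=
  orthonormal_iff_ite.1 orthonormal_casL k l

lemma ext_coef {f g : L2} (h : ∀ k, coef k f = coef k g) : f = g := by
  apply casBasis.repr.injective
  ext k
  rw [← coef_eq_repr, ← coef_eq_repr, h]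

lemma hasSum_coef_mul (f g : L2) : HasSum (fun k => coef k f * coef k g) (inner ℝ f g) := by
  have := casBasis.hasSum_inner_mul_inner f g
  simp only [coe_casBasis] at this
  simpa only [coef_eq_inner, real_inner_comm f] using this

lemma hasSum_coef_sq (f : L2) : HasSum (fun k => coef k f ^ 2) (‖f‖ ^ 2) := by
  simpa [← real_inner_self_eq_norm_sq, sq] using hasSum_coef_mul f f

lemma coef_neg_index_of_isWeakPartial {j : Fin 2} {f g : L2} (h : IsWeakPartial j f g)
    (k : Fin 2 → ℤ) : coef k g = -(2 * Real.pi * k j) * coef (-k) f := by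
  have h1 := h (cas k) (isSmooth_cas k)
  rw [coef_eq_integral, coef_eq_integral, ← neg_eq_iff_eq_neg.2 h1]
  simp only [pderiv_cas]
  rw [← integral_const_mul, ← integral_neg]
  congr 1
  funext x
  ring

/-- A continuous function as an element of `L²`. -/
noncomputable def contL2 {φ : T2 → ℝ} (h : Continuous φ) : L2 :=
  ContinuousMap.toLp 2 vol ℝ ⟨φ, h⟩

lemma coeFn_contL2 {φ : T2 → ℝ} (h : Continuous φ) : contL2 h =ᵐ[vol] φ :=
  ContinuousMap.coeFn_toLp vol (⟨φ, h⟩ : C(T2, ℝ))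

lemma inner_contL2 {φ : T2 → ℝ} (h : Continuous φ) (f : L2) :
    inner ℝ f (contL2 h) = ∫ x, f x * φ x ∂vol := by
  rw [L2.inner_def]
  refine integral_congr_ae ?_
  filter_upwards [coeFn_contL2 h] with x hx
  simp [hx, mul_comm]

lemma coef_contL2 {φ : T2 → ℝ} (h : Continuous φ) (k : Fin 2 → ℤ) :
    coef k (contL2 h) = ∫ x, φ x * cas k x ∂vol := by
  rw [coef_eq_integral]
  refine integral_congr_ae ?_
  filter_upwards [coeFn_contL2 h] with x hx
  rw [hx]

lemma IsSmooth.isWeakPartial {φ : T2 → ℝ} (h : IsSmooth φ) (j : Fin 2) :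
    IsWeakPartial j (contL2 h.continuous) (contL2 (h.continuous_pderiv j)) := by
  intro ψ hψ
  have e : ∀ {χ : T2 → ℝ} (hc : Continuous χ) (ξ : T2 → ℝ),
      ∫ x, contL2 hc x * ξ x ∂vol = ∫ x, χ x * ξ x ∂vol := by
    intro χ hc ξ
    refine integral_congr_ae ?_
    filter_upwards [coeFn_contL2 hc] with x hx
    rw [hx]
  rw [e, e, integral_mul_pderiv h hψ]

/-- A smooth test function and its derivative are related by the same coefficient rule, so both
sides of the integration by parts expand by Parseval, and reindexing by k ↦ -k matches them.
Regularity becomes a statement about coefficients. -/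
lemma isWeakPartial_iff {j : Fin 2} {f g : L2} :
    IsWeakPartial j f g ↔ ∀ k, coef k g = -(2 * Real.pi * k j) * coef (-k) f := by
  refine ⟨coef_neg_index_of_isWeakPartial, fun h φ hφ => ?_⟩
  rw [← inner_contL2 (hφ.continuous_pderiv j), ← inner_contL2 hφ.continuous]
  have h1 := hasSum_coef_mul f (contL2 (hφ.continuous_pderiv j))
  have h2 := hasSum_coef_mul g (contL2 hφ.continuous)
  rw [← (Equiv.neg (Fin 2 → ℤ)).hasSum_iff] at h2
  refine h1.unique ?_
  refine h2.neg.congr_fun ?_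
  intro k
  rw [coef_neg_index_of_isWeakPartial (hφ.isWeakPartial j) k]
  simp only [Function.comp, Equiv.neg_apply, h, neg_neg, Pi.neg_apply]
  push_cast
  ring

/-! ### Fourier multipliers -/

lemma summable_coef_sq (f : L2) : Summable (fun k => coef k f ^ 2) := (hasSum_coef_sq f).summable

lemma exists_of_summable_sq {a : (Fin 2 → ℤ) → ℝ} (h : Summable fun k => a k ^ 2) :
    ∃ f : L2, ∀ k, coef k f = a k := by
  have hm : Memℓp a 2 := by
    rw [memℓp_gen_iff (by norm_num)]
    simpa using h
  refine ⟨casBasis.repr.symm ⟨a, hm⟩, fun k => ?_⟩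
  rw [coef_eq_repr, LinearIsometryEquiv.apply_symm_apply]

/-- Parseval bounds the operator by sup |m|. The permutation makes room for derivatives, which
exchange k and -k. -/
lemma exists_coefOp (σ : Equiv.Perm (Fin 2 → ℤ)) (m : (Fin 2 → ℤ) → ℝ) (h : ∃ C, ∀ k, |m k| ≤ C) :
    ∃ T : L2 →L[ℝ] L2, ∀ f k, coef k (T f) = m k * coef (σ k) f := by
  obtain ⟨C, hC⟩ := h
  have hC0 : 0 ≤ C := (abs_nonneg _).trans (hC 0)
  have hle : ∀ (f : L2) k, (m k * coef (σ k) f) ^ 2 ≤ C ^ 2 * coef (σ k) f ^ 2 := by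
    intro f k
    rw [mul_pow]
    exact mul_le_mul_of_nonneg_right
      (sq_le_sq' (neg_le_of_abs_le (hC k)) (le_of_abs_le (hC k))) (sq_nonneg _)
  have hs : ∀ f : L2, HasSum (fun k => C ^ 2 * coef (σ k) f ^ 2) (C ^ 2 * ‖f‖ ^ 2) := fun f =>
    (σ.hasSum_iff (f := fun k => coef k f ^ 2).2 (hasSum_coef_sq f)).mul_left _
  choose T hT using fun f : L2 => exists_of_summable_sq
    (Summable.of_nonneg_of_le (fun k => sq_nonneg _) (hle f) (hs f).summable)
  let TL : L2 →ₗ[ℝ] L2 :=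
    { toFun := T
      map_add' := fun f g => ext_coef fun k => by simp only [map_add, hT]; ring
      map_smul' := fun c f => ext_coef fun k => by
        simp only [map_smul, hT, RingHom.id_apply, smul_eq_mul]; ring }
  refine ⟨TL.mkContinuous C fun f => ?_, fun f k => hT f k⟩
  have h1 := hasSum_coef_sq (T f)
  simp only [hT] at h1
  have h2 := hasSum_le (hle f) h1 (hs f)
  rw [← mul_pow] at h2
  exact abs_le_of_sq_le_sq' h2 (by positivity) |>.2

/-- The operator that multiplies the `σ k`-th coefficient by `m k` and makes it the `k`-th one. -/
noncomputable def coefOp (σ : Equiv.Perm (Fin 2 → ℤ)) (m : (Fin 2 → ℤ) → ℝ)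
    (h : ∃ C, ∀ k, |m k| ≤ C) : L2 →L[ℝ] L2 := (exists_coefOp σ m h).choose

lemma coef_coefOp (σ : Equiv.Perm (Fin 2 → ℤ)) (m : (Fin 2 → ℤ) → ℝ) (h : ∃ C, ∀ k, |m k| ≤ C)
    (f : L2) (k : Fin 2 → ℤ) : coef k (coefOp σ m h f) = m k * coef (σ k) f :=
  (exists_coefOp σ m h).choose_spec f k

/-- The symbol `1 + 4π²|k|²` of `1 - Δ`. -/
noncomputable def lam (k : Fin 2 → ℤ) : ℝ := 1 + ∑ j, (2 * Real.pi * k j) ^ 2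

lemma one_le_lam (k : Fin 2 → ℤ) : 1 ≤ lam k :=
  le_add_of_nonneg_right (Finset.sum_nonneg fun _ _ => sq_nonneg _)

lemma lam_pos (k : Fin 2 → ℤ) : 0 < lam k := one_pos.trans_le (one_le_lam k)

lemma lam_neg (k : Fin 2 → ℤ) : lam (-k) = lam k := by simp [lam]

lemma sqrt_lam_pos (k : Fin 2 → ℤ) : 0 < √(lam k) := Real.sqrt_pos.2 (lam_pos k)

lemma one_le_sqrt_lam (k : Fin 2 → ℤ) : 1 ≤ √(lam k) := Real.one_le_sqrt.2 (one_le_lam k)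

lemma abs_le_sqrt_lam (k : Fin 2 → ℤ) (j : Fin 2) : |2 * Real.pi * k j| ≤ √(lam k) := by
  apply Real.abs_le_sqrt
  have := Finset.single_le_sum (f := fun j => (2 * Real.pi * (k j : ℝ)) ^ 2)
    (fun j _ => sq_nonneg _) (Finset.mem_univ j)
  rw [lam]
  linarith

lemma inv_sqrt_lam_bound : ∃ C, ∀ k, |(√(lam k))⁻¹| ≤ C :=
  ⟨1, fun k => by
    rw [abs_of_pos (inv_pos.2 (sqrt_lam_pos k))]
    exact inv_le_one_of_one_le₀ (one_le_sqrt_lam k)⟩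

lemma deriv_symbol_bound (j : Fin 2) : ∃ C, ∀ k : Fin 2 → ℤ,
    |-(2 * Real.pi * k j) * (√(lam k))⁻¹| ≤ C :=
  ⟨1, fun k => by
    rw [abs_mul, abs_neg, abs_of_pos (inv_pos.2 (sqrt_lam_pos k)), ← div_eq_mul_inv,
      div_le_one (sqrt_lam_pos k)]
    exact abs_le_sqrt_lam k j⟩

/-- The Bessel potential `(1 - Δ)^{-1/2}`. -/
noncomputable def bessel : L2 →L[ℝ] L2 := coefOp 1 (fun k => (√(lam k))⁻¹) inv_sqrt_lam_bound

/-- `∂_j (1 - Δ)^{-1/2}`. -/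
noncomputable def riesz (j : Fin 2) : L2 →L[ℝ] L2 :=
  coefOp (Equiv.neg _) (fun k => -(2 * Real.pi * k j) * (√(lam k))⁻¹) (deriv_symbol_bound j)

/-- The frequencies `k` with `|k_j| ≤ n`. -/
noncomputable def box (n : ℕ) : Finset (Fin 2 → ℤ) := Fintype.piFinset fun _ => Finset.Icc (-(n : ℤ)) n

lemma mem_box {n : ℕ} {k : Fin 2 → ℤ} : k ∈ box n ↔ ∀ j, |k j| ≤ n := by
  simp [box, Fintype.mem_piFinset, abs_le]

lemma neg_mem_box {n : ℕ} {k : Fin 2 → ℤ} : -k ∈ box n ↔ k ∈ box n := by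
  simp [mem_box]

lemma monotone_box : Monotone box := fun m n h k hk => by
  rw [mem_box] at hk ⊢
  exact fun j => (hk j).trans (by exact_mod_cast h)

lemma tendsto_box : Tendsto box atTop atTop := by
  refine tendsto_atTop_finset_of_monotone monotone_box fun k => ?_
  refine ⟨∑ j, (k j).natAbs, mem_box.2 fun j => ?_⟩
  have := Finset.single_le_sum (f := fun j => (k j).natAbs) (fun j _ => Nat.zero_le _)
    (Finset.mem_univ j)
  rw [Int.abs_eq_natAbs]
  exact_mod_cast this

lemma ite_box_bound (n : ℕ) (m : (Fin 2 → ℤ) → ℝ) :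
    ∃ C, ∀ k, |if k ∈ box n then m k else 0| ≤ C := by
  refine ⟨∑ k ∈ box n, |m k|, fun k => ?_⟩
  split_ifs with h
  · exact Finset.single_le_sum (f := fun k => |m k|) (fun k _ => abs_nonneg _) h
  · simpa using Finset.sum_nonneg fun k _ => abs_nonneg (m k)

/-- The projection onto the frequencies in `box n`. -/
noncomputable def proj (n : ℕ) : L2 →L[ℝ] L2 :=
  coefOp 1 (fun k => if k ∈ box n then 1 else 0) (ite_box_bound n fun _ => 1)

/-- `(1 - Δ)^{1/2}` on the frequencies in `box n`. -/
noncomputable def rough (n : ℕ) : L2 →L[ℝ] L2 :=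
  coefOp 1 (fun k => if k ∈ box n then √(lam k) else 0) (ite_box_bound n fun k => √(lam k))

@[simp] lemma coef_bessel (f : L2) (k : Fin 2 → ℤ) :
    coef k (bessel f) = (√(lam k))⁻¹ * coef k f := coef_coefOp _ _ _ _ _

@[simp] lemma coef_riesz (j : Fin 2) (f : L2) (k : Fin 2 → ℤ) :
    coef k (riesz j f) = -(2 * Real.pi * k j) * (√(lam k))⁻¹ * coef (-k) f := coef_coefOp _ _ _ _ _

@[simp] lemma coef_proj (n : ℕ) (f : L2) (k : Fin 2 → ℤ) :
    coef k (proj n f) = (if k ∈ box n then 1 else 0) * coef k f := coef_coefOp _ _ _ _ _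

@[simp] lemma coef_rough (n : ℕ) (f : L2) (k : Fin 2 → ℤ) :
    coef k (rough n f) = (if k ∈ box n then √(lam k) else 0) * coef k f := coef_coefOp _ _ _ _ _

lemma norm_sq_le_of_coef {f g : L2} (σ : Equiv.Perm (Fin 2 → ℤ))
    (h : ∀ k, |coef k f| ≤ |coef (σ k) g|) : ‖f‖ ≤ ‖g‖ := by
  have h2 := (σ.hasSum_iff (f := fun k => coef k g ^ 2)).2 (hasSum_coef_sq g)
  have h3 := hasSum_le (fun k => sq_le_sq.2 (h k)) (hasSum_coef_sq f) h2
  exact abs_le_of_sq_le_sq' h3 (norm_nonneg _) |>.2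

lemma norm_bessel_le (f : L2) : ‖bessel f‖ ≤ ‖f‖ := by
  refine norm_sq_le_of_coef 1 fun k => ?_
  rw [coef_bessel, abs_mul, abs_of_pos (inv_pos.2 (sqrt_lam_pos k))]
  exact mul_le_of_le_one_left (abs_nonneg _) (inv_le_one_of_one_le₀ (one_le_sqrt_lam k))

lemma norm_riesz_le (j : Fin 2) (f : L2) : ‖riesz j f‖ ≤ ‖f‖ := by
  refine norm_sq_le_of_coef (Equiv.neg _) fun k => ?_
  rw [coef_riesz, abs_mul]
  refine mul_le_of_le_one_left (abs_nonneg _) ?_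
  rw [abs_mul, abs_neg, abs_of_pos (inv_pos.2 (sqrt_lam_pos k)), ← div_eq_mul_inv,
      div_le_one (sqrt_lam_pos k)]
  exact abs_le_sqrt_lam k j

lemma norm_proj_le (n : ℕ) (f : L2) : ‖proj n f‖ ≤ ‖f‖ := by
  refine norm_sq_le_of_coef 1 fun k => ?_
  rw [coef_proj]
  split_ifs <;> simp

lemma bessel_riesz (j : Fin 2) (f : L2) : bessel (riesz j f) = riesz j (bessel f) :=
  ext_coef fun k => by simp only [coef_bessel, coef_riesz, lam_neg]; ring

lemma bessel_proj (n : ℕ) (f : L2) : bessel (proj n f) = proj n (bessel f) :=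
  ext_coef fun k => by simp only [coef_bessel, coef_proj]; ring

lemma riesz_proj (j : Fin 2) (n : ℕ) (f : L2) : riesz j (proj n f) = proj n (riesz j f) :=
  ext_coef fun k => by simp only [coef_riesz, coef_proj, neg_mem_box]; ring

lemma bessel_rough (n : ℕ) (f : L2) : bessel (rough n f) = proj n f :=
  ext_coef fun k => by
    simp only [coef_bessel, coef_rough, coef_proj]
    split_ifs
    · rw [inv_mul_cancel_left₀ (sqrt_lam_pos k).ne', one_mul]
    · simp

lemma proj_proj {m n : ℕ} (h : m ≤ n) (f : L2) : proj n (proj m f) = proj m f :=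
  ext_coef fun k => by
    simp only [coef_proj]
    split_ifs with h1 h2
    · simp
    · simp
    · exact absurd (monotone_box h ‹_›) h1
    · simp

lemma rough_proj {m n : ℕ} (h : m ≤ n) (f : L2) : rough n (proj m f) = rough m f :=
  ext_coef fun k => by
    simp only [coef_proj, coef_rough]
    split_ifs with h1 h2
    · simp
    · simp
    · exact absurd (monotone_box h ‹_›) h1
    · simp

lemma proj_rough {m n : ℕ} (h : m ≤ n) (f : L2) : proj n (rough m f) = rough m f :=
  ext_coef fun k => by
    simp only [coef_proj, coef_rough]
    split_ifs with h1 h2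
    · simp
    · simp
    · exact absurd (monotone_box h ‹_›) h1
    · simp

lemma inner_eq_of_coef {f g f' g' : L2} (h : ∀ k, coef k f * coef k g = coef k f' * coef k g') :
    inner ℝ f g = inner ℝ f' g' :=
  (hasSum_coef_mul f g).unique (by simpa only [h] using hasSum_coef_mul f' g')

lemma inner_bessel_left (f g : L2) : inner ℝ (bessel f) g = inner ℝ f (bessel g) :=
  inner_eq_of_coef fun k => by simp only [coef_bessel]; ring

lemma inner_proj_left (n : ℕ) (f g : L2) : inner ℝ (proj n f) g = inner ℝ f (proj n g) :=
  inner_eq_of_coef fun k => by simp only [coef_proj]; ring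

lemma inner_rough_left (n : ℕ) (f g : L2) : inner ℝ (rough n f) g = inner ℝ f (rough n g) :=
  inner_eq_of_coef fun k => by simp only [coef_rough]; ring

lemma isWeakPartial_bessel (j : Fin 2) (f : L2) : IsWeakPartial j (bessel f) (riesz j f) :=
  isWeakPartial_iff.2 fun k => by simp only [coef_riesz, coef_bessel, lam_neg]; ring

/-- The symbols add up to (1 + 4π²|k|²) / λ_k = 1. This is the reason (1 - Δ)^{-1/2} is isometric
from L² to H¹. -/
lemma norm_bessel_sq_add (f : L2) : ‖bessel f‖ ^ 2 + ∑ j, ‖riesz j f‖ ^ 2 = ‖f‖ ^ 2 := by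
  have h1 := hasSum_coef_sq (bessel f)
  have h2 : ∀ j, HasSum (fun k => coef (-k) (riesz j f) ^ 2) (‖riesz j f‖ ^ 2) := fun j =>
    ((Equiv.neg _).hasSum_iff (f := fun k => coef k (riesz j f) ^ 2)).2
      (hasSum_coef_sq (riesz j f))
  have h3 := h1.add (hasSum_sum (s := Finset.univ) fun j _ => h2 j)
  refine h3.unique ?_
  convert hasSum_coef_sq f using 2 with k
  simp only [coef_bessel, coef_riesz, lam_neg, neg_neg, mul_pow, ← Finset.sum_mul, inv_pow,
    Real.sq_sqrt (lam_pos k).le]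
  have h4 : (lam k)⁻¹ * lam k = 1 := inv_mul_cancel₀ (lam_pos k).ne'
  symm
  calc (coef k f) ^ 2 = (lam k)⁻¹ * lam k * coef k f ^ 2 := by rw [h4, one_mul]
    _ = (lam k)⁻¹ * (1 + ∑ j, (2 * Real.pi * k j) ^ 2) * coef k f ^ 2 := rfl
    _ = _ := by simp only [Fin.sum_univ_two, Pi.neg_apply]; push_cast; ring

lemma proj_eq_sum (n : ℕ) (f : L2) : proj n f = ∑ k ∈ box n, coef k f • casL k :=
  ext_coef fun k => by
    simp only [coef_proj, map_sum, map_smul, coef_casL, smul_eq_mul, mul_ite, mul_one, mul_zero,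
      Finset.sum_ite_eq]
    split_ifs <;> simp

lemma tendsto_proj (f : L2) : Tendsto (fun n => proj n f) atTop (𝓝 f) := by
  have h := casBasis.hasSum_repr f
  simp only [← coef_eq_repr, coe_casBasis] at h
  simpa only [proj_eq_sum, Function.comp_def] using h.comp tendsto_box

/-- The trigonometric polynomial `∑ k ∈ box n, f̂(k) cas k`. -/
noncomputable def trigFn (n : ℕ) (f : L2) (x : T2) : ℝ := ∑ k ∈ box n, coef k f * cas k x

lemma isSmooth_trigFn (n : ℕ) (f : L2) : IsSmooth (trigFn n f) :=
  IsSmooth.sum fun k => (isSmooth_cas k).const_mul _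

lemma pderiv_trigFn_bessel (n : ℕ) (j : Fin 2) (f : L2) (x : T2) :
    pderiv j (trigFn n (bessel f)) x = trigFn n (riesz j f) x := by
  have h1 : pderiv j (trigFn n (bessel f)) x
      = ∑ k ∈ box n, coef k (bessel f) * (2 * Real.pi * k j * cas (-k) x) := by
    unfold trigFn
    rw [pderiv_sum (fun k => (isSmooth_cas k).const_mul _)]
    simp only [pderiv_const_mul _ (isSmooth_cas _), pderiv_cas]
  rw [h1, trigFn]
  refine Finset.sum_nbij' (fun k => -k) (fun k => -k) (fun k hk => neg_mem_box.2 hk)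
    (fun k hk => neg_mem_box.2 hk) (fun k _ => neg_neg k) (fun k _ => neg_neg k) fun k _ => ?_
  simp only [coef_bessel, coef_riesz, lam_neg, neg_neg, Pi.neg_apply]
  push_cast
  ring

lemma coeFn_proj (n : ℕ) (f : L2) : proj n f =ᵐ[vol] trigFn n f := by
  have h : proj n f = contL2 (isSmooth_trigFn n f).continuous := by
    refine ext_coef fun k => ?_
    rw [coef_contL2, coef_proj]
    simp only [trigFn, Finset.sum_mul]
    rw [integral_finsetSum (f := fun l x => coef l f * cas l x * cas k x) _
      fun l _ => integrable_of_continuous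
        ((continuous_const.mul (continuous_cas l)).mul (continuous_cas k))]
    simp only [mul_assoc, integral_const_mul, integral_cas_mul_cas, mul_ite, mul_one, mul_zero,
      Finset.sum_ite_eq']
    split_ifs <;> simp
  rw [h]
  exact coeFn_contL2 _

/-! ### The spaces `H¹`, `H²` in terms of Fourier coefficients -/

/-- `(1 - Δ)^{-1/2}` as a map `L² → H¹`. -/
noncomputable def besselH1ₗ : L2 →ₗ[ℝ] H1 where
  toFun f := ⟨WithLp.toLp 2 (bessel f, WithLp.toLp 2 fun j => riesz j f),
    fun j => isWeakPartial_bessel j f⟩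
  map_add' f g := by ext1; simp; rfl
  map_smul' c f := by ext1; simp; rfl

lemma norm_besselH1ₗ (f : L2) : ‖besselH1ₗ f‖ = ‖f‖ := by
  have h : ‖besselH1ₗ f‖ ^ 2 = ‖f‖ ^ 2 := by
    rw [← norm_bessel_sq_add f]
    change ‖WithLp.toLp 2 (bessel f, (WithLp.toLp 2 fun j => riesz j f : L2Vec))‖ ^ 2 = _
    rw [WithLp.prod_norm_sq_eq_of_L2, PiLp.norm_sq_eq_of_L2]
    rfl
  exact (sq_eq_sq₀ (norm_nonneg _) (norm_nonneg _)).1 h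

/-- Finiteness of the H¹ norm makes √λ_k f̂(k) square summable, and these numbers are the
coefficients of the preimage. -/
lemma surjective_besselH1ₗ : Function.Surjective besselH1ₗ := by
  intro h
  have hw : ∀ j k, coef k (h.1.snd j) = -(2 * Real.pi * k j) * coef (-k) h.1.fst :=
    fun j => isWeakPartial_iff.1 (h.2 j)
  have hs : Summable fun k => (√(lam k) * coef k h.1.fst) ^ 2 := by
    have h1 : Summable fun k => coef k h.1.fst ^ 2 + ∑ j, coef (-k) (h.1.snd j) ^ 2 :=
      (summable_coef_sq _).add <| summable_sum fun j _ =>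
        ((Equiv.neg _).summable_iff (f := fun k => coef k (h.1.snd j) ^ 2)).2 (summable_coef_sq _)
    refine h1.congr fun k => ?_
    rw [mul_pow, Real.sq_sqrt (lam_pos k).le, lam]
    simp only [hw, neg_neg, Fin.sum_univ_two, Pi.neg_apply]
    push_cast
    ring
  obtain ⟨φ, hφ⟩ := exists_of_summable_sq hs
  refine ⟨φ, Subtype.ext ?_⟩
  have e1 : bessel φ = h.1.fst := ext_coef fun k => by
    rw [coef_bessel, hφ, inv_mul_cancel_left₀ (sqrt_lam_pos k).ne']
  have e2 : ∀ j, riesz j φ = h.1.snd j := fun j => ext_coef fun k => by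
    rw [coef_riesz, hφ, hw, lam_neg, mul_assoc, inv_mul_cancel_left₀ (sqrt_lam_pos k).ne']
  change WithLp.toLp 2 (bessel φ, (WithLp.toLp 2 fun j => riesz j φ : L2Vec)) = h.1
  simp only [e1, e2]
  rfl

/-- The isometry `(1 - Δ)^{-1/2} : L² → H¹`. -/
noncomputable def besselH1 : L2 ≃ₗᵢ[ℝ] H1 :=
  LinearIsometryEquiv.ofSurjective ⟨besselH1ₗ, norm_besselH1ₗ⟩ surjective_besselH1ₗ

@[simp] lemma fn_besselH1 (f : L2) : H1.fn (besselH1 f) = bessel f := rfl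

/-- `(1 - Δ)^{-1}` as a map `L² → H²`. -/
noncomputable def besselH2 : L2 →L[ℝ] H2 :=
  ContinuousLinearMap.codRestrict
    ((WithLp.prodContinuousLinearEquiv 2 ℝ L2 (PiLp 2 fun _ : Fin 2 => H1)).symm.toContinuousLinearMap.comp
      ((bessel.comp bessel).prod
        ((PiLp.continuousLinearEquiv 2 ℝ fun _ : Fin 2 => H1).symm.toContinuousLinearMap.comp
          (ContinuousLinearMap.pi fun j =>
            besselH1.toContinuousLinearEquiv.toContinuousLinearMap.comp (riesz j)))))
    H2Graph fun f j => by
      change IsWeakPartial j (bessel (bessel f)) (bessel (riesz j f))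
      rw [bessel_riesz]
      exact isWeakPartial_bessel j (bessel f)

/-- On symbols this is -4π²|k|² / λ_k = 1 / λ_k - 1, that is, Δ (1 - Δ)^{-1} = (1 - Δ)^{-1} - 1. -/
lemma sum_riesz_riesz (f : L2) : ∑ j, riesz j (riesz j f) = bessel (bessel f) - f := by
  refine ext_coef fun k => ?_
  rw [map_sum, map_sub]
  simp only [coef_riesz, coef_bessel, lam_neg, neg_neg, Fin.sum_univ_two, Pi.neg_apply]
  have h : (√(lam k))⁻¹ * (√(lam k))⁻¹ = (lam k)⁻¹ := by
    rw [← mul_inv, Real.mul_self_sqrt (lam_pos k).le]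
  have h2 : (2 * Real.pi * k 0) ^ 2 + (2 * Real.pi * k 1) ^ 2 = lam k - 1 := by
    simp [lam, Fin.sum_univ_two]
  have h3 : (lam k)⁻¹ * lam k = 1 := inv_mul_cancel₀ (lam_pos k).ne'
  push_cast
  calc _ = -(((2 * Real.pi * k 0) ^ 2 + (2 * Real.pi * k 1) ^ 2)
        * ((√(lam k))⁻¹ * (√(lam k))⁻¹)) * coef k f := by ring
    _ = ((√(lam k))⁻¹ * (√(lam k))⁻¹) * coef k f - ((lam k)⁻¹ * lam k) * coef k f := by
        rw [h2, h]; ring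
    _ = _ := by rw [h3]; ring

@[simp] lemma lap_besselH2 (f : L2) : H2.lap (besselH2 f) = bessel (bessel f) - f := by
  rw [← sum_riesz_riesz]; rfl

/-! ### Componentwise operators and solenoidal fields -/

section VecMap

variable {X Y : Type*} [NormedAddCommGroup X] [NormedSpace ℝ X] [NormedAddCommGroup Y]
  [NormedSpace ℝ Y]

/-- The operator `T` applied to both components. -/
noncomputable def vecMap (T : X →L[ℝ] Y) :
    PiLp 2 (fun _ : Fin 2 => X) →L[ℝ] PiLp 2 (fun _ : Fin 2 => Y) :=
  (PiLp.continuousLinearEquiv 2 ℝ fun _ : Fin 2 => Y).symm.toContinuousLinearMap.comp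
    (ContinuousLinearMap.pi fun i => T.comp (PiLp.proj 2 (fun _ : Fin 2 => X) i))

@[simp] lemma vecMap_apply (T : X →L[ℝ] Y) (w : PiLp 2 fun _ : Fin 2 => X) (i : Fin 2) :
    vecMap T w i = T (w i) := rfl

end VecMap

lemma IsTrigPoly.isSmooth {φ : T2 → ℝ} (h : IsTrigPoly φ) : IsSmooth φ := by
  obtain ⟨S, c, hc⟩ := h
  have h1 : φ ∘ toTorus
      = fun y => Complex.reCLM (∑ k ∈ S, c k * UnitAddTorus.mFourier k (toTorus y)) := by
    funext y
    rw [← hc, Complex.reCLM_apply, Complex.ofReal_re, Function.comp]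
  rw [IsSmooth, h1]
  exact Complex.reCLM.contDiff.comp
    (ContDiff.sum fun k _ => contDiff_const.mul (contDiff_mFourier_toTorus k))

lemma isTrigPoly_trigFn (n : ℕ) (f : L2) : IsTrigPoly (trigFn n f) := by
  -- The weights come from cas k = (1 - i)/2 e_k + (1 + i)/2 e_{-k}, after collecting the terms at k
  -- and at -k in the symmetric set `box n`.
  refine ⟨box n, fun k => (coef k f * ((1 - Complex.I) / 2) + coef (-k) f * ((1 + Complex.I) / 2)),
    fun x => ?_⟩
  have h1 : ∀ k, (cas k x : ℂ) = (1 - Complex.I) / 2 * mFourier k x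
      + (1 + Complex.I) / 2 * mFourier (-k) x := by
    intro k
    rw [mFourier_neg, cas]
    apply Complex.ext <;> simp <;> ring
  have h2 : ∑ k ∈ box n, (coef k f : ℂ) * ((1 + Complex.I) / 2 * mFourier (-k) x)
      = ∑ k ∈ box n, (coef (-k) f : ℂ) * ((1 + Complex.I) / 2 * mFourier k x) :=
    Finset.sum_nbij' (fun k => -k) (fun k => -k) (fun k hk => neg_mem_box.2 hk)
      (fun k hk => neg_mem_box.2 hk) (fun k _ => neg_neg k) (fun k _ => neg_neg k)
      fun k _ => by rw [neg_neg]
  rw [trigFn]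
  push_cast
  simp only [h1, mul_add, Finset.sum_add_distrib]
  rw [h2, ← Finset.sum_add_distrib]
  refine Finset.sum_congr rfl fun k _ => ?_
  ring

/-- Square integrable divergence free fields with zero average, via Fourier coefficients. -/
def solenoidal : Submodule ℝ L2Vec where
  carrier := {w | (∀ i, coef 0 (w i) = 0) ∧ ∀ k : Fin 2 → ℤ, ∑ j, (k j : ℝ) * coef k (w j) = 0}
  zero_mem' := by simp
  add_mem' := fun {a b} ha hb => by
    refine ⟨fun i => by simp [ha.1 i, hb.1 i], fun k => ?_⟩
    simp only [PiLp.add_apply, map_add, mul_add, Finset.sum_add_distrib, ha.2 k, hb.2 k, add_zero]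
  smul_mem' := fun c a ha => by
    refine ⟨fun i => by simp [ha.1 i], fun k => ?_⟩
    simp only [PiLp.smul_apply, map_smul, smul_eq_mul, mul_left_comm _ c, ← Finset.mul_sum,
      ha.2 k, mul_zero]

lemma mem_solenoidal {w : L2Vec} : w ∈ solenoidal ↔
    (∀ i, coef 0 (w i) = 0) ∧ ∀ k : Fin 2 → ℤ, ∑ j, (k j : ℝ) * coef k (w j) = 0 := Iff.rfl

lemma isClosed_solenoidal : IsClosed (solenoidal : Set L2Vec) := by
  have : (solenoidal : Set L2Vec) = (⋂ i, {w : L2Vec | coef 0 (w i) = 0}) ∩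
      ⋂ k : Fin 2 → ℤ, {w : L2Vec | ∑ j, (k j : ℝ) * coef k (w j) = 0} := by
    ext w; simp [mem_solenoidal]
  rw [this]
  refine IsClosed.inter (isClosed_iInter fun i => ?_) (isClosed_iInter fun k => ?_)
  · exact isClosed_eq (by fun_prop) continuous_const
  · exact isClosed_eq (by fun_prop) continuous_const

lemma mem_solenoidal_of_trigSolenoidal {w : L2Vec} {φ : Fin 2 → T2 → ℝ} (hφ : φ ∈ trigSolenoidal)
    (h : ∀ i, w i =ᵐ[vol] φ i) : w ∈ solenoidal := by
  have hc : ∀ i k, coef k (w i) = ∫ x, φ i x * cas k x ∂vol := by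
    intro i k
    rw [coef_eq_integral]
    refine integral_congr_ae ?_
    filter_upwards [h i] with x hx
    rw [hx]
  obtain ⟨h1, h2, h3⟩ := hφ
  refine ⟨fun i => ?_, fun k => ?_⟩
  · rw [hc, ← h3 i]
    simp [cas, mFourier_zero]
  · have e : ∀ j, ((k j : ℝ)) * coef k (w j)
        = (2 * Real.pi)⁻¹ * ∫ x, pderiv j (φ j) x * cas (-k) x ∂vol := by
      intro j
      have := integral_mul_pderiv (h1 j).isSmooth (isSmooth_cas (-k)) j
      rw [eq_comm, neg_eq_iff_eq_neg] at this
      rw [this, hc, ← integral_neg, ← integral_const_mul, ← integral_const_mul]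
      congr 1
      funext x
      rw [pderiv_cas, neg_neg, Pi.neg_apply]
      push_cast
      field_simp
    simp only [e, ← Finset.mul_sum]
    rw [← integral_finsetSum (f := fun j x => pderiv j (φ j) x * cas (-k) x) _
      fun j _ => integrable_of_continuous (((h1 j).isSmooth.continuous_pderiv j).mul (continuous_cas _))]
    simp only [← Finset.sum_mul, h2, zero_mul, integral_zero, mul_zero]

lemma trigFn_mem_trigSolenoidal {w : L2Vec} (hw : w ∈ solenoidal) (n : ℕ) :
    (fun i => trigFn n (w i)) ∈ trigSolenoidal := by
  refine ⟨fun i => isTrigPoly_trigFn n (w i), fun x => ?_, fun i => ?_⟩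
  · have h1 : ∀ j, pderiv j (trigFn n (w j)) x
        = ∑ k ∈ box n, coef k (w j) * (2 * Real.pi * k j * cas (-k) x) := by
      intro j
      unfold trigFn
      rw [pderiv_sum (fun k => (isSmooth_cas k).const_mul _)]
      simp only [pderiv_const_mul _ (isSmooth_cas _), pderiv_cas]
    simp only [h1]
    rw [Finset.sum_comm]
    refine Finset.sum_eq_zero fun k _ => ?_
    have := hw.2 k
    rw [Fin.sum_univ_two] at this ⊢
    linear_combination 2 * Real.pi * cas (-k) x * this
  · have h1 : ∫ x, trigFn n (w i) x ∂vol = coef 0 (proj n (w i)) := by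
      rw [coef_eq_integral]
      refine integral_congr_ae ?_
      filter_upwards [coeFn_proj n (w i)] with x hx
      rw [hx]
      simp [cas, mFourier_zero]
    rw [h1, coef_proj, hw.1 i, mul_zero]

lemma tendsto_vecMap_proj (w : L2Vec) : Tendsto (fun n => vecMap (proj n) w) atTop (𝓝 w) := by
  refine ((PiLp.continuous_toLp 2 _).tendsto (w : Fin 2 → L2)).comp ?_
  exact tendsto_pi_nhds.2 fun i => tendsto_proj (w i)

/-- The Fourier conditions are closed and hold on 𝒱. Conversely, the truncations of a field that
satisfies them lie in 𝒱 and converge to it. -/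
lemma mem_HSpace_iff {w : L2Vec} : w ∈ HSpace ↔ w ∈ solenoidal := by
  constructor
  · intro h
    refine Submodule.topologicalClosure_minimal _ (Submodule.span_le.2 ?_) isClosed_solenoidal h
    rintro w ⟨φ, hφ, hw⟩
    exact mem_solenoidal_of_trigSolenoidal hφ hw
  · intro h
    refine mem_closure_of_tendsto (tendsto_vecMap_proj w) (Eventually.of_forall fun n => ?_)
    exact Submodule.subset_span ⟨_, trigFn_mem_trigSolenoidal h n, fun i => coeFn_proj n (w i)⟩

/-- `T` acts on the `k`-th coefficient by a multiplication. -/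
def IsMultiplier (T : L2 →L[ℝ] L2) : Prop := ∃ m : (Fin 2 → ℤ) → ℝ, ∀ f k, coef k (T f) = m k * coef k f

lemma isMultiplier_bessel : IsMultiplier bessel := ⟨_, coef_bessel⟩
lemma isMultiplier_proj (n : ℕ) : IsMultiplier (proj n) := ⟨_, coef_proj n⟩
lemma isMultiplier_rough (n : ℕ) : IsMultiplier (rough n) := ⟨_, coef_rough n⟩

lemma IsMultiplier.vecMap_mem {T : L2 →L[ℝ] L2} (hT : IsMultiplier T) {w : L2Vec}
    (hw : w ∈ HSpace) : vecMap T w ∈ HSpace := by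
  rw [mem_HSpace_iff] at hw ⊢
  obtain ⟨m, hm⟩ := hT
  refine ⟨fun i => ?_, fun k => ?_⟩
  · rw [vecMap_apply, hm, hw.1 i, mul_zero]
  · simp only [vecMap_apply, hm, mul_left_comm _ (m k), ← Finset.mul_sum, hw.2 k, mul_zero]

/-- The symbol of (1 - Δ)^{-1/2} never vanishes, so it can be divided out of the linear conditions
on the coefficients. -/
lemma mem_HSpace_of_bessel {w : L2Vec} (hw : vecMap bessel w ∈ HSpace) : w ∈ HSpace := by
  rw [mem_HSpace_iff] at hw ⊢
  have h0 : ∀ k, (√(lam k))⁻¹ ≠ 0 := fun k => (inv_pos.2 (sqrt_lam_pos k)).ne'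
  refine ⟨fun i => ?_, fun k => ?_⟩
  · have := hw.1 i
    rw [vecMap_apply, coef_bessel] at this
    exact (mul_eq_zero.1 this).resolve_left (h0 0)
  · have := hw.2 k
    simp only [vecMap_apply, coef_bessel, mul_left_comm _ (√(lam k))⁻¹, ← Finset.mul_sum] at this
    exact (mul_eq_zero.1 this).resolve_left (h0 k)

/-- `(1 - Δ)^{-1/2} : (L²)² → (H¹)²`. -/
noncomputable abbrev besselVec : L2Vec →L[ℝ] H1Vec :=
  vecMap besselH1.toContinuousLinearEquiv.toContinuousLinearMap

lemma besselVec_mem {w : L2Vec} (hw : w ∈ HSpace) : besselVec w ∈ VSpace := by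
  have h : Tendsto (fun n => besselVec (vecMap (proj n) w)) atTop (𝓝 (besselVec w)) :=
    (besselVec.continuous.tendsto w).comp (tendsto_vecMap_proj w)
  refine mem_closure_of_tendsto h (Eventually.of_forall fun n => Submodule.subset_span ?_)
  refine ⟨_, trigFn_mem_trigSolenoidal
    (mem_HSpace_iff.1 (isMultiplier_bessel.vecMap_mem hw)) n, fun i => ?_⟩
  change (bessel (proj n (w i)) : L2) =ᵐ[vol] _
  rw [bessel_proj]
  exact coeFn_proj n _

/-- Invert the isometry componentwise; the result is solenoidal because its smoothed version, the L²
field of v, is. Together with `besselVec_mem` this replaces V by H, so data in V become points of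
the phase space. -/
lemma exists_besselVec {v : H1Vec} (hv : v ∈ VSpace) : ∃ w ∈ HSpace, besselVec w = v := by
  refine ⟨WithLp.toLp 2 fun i => besselH1.symm (v i), ?_, ?_⟩
  · apply mem_HSpace_of_bessel
    have h1 : vecMap bessel (WithLp.toLp 2 fun i => besselH1.symm (v i)) = vecMap H1.fn v := by
      ext1 i
      change bessel (besselH1.symm (v i)) = H1.fn (v i)
      rw [← fn_besselH1, LinearIsometryEquiv.apply_symm_apply]
    rw [h1, mem_HSpace_iff]
    have h2 : VSpace ≤ solenoidal.comap (vecMap H1.fn).toLinearMap := by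
      refine Submodule.topologicalClosure_minimal _ (Submodule.span_le.2 ?_)
        (isClosed_solenoidal.preimage (vecMap H1.fn).continuous)
      rintro w ⟨φ, hφ, hw⟩
      exact mem_solenoidal_of_trigSolenoidal hφ hw
    exact h2 hv
  · ext1 i
    exact besselH1.apply_symm_apply (v i)

lemma leray_eq_self {w : L2Vec} (hw : w ∈ HSpace) : leray w = w :=
  Submodule.starProjection_eq_self_iff.2 hw

/-- The sum is the divergence of (1 - Δ)^{-1/2} w, so its k-th coefficient is the solenoidal
condition at frequency -k. -/
lemma sum_riesz_eq_zero {w : L2Vec} (hw : w ∈ HSpace) : ∑ j, riesz j (w j) = 0 := by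
  rw [mem_HSpace_iff] at hw
  refine ext_coef fun k => ?_
  have := hw.2 (-k)
  rw [map_sum, map_zero]
  simp only [coef_riesz]
  rw [Fin.sum_univ_two] at this ⊢
  simp only [Pi.neg_apply] at this
  push_cast at this
  linear_combination 2 * Real.pi * (√(lam k))⁻¹ * this

/-! ### Ladyzhenskaya's inequality and the embeddings into `L⁴` and `L^∞` -/

lemma intervalIntegral_coe_circle (f : UnitAddCircle → ℝ) :
    ∫ r in (0 : ℝ)..1, f (r : UnitAddCircle) = ∫ b, f b ∂AddCircle.haarAddCircle := by
  rw [AddCircle.integral_haarAddCircle, inv_one, one_smul, ← UnitAddCircle.intervalIntegral_preimage 0,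
    zero_add]

/-- Write h(0)² as h(s)² minus the integral of 2 h h' over [0,s], enlarge that integral to all of
[0,1], and average over s. This is the one-dimensional bound behind Ladyzhenskaya's inequality. -/
lemma sq_le_integral_of_hasDerivAt {h h' : ℝ → ℝ} (hd : ∀ s, HasDerivAt h (h' s) s)
    (hc : Continuous h') :
    h 0 ^ 2 ≤ ∫ s in (0 : ℝ)..1, (h s ^ 2 + 2 * |h s * h' s|) := by
  have hh : Continuous h := continuous_iff_continuousAt.2 fun s => (hd s).continuousAt
  have hi : ∀ a b, IntervalIntegrable (fun s => 2 * |h s * h' s|) volume a b := fun a b =>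
    (continuous_const.mul (hh.mul hc).abs).intervalIntegrable a b
  have h1 : ∀ s ∈ Icc (0 : ℝ) 1, h 0 ^ 2 ≤ h s ^ 2 + ∫ r in (0 : ℝ)..1, 2 * |h r * h' r| := by
    intro s hs
    have e : ∫ r in (0 : ℝ)..s, 2 * (h r * h' r) = h s ^ 2 - h 0 ^ 2 := by
      refine intervalIntegral.integral_eq_sub_of_hasDerivAt (f := fun r => h r ^ 2) (fun r _ => ?_)
        ((continuous_const.mul (hh.mul hc)).intervalIntegrable _ _)
      refine ((hd r).pow 2).congr_deriv ?_
      simp [mul_assoc]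
    have e2 : |∫ r in (0 : ℝ)..s, 2 * (h r * h' r)| ≤ ∫ r in (0 : ℝ)..s, 2 * |h r * h' r| := by
      refine (intervalIntegral.abs_integral_le_integral_abs hs.1).trans_eq ?_
      simp only [abs_mul, abs_two]
    have e3 : ∫ r in (0 : ℝ)..s, 2 * |h r * h' r| ≤ ∫ r in (0 : ℝ)..1, 2 * |h r * h' r| :=
      intervalIntegral.integral_mono_interval le_rfl hs.1 hs.2
        (Eventually.of_forall fun r => by positivity) (hi 0 1)
    rw [e] at e2
    linarith [neg_abs_le (h s ^ 2 - h 0 ^ 2)]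
  have h2 : ∫ s in (0 : ℝ)..1, h 0 ^ 2
      ≤ ∫ s in (0 : ℝ)..1, (h s ^ 2 + ∫ r in (0 : ℝ)..1, 2 * |h r * h' r|) :=
    intervalIntegral.integral_mono_on zero_le_one (by simp)
      (((hh.pow 2).add continuous_const).intervalIntegrable _ _) h1
  rw [intervalIntegral.integral_add (f := fun s => h s ^ 2)
    ((hh.pow 2).intervalIntegrable _ _) (by simp)] at h2
  rw [intervalIntegral.integral_add (f := fun s => h s ^ 2)
    ((hh.pow 2).intervalIntegrable _ _) (hi 0 1)]
  simpa using h2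

lemma IsSmooth.sq_le_integral_line {φ : T2 → ℝ} (h : IsSmooth φ) (j : Fin 2) (x : T2) :
    φ x ^ 2 ≤ ∫ b, (fun y => φ y ^ 2 + 2 * |φ y * pderiv j φ y|) (x + Pi.single j b)
      ∂AddCircle.haarAddCircle := by
  rw [← intervalIntegral_coe_circle]
  have := sq_le_integral_of_hasDerivAt (fun s => h.hasDerivAt j x s)
    ((h.continuous_pderiv j).comp
      (continuous_const.add ((continuous_single j).comp (AddCircle.continuous_mk' 1))))
  simpa using this

lemma integral_vol_eq (F : T2 → ℝ) :
    ∫ x, F x ∂vol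
      = ∫ z, F ![z.1, z.2] ∂(AddCircle.haarAddCircle.prod (AddCircle.haarAddCircle (T := 1))) := by
  rw [← (measurePreserving_finTwoArrow (AddCircle.haarAddCircle (T := 1))).integral_comp'
    (fun z => F ![z.1, z.2])]
  refine integral_congr_ae (Eventually.of_forall fun x => ?_)
  simp only [MeasurableEquiv.finTwoArrow, MeasurableEquiv.piFinTwo]
  congr 1
  funext i
  fin_cases i <;> rfl

/-- Ladyzhenskaya's inequality for smooth functions. -/
lemma IsSmooth.integral_pow_four_le {φ : T2 → ℝ} (h : IsSmooth φ) :
    ∫ x, φ x ^ 4 ∂vol ≤ ∏ j, ∫ x, (φ x ^ 2 + 2 * |φ x * pderiv j φ x|) ∂vol := by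
  let μ : Measure UnitAddCircle := AddCircle.haarAddCircle
  let G : Fin 2 → T2 → ℝ := fun j y => φ y ^ 2 + 2 * |φ y * pderiv j φ y|
  have hG : ∀ j, Continuous (G j) := fun j => (h.continuous.pow 2).add
    (continuous_const.mul (h.continuous.mul (h.continuous_pderiv j)).abs)
  have hv : Continuous fun z : UnitAddCircle × UnitAddCircle => (![z.1, z.2] : T2) := by
    refine continuous_pi fun i => ?_
    fin_cases i
    · exact continuous_fst
    · exact continuous_snd
  have int2 : ∀ {F : UnitAddCircle × UnitAddCircle → ℝ}, Continuous F → Integrable F (μ.prod μ) := by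
    intro F hF
    obtain ⟨C, hC⟩ := isCompact_univ.exists_bound_of_continuousOn hF.continuousOn
    exact Integrable.of_bound hF.aestronglyMeasurable C
      (Eventually.of_forall fun x => hC x (mem_univ x))
  let A : UnitAddCircle → ℝ := fun d => ∫ a, G 0 ![a, d] ∂μ
  let B : UnitAddCircle → ℝ := fun c => ∫ b, G 1 ![c, b] ∂μ
  -- Integrating along a full line removes the coordinate c from this bound, and the next bound
  -- loses d in the same way. Their product dominates φ⁴ and its integral factors.
  have hA : ∀ c d, φ ![c, d] ^ 2 ≤ A d := by
    intro c d
    refine (h.sq_le_integral_line 0 ![c, d]).trans_eq ?_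
    have : ∀ b : UnitAddCircle, (![c, d] : T2) + (Pi.single 0 b : T2) = ![c + b, d] := by
      intro b; funext i; fin_cases i <;> simp
    simp only [this]
    exact integral_add_left_eq_self (fun a => G 0 ![a, d]) c
  have hB : ∀ c d, φ ![c, d] ^ 2 ≤ B c := by
    intro c d
    refine (h.sq_le_integral_line 1 ![c, d]).trans_eq ?_
    have : ∀ b : UnitAddCircle, (![c, d] : T2) + (Pi.single 1 b : T2) = ![c, d + b] := by
      intro b; funext i; fin_cases i <;> simp
    simp only [this]
    exact integral_add_left_eq_self (fun a => G 1 ![c, a]) d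
  have iA : ∫ d, A d ∂μ = ∫ x, G 0 x ∂vol := by
    rw [integral_vol_eq]
    exact (integral_prod_symm _ (int2 ((hG 0).comp hv))).symm
  have iB : ∫ c, B c ∂μ = ∫ x, G 1 x ∂vol := by
    rw [integral_vol_eq]
    exact (integral_prod _ (int2 ((hG 1).comp hv))).symm
  have intA : Integrable A μ := (int2 ((hG 0).comp hv)).integral_prod_right
  have intB : Integrable B μ := (int2 ((hG 1).comp hv)).integral_prod_left
  calc ∫ x, φ x ^ 4 ∂vol = ∫ z, φ ![z.1, z.2] ^ 4 ∂(μ.prod μ) := integral_vol_eq _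
    _ ≤ ∫ z, B z.1 * A z.2 ∂(μ.prod μ) := by
        refine integral_mono (int2 ((h.continuous.comp hv).pow 4)) (intB.mul_prod intA) fun z => ?_
        have e1 := hA z.1 z.2
        have e2 := hB z.1 z.2
        calc φ ![z.1, z.2] ^ 4 = φ ![z.1, z.2] ^ 2 * φ ![z.1, z.2] ^ 2 := by ring
          _ ≤ B z.1 * A z.2 := mul_le_mul e2 e1 (sq_nonneg _) ((sq_nonneg _).trans e2)
    _ = (∫ c, B c ∂μ) * ∫ d, A d ∂μ := integral_prod_mul B A
    _ = _ := by rw [iA, iB, Fin.prod_univ_two, mul_comm]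

lemma integrable_mul_L2 (f g : L2) : Integrable (fun x => f x * g x) vol :=
  (Lp.memLp f).integrable_mul (Lp.memLp g)

lemma integral_abs_mul_le (f g : L2) : ∫ x, |f x * g x| ∂vol ≤ ‖f‖ * ‖g‖ := by
  have h : ∫ x, |f x * g x| ∂vol = inner ℝ |f| |g| := by
    rw [L2.inner_def]
    refine integral_congr_ae ?_
    filter_upwards [Lp.coeFn_abs f, Lp.coeFn_abs g] with x h1 h2
    simp [h1, h2, abs_mul, mul_comm]
  rw [h, ← norm_abs_eq_norm f, ← norm_abs_eq_norm g]
  exact real_inner_le_norm _ _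

lemma integral_sq_L2 (f : L2) : ∫ x, f x ^ 2 ∂vol = ‖f‖ ^ 2 := by
  rw [← real_inner_self_eq_norm_sq, L2.inner_def]
  simp [sq]

/-- Each of the two factors is at most ‖a‖² + 2‖a‖‖d‖, where a and d are the truncations of `bessel
f` and of its derivative. Both ‖a‖² and ‖a‖‖d‖ are at most ‖bessel f‖‖f‖, whence the 3. -/
lemma integral_trigFn_pow_four_le (n : ℕ) (f : L2) :
    ∫ x, trigFn n (bessel f) x ^ 4 ∂vol ≤ (3 * ‖bessel f‖ * ‖f‖) ^ 2 := by
  refine (isSmooth_trigFn n (bessel f)).integral_pow_four_le.trans ?_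
  have h : ∀ j, ∫ x, (trigFn n (bessel f) x ^ 2
      + 2 * |trigFn n (bessel f) x * pderiv j (trigFn n (bessel f)) x|) ∂vol
      ≤ 3 * ‖bessel f‖ * ‖f‖ := by
    intro j
    let a := proj n (bessel f)
    let d := proj n (riesz j f)
    have e : ∫ x, (trigFn n (bessel f) x ^ 2
        + 2 * |trigFn n (bessel f) x * pderiv j (trigFn n (bessel f)) x|) ∂vol
        = ∫ x, (a x ^ 2 + 2 * |a x * d x|) ∂vol := by
      refine integral_congr_ae ?_
      filter_upwards [coeFn_proj n (bessel f), coeFn_proj n (riesz j f)] with x h1 h2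
      rw [h1, h2, pderiv_trigFn_bessel]
    rw [e, integral_add (by simpa [sq] using integrable_mul_L2 a a)
      ((integrable_mul_L2 a d).abs.const_mul 2), integral_const_mul, integral_sq_L2]
    have h1 := integral_abs_mul_le a d
    have h2 : ‖a‖ ≤ ‖bessel f‖ := norm_proj_le n _
    have h3 : ‖d‖ ≤ ‖f‖ := (norm_proj_le n _).trans (norm_riesz_le j f)
    have h4 : ‖a‖ * ‖d‖ ≤ ‖bessel f‖ * ‖f‖ := by gcongr
    have h5 : ‖a‖ ^ 2 ≤ ‖bessel f‖ * ‖f‖ := by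
      rw [sq]
      exact mul_le_mul h2 (h2.trans (norm_bessel_le f)) (norm_nonneg _) (norm_nonneg _)
    linarith
  rw [sq, Fin.prod_univ_two]
  refine mul_le_mul (h 0) (h 1) (integral_nonneg fun x => by positivity) (by positivity)

/-- Fatou's lemma along an almost everywhere convergent subsequence. It carries bounds proved for
trigonometric polynomials over to their L² limits. -/
lemma eLpNorm_le_of_tendsto {p : ℝ≥0∞} {f : ℕ → L2} {g : L2} {C : ℝ≥0∞}
    (h : Tendsto f atTop (𝓝 g)) (hC : ∀ n, eLpNorm (f n) p vol ≤ C) : eLpNorm g p vol ≤ C := by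
  obtain ⟨ns, -, hns⟩ := (tendstoInMeasure_of_tendsto_Lp h).exists_seq_tendsto_ae
  refine (Lp.eLpNorm_lim_le_liminf_eLpNorm
    (fun n => Lp.aestronglyMeasurable (f (ns n))) _ hns).trans ?_
  exact liminf_le_of_le (by isBoundedDefault) fun b hb => by
    obtain ⟨n, hn⟩ := hb.exists
    exact hn.trans (hC _)

lemma eLpNorm_four_bessel_le (f : L2) :
    eLpNorm (bessel f) 4 vol ≤ ENNReal.ofReal √(3 * ‖bessel f‖ * ‖f‖) := by
  refine eLpNorm_le_of_tendsto (tendsto_proj (bessel f)) fun n => ?_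
  rw [eLpNorm_congr_ae (coeFn_proj n _)]
  have hc := (isSmooth_trigFn n (bessel f)).continuous
  obtain ⟨C, hC⟩ := isCompact_univ.exists_bound_of_continuousOn hc.continuousOn
  have hm : MemLp (trigFn n (bessel f)) 4 vol :=
    MemLp.of_bound hc.aestronglyMeasurable C (Eventually.of_forall fun x => hC x (mem_univ x))
  rw [hm.eLpNorm_eq_integral_rpow_norm (by norm_num) (by norm_num)]
  refine ENNReal.ofReal_le_ofReal ?_
  have e4 : (4 : ℝ≥0∞).toReal = (4 : ℕ) := by norm_num
  have e : ∀ x, ‖trigFn n (bessel f) x‖ ^ (4 : ℝ≥0∞).toReal = trigFn n (bessel f) x ^ 4 := by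
    intro x
    rw [e4, Real.rpow_natCast, Real.norm_eq_abs]
    exact (by decide : Even 4).pow_abs _
  simp only [e]
  have h0 : (0 : ℝ) ≤ 3 * ‖bessel f‖ * ‖f‖ := by positivity
  refine (Real.rpow_le_rpow (integral_nonneg fun x => by positivity)
    (integral_trigFn_pow_four_le n f) (by positivity)).trans_eq ?_
  rw [← Real.rpow_natCast, ← Real.rpow_mul h0, Real.sqrt_eq_rpow]
  norm_num

/-- Away from k = 0 one has λ_k ≥ ‖k‖², and ∑ ‖k‖^{-4} converges because 4 exceeds the dimension 2.
This is what puts H² inside L^∞. -/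
lemma summable_inv_lam_sq : Summable fun k : Fin 2 → ℤ => ((lam k)⁻¹) ^ 2 := by
  refine Summable.of_norm_bounded_eventually
    (EisensteinSeries.summable_one_div_norm_rpow (k := 4) (by norm_num)) ?_
  have : ∀ᶠ k : Fin 2 → ℤ in cofinite, k ≠ 0 := by simp
  filter_upwards [this] with k hk
  have h0 : 0 < ‖k‖ := norm_pos_iff.2 hk
  have h1 : ‖k‖ ^ 2 ≤ lam k := by
    obtain ⟨j, -, hj⟩ := Finset.exists_mem_eq_sup' (Finset.univ_nonempty (α := Fin 2)) fun j => ‖k j‖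
    have hk : ‖k‖ ≤ ‖k j‖ := by
      rw [pi_norm_le_iff_of_nonneg (norm_nonneg _)]
      intro i
      rw [← hj]
      exact Finset.le_sup' (fun j => ‖k j‖) (Finset.mem_univ i)
    have h2 : ‖k j‖ ≤ |2 * Real.pi * k j| := by
      rw [abs_mul, Int.norm_eq_abs]
      refine le_mul_of_one_le_left (abs_nonneg _) ?_
      rw [abs_of_pos Real.two_pi_pos]
      linarith [Real.pi_gt_three]
    rw [← Real.sq_sqrt (lam_pos k).le]
    gcongr
    exact hk.trans (h2.trans (abs_le_sqrt_lam k j))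
  rw [Real.norm_of_nonneg (by positivity), Real.rpow_neg h0.le, inv_pow]
  refine inv_anti₀ (by positivity) ?_
  calc ‖k‖ ^ (4 : ℝ) = (‖k‖ ^ 2) ^ 2 := by rw [← pow_mul]; exact_mod_cast Real.rpow_natCast ‖k‖ 4
    _ ≤ lam k ^ 2 := by gcongr

lemma abs_cas_le (k : Fin 2 → ℤ) (x : T2) : |cas k x| ≤ 2 := by
  have h : ‖mFourier k x‖ ≤ 1 := by simpa [mFourier_norm] using (mFourier k).norm_coe_le_norm x
  refine (abs_add_le _ _).trans ?_
  linarith [Complex.abs_re_le_norm (mFourier k x), Complex.abs_im_le_norm (mFourier k x)]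

lemma eLpNorm_top_bessel_bessel_le : ∃ C : ℝ, 0 ≤ C ∧ ∀ f : L2,
    eLpNorm (bessel (bessel f)) ∞ vol ≤ ENNReal.ofReal (C * ‖f‖) := by
  let S := ∑' k : Fin 2 → ℤ, ((lam k)⁻¹) ^ 2
  refine ⟨2 * √S, by positivity, fun f => ?_⟩
  refine eLpNorm_le_of_tendsto (tendsto_proj (bessel (bessel f))) fun n => ?_
  rw [eLpNorm_congr_ae (coeFn_proj n _), eLpNorm_exponent_top]
  refine eLpNormEssSup_le_of_ae_bound (Eventually.of_forall fun x => ?_)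
  have h1 : ∀ k, coef k (bessel (bessel f)) = (lam k)⁻¹ * coef k f := by
    intro k
    rw [coef_bessel, coef_bessel, ← mul_assoc, ← mul_inv, Real.mul_self_sqrt (lam_pos k).le]
  -- Cauchy–Schwarz against the square summable sequence 1 / λ_k, uniformly in the truncation.
  have h2 : ∑ k ∈ box n, (lam k)⁻¹ * |coef k f| ≤ √S * ‖f‖ := by
    refine abs_le_of_sq_le_sq' ?_ (by positivity) |>.2
    refine (Finset.sum_mul_sq_le_sq_mul_sq _ _ _).trans ?_
    rw [mul_pow, Real.sq_sqrt (tsum_nonneg fun k => sq_nonneg _)]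
    refine mul_le_mul (summable_inv_lam_sq.sum_le_tsum _ fun k _ => sq_nonneg _) ?_
      (Finset.sum_nonneg fun k _ => sq_nonneg _) (tsum_nonneg fun k => sq_nonneg _)
    simp only [sq_abs]
    exact sum_le_hasSum _ (fun k _ => sq_nonneg _) (hasSum_coef_sq f)
  calc ‖trigFn n (bessel (bessel f)) x‖
      ≤ ∑ k ∈ box n, ‖coef k (bessel (bessel f)) * cas k x‖ := norm_sum_le _ _
    _ ≤ ∑ k ∈ box n, (lam k)⁻¹ * |coef k f| * 2 := by
        refine Finset.sum_le_sum fun k _ => ?_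
        rw [h1, norm_mul, Real.norm_eq_abs, Real.norm_eq_abs, abs_mul,
          abs_of_pos (inv_pos.2 (lam_pos k))]
        have := abs_cas_le k x
        have h0 := inv_pos.2 (lam_pos k)
        gcongr
    _ ≤ 2 * √S * ‖f‖ := by rw [← Finset.sum_mul]; linarith

lemma exists_clm_Lp {p : ℝ≥0∞} [Fact (1 ≤ p)] (T : L2 →L[ℝ] L2) (C : ℝ) (hC : 0 ≤ C)
    (h : ∀ f, eLpNorm (T f) p vol ≤ ENNReal.ofReal (C * ‖f‖)) :
    ∃ S : L2 →L[ℝ] Lp ℝ p vol, ∀ f, S f =ᵐ[vol] T f := by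
  have hm : ∀ f, MemLp (T f) p vol := fun f =>
    ⟨Lp.aestronglyMeasurable _, (h f).trans_lt ENNReal.ofReal_lt_top⟩
  let SL : L2 →ₗ[ℝ] Lp ℝ p vol :=
    { toFun := fun f => (hm f).toLp
      map_add' := fun f g => by
        rw [← MemLp.toLp_add]
        refine MemLp.toLp_congr _ _ ?_
        rw [map_add]
        exact Lp.coeFn_add _ _
      map_smul' := fun c f => by
        rw [RingHom.id_apply, ← MemLp.toLp_const_smul]
        refine MemLp.toLp_congr _ _ ?_
        rw [map_smul]
        exact Lp.coeFn_smul _ _ }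
  refine ⟨SL.mkContinuous C fun f => ?_, fun f => (hm f).coeFn_toLp⟩
  change ‖(hm f).toLp‖ ≤ _
  rw [Lp.norm_toLp]
  exact ENNReal.toReal_le_of_le_ofReal (by positivity) (h f)

instance : Fact ((1 : ℝ≥0∞) ≤ 4) := ⟨by norm_num⟩

lemma exists_besselL4 : ∃ S : L2 →L[ℝ] Lp ℝ 4 vol, ∀ f, S f =ᵐ[vol] bessel f := by
  refine exists_clm_Lp bessel √3 (by positivity) fun f => (eLpNorm_four_bessel_le f).trans ?_
  refine ENNReal.ofReal_le_ofReal ?_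
  rw [Real.sqrt_le_left (by positivity), mul_pow, Real.sq_sqrt (by norm_num), mul_assoc, sq]
  gcongr
  exact norm_bessel_le f

/-- `(1 - Δ)^{-1/2} : L² → L⁴`. -/
noncomputable def besselL4 : L2 →L[ℝ] Lp ℝ 4 vol := exists_besselL4.choose

lemma coeFn_besselL4 (f : L2) : besselL4 f =ᵐ[vol] bessel f := exists_besselL4.choose_spec f

lemma norm_besselL4_sq_le (f : L2) : ‖besselL4 f‖ ^ 2 ≤ 3 * ‖bessel f‖ * ‖f‖ := by
  rw [← Real.le_sqrt (norm_nonneg _) (by positivity), Lp.norm_def, eLpNorm_congr_ae (coeFn_besselL4 f)]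
  exact ENNReal.toReal_le_of_le_ofReal (by positivity) (eLpNorm_four_bessel_le f)

lemma exists_besselLinf :
    ∃ S : L2 →L[ℝ] Lp ℝ ∞ vol, ∀ f, S f =ᵐ[vol] bessel (bessel f) := by
  obtain ⟨C, hC, h⟩ := eLpNorm_top_bessel_bessel_le
  exact exists_clm_Lp (bessel.comp bessel) C hC h

/-- `(1 - Δ)^{-1} : L² → L^∞`. -/
noncomputable def besselLinf : L2 →L[ℝ] Lp ℝ ∞ vol := exists_besselLinf.choose

lemma coeFn_besselLinf (f : L2) : besselLinf f =ᵐ[vol] bessel (bessel f) :=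
  exists_besselLinf.choose_spec f

/-! ### Ordinary differential equations with a priori bounds -/

/-- `G` is Lipschitz on balls around the origin. -/
def IsLipschitzOnBalls {E F : Type*} [NormedAddCommGroup E] [NormedAddCommGroup F] (G : E → F) : Prop :=
  ∀ R : ℝ, ∃ C : ℝ, 0 ≤ C ∧ ∀ x y, ‖x‖ ≤ R → ‖y‖ ≤ R → ‖G x - G y‖ ≤ C * ‖x - y‖

lemma IsLipschitzOnBalls.continuous {E F : Type*} [NormedAddCommGroup E] [NormedAddCommGroup F] {G : E → F}
    (h : IsLipschitzOnBalls G) : Continuous G := by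
  rw [continuous_iff_continuousAt]
  intro x
  obtain ⟨C, hC, hG⟩ := h (‖x‖ + 1)
  have h1 : Tendsto (fun y => C * ‖y - x‖) (𝓝 x) (𝓝 0) := by
    have : Continuous fun y => C * ‖y - x‖ := by fun_prop
    simpa using this.tendsto x
  rw [ContinuousAt, tendsto_iff_norm_sub_tendsto_zero]
  refine squeeze_zero' (Eventually.of_forall fun _ => norm_nonneg _) ?_ h1
  filter_upwards [Metric.ball_mem_nhds x one_pos] with y hy
  rw [Metric.mem_ball, dist_eq_norm] at hy
  refine hG y x ?_ (by linarith)
  linarith [norm_sub_norm_le y x]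

section ODE

variable {E : Type*} [NormedAddCommGroup E] [NormedSpace ℝ E]

/-- `x` solves `x' = G x` on `[0,τ]`. -/
structure IsFlowLine (G : E → E) (τ : ℝ) (x : ℝ → E) : Prop where
  continuousOn : ContinuousOn x (Icc 0 τ)
  hasDerivAt : ∀ t ∈ Ioo 0 τ, HasDerivAt x (G (x t)) t

lemma IsFlowLine.mono {G : E → E} {τ σ : ℝ} {x : ℝ → E} (h : IsFlowLine G τ x) (hσ : σ ≤ τ) :
    IsFlowLine G σ x :=
  ⟨h.continuousOn.mono (Icc_subset_Icc_right hσ),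
    fun t ht => h.hasDerivAt t ⟨ht.1, ht.2.trans_le hσ⟩⟩

lemma exists_isFlowLine_of_bounded [CompleteSpace E] {H : E → E} {C M : ℝ}
    (hC : ∀ x y, ‖H x - H y‖ ≤ C * ‖x - y‖) (hM : ∀ x, ‖H x‖ ≤ M) (x₀ : E) {T : ℝ} (hT : 0 ≤ T) :
    ∃ x, x 0 = x₀ ∧ IsFlowLine H T x := by
  have hM0 : 0 ≤ M := (norm_nonneg _).trans (hM 0)
  -- With speed at most M everywhere, a solution stays within M T of its starting point, so
  -- Picard–Lindelöf on that ball reaches time T in one step.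
  have hp : IsPicardLindelof (fun _ => H) (tmin := 0) (tmax := T) ⟨0, le_rfl, hT⟩ x₀
      (M * T).toNNReal 0 M.toNNReal C.toNNReal := by
    refine ⟨fun t _ => ?_, fun x _ => continuousOn_const, fun t _ x _ => ?_, ?_⟩
    · refine (LipschitzWith.of_dist_le_mul fun x y => ?_).lipschitzOnWith
      rw [dist_eq_norm, dist_eq_norm]
      refine (hC x y).trans ?_
      gcongr
      exact Real.le_coe_toNNReal C
    · exact (hM x).trans (Real.le_coe_toNNReal M)
    · simp [hT, Real.coe_toNNReal _ hM0, Real.coe_toNNReal _ (mul_nonneg hM0 hT)]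
  obtain ⟨x, hx, hd⟩ := hp.exists_eq_forall_mem_Icc_hasDerivWithinAt₀
  exact ⟨x, hx, fun t ht => (hd t ht).continuousWithinAt,
    fun t ht => (hd t (Ioo_subset_Icc_self ht)).hasDerivAt (Icc_mem_nhds ht.1 ht.2)⟩

/-- Multiply G by a 1-Lipschitz function of the norm that is 1 up to R and 0 beyond r. A pair with
one point outside the large ball sees only the variation of the cutoff, so C + M is a global
Lipschitz constant. -/
lemma exists_cutoff {G : E → E} (hG : IsLipschitzOnBalls G) (R : ℝ) :
    ∃ (H : E → E) (C M : ℝ), (∀ x y, ‖H x - H y‖ ≤ C * ‖x - y‖) ∧ (∀ x, ‖H x‖ ≤ M) ∧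
      ∀ x, ‖x‖ ≤ R → H x = G x := by
  obtain ⟨C, hC, hL⟩ := hG (max (R + 1) 0)
  set r := max (R + 1) 0
  let M := C * r + ‖G 0‖
  have hM0 : 0 ≤ M := by positivity
  have hM : ∀ x, ‖x‖ ≤ r → ‖G x‖ ≤ M := by
    intro x hx
    have h1 := hL x 0 hx (by simp [r])
    rw [sub_zero] at h1
    have h2 : C * ‖x‖ ≤ C * r := by gcongr
    linarith [norm_le_norm_sub_add (G x) (G 0)]
  let χ : E → ℝ := fun x => max 0 (min 1 (r - ‖x‖))
  have hχ0 : ∀ x, 0 ≤ χ x := fun x => le_max_left _ _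
  have hχ1 : ∀ x, χ x ≤ 1 := fun x => max_le zero_le_one (min_le_left _ _)
  have hχL : ∀ x y, |χ x - χ y| ≤ ‖x - y‖ := by
    intro x y
    refine (abs_max_sub_max_le_max _ _ _ _).trans ?_
    rw [sub_self, abs_zero]
    refine max_le (norm_nonneg _) ((abs_min_sub_min_le_max _ _ _ _).trans ?_)
    rw [sub_self, abs_zero]
    refine max_le (norm_nonneg _) ?_
    have : r - ‖x‖ - (r - ‖y‖) = -(‖x‖ - ‖y‖) := by ring
    rw [this, abs_neg]
    exact abs_norm_sub_norm_le x y
  have hout : ∀ x, r < ‖x‖ → χ x = 0 := fun x hx =>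
    max_eq_left ((min_le_right _ _).trans (by linarith))
  have key : ∀ x y, ‖y‖ ≤ r → ‖χ x • G x - χ y • G y‖ ≤ (C + M) * ‖x - y‖ := by
    intro x y hy
    have h0 : 0 ≤ C * ‖x - y‖ := by positivity
    by_cases hx : ‖x‖ ≤ r
    · have e : χ x • G x - χ y • G y = χ x • (G x - G y) + (χ x - χ y) • G y := by
        rw [smul_sub, sub_smul]; abel
      rw [e]
      refine (norm_add_le _ _).trans ?_
      rw [norm_smul, norm_smul, add_mul, Real.norm_eq_abs, Real.norm_eq_abs, abs_of_nonneg (hχ0 x)]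
      refine add_le_add ?_ ?_
      · exact (mul_le_of_le_one_left (norm_nonneg _) (hχ1 x)).trans (hL x y hx hy)
      · rw [mul_comm]
        exact mul_le_mul (hM y hy) (hχL x y) (abs_nonneg _) hM0
    · rw [hout x (not_le.1 hx), zero_smul, zero_sub, norm_neg, norm_smul, Real.norm_eq_abs]
      have h1 := hχL x y
      rw [hout x (not_le.1 hx), zero_sub, abs_neg] at h1
      have := mul_le_mul (hM y hy) h1 (abs_nonneg _) hM0
      linarith
  refine ⟨fun x => χ x • G x, C + M, M, fun x y => ?_, fun x => ?_, fun x hx => ?_⟩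
  · by_cases hy : ‖y‖ ≤ r
    · exact key x y hy
    · by_cases hx : ‖x‖ ≤ r
      · rw [norm_sub_rev, norm_sub_rev x]
        exact key y x hx
      · simp only [hout x (not_le.1 hx), hout y (not_le.1 hy), zero_smul, sub_self, norm_zero]
        positivity
  · by_cases hx : ‖x‖ ≤ r
    · rw [norm_smul, Real.norm_eq_abs, abs_of_nonneg (hχ0 x)]
      exact (mul_le_of_le_one_left (norm_nonneg _) (hχ1 x)).trans (hM x hx)
    · simpa [hout x (not_le.1 hx)] using hM0
  · have : χ x = 1 := by
      have h1 : R + 1 ≤ r := le_max_left _ _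
      have h2 : min 1 (r - ‖x‖) = 1 := min_eq_left (by linarith)
      simp only [χ, h2]
      norm_num
    simp [this]

/-- An a priori bound gives global existence. -/
lemma exists_isFlowLine [CompleteSpace E] {G : E → E} (hG : IsLipschitzOnBalls G) {x₀ : E}
    {T R : ℝ} (hT : 0 ≤ T)
    (hR : ∀ τ, 0 ≤ τ → τ ≤ T → ∀ x, x 0 = x₀ → IsFlowLine G τ x → ‖x τ‖ ≤ R) :
    ∃ x, x 0 = x₀ ∧ IsFlowLine G T x := by
  obtain ⟨H, C, M, hC, hM, hH⟩ := exists_cutoff hG (R + 1)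
  obtain ⟨x, hx0, hx⟩ := exists_isFlowLine_of_bounded hC hM x₀ hT
  refine ⟨x, hx0, ?_⟩
  by_cases hA : (Icc 0 T ∩ {t | R + 1 ≤ ‖x t‖}).Nonempty
  · exfalso
    have hcl : IsCompact (Icc 0 T ∩ {t | R + 1 ≤ ‖x t‖}) := by
      refine isCompact_Icc.of_isClosed_subset ?_ inter_subset_left
      exact hx.continuousOn.norm.preimage_isClosed_of_isClosed isClosed_Icc isClosed_Ici
    -- The first time at which the truncated solution has norm at least R + 1. Before it the cutoff
    -- is inactive, so the a priori bound applies on [0,s] and gives norm at most R at s, a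
    -- contradiction.
    obtain ⟨s, hs, hmin⟩ := hcl.exists_isLeast hA
    have hfl : IsFlowLine G s x := by
      refine ⟨(hx.mono hs.1.2).continuousOn, fun t ht => ?_⟩
      have h1 : ‖x t‖ < R + 1 := by
        by_contra hcon
        exact absurd (hmin ⟨⟨ht.1.le, ht.2.le.trans hs.1.2⟩, not_lt.1 hcon⟩) (not_le.2 ht.2)
      rw [← hH _ h1.le]
      exact (hx.mono hs.1.2).hasDerivAt t ht
    have h1 := hR s hs.1.1 hs.1.2 x hx0 hfl
    have h2 : R + 1 ≤ ‖x s‖ := hs.2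
    linarith
  · refine ⟨hx.continuousOn, fun t ht => ?_⟩
    have h1 : ‖x t‖ < R + 1 := by
      by_contra hcon
      exact hA ⟨t, Ioo_subset_Icc_self ht, not_lt.1 hcon⟩
    rw [← hH _ h1.le]
    exact hx.hasDerivAt t ht

lemma sub_le_integral_of_hasDerivAt {f f' h : ℝ → ℝ} {a b : ℝ} (hab : a ≤ b)
    (hf : ContinuousOn f (Icc a b)) (hd : ∀ t ∈ Ioo a b, HasDerivAt f (f' t) t)
    (hh : ContinuousOn h (Icc a b)) (hle : ∀ t ∈ Ioo a b, f' t ≤ h t) :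
    f b - f a ≤ ∫ t in a..b, h t :=
  intervalIntegral.sub_le_integral_of_hasDeriv_right_of_le hab hf
    (fun t ht => (hd t ht).hasDerivWithinAt) (hh.integrableOn_compact isCompact_Icc) hle

end ODE

/-! ### Square integrable functions of time -/

section L2Time

variable {α E : Type*} [MeasurableSpace α] {μ : Measure α} [NormedAddCommGroup E]

lemma integrable_norm_sq_of_memLp {f : α → E} (h : MemLp f 2 μ) : Integrable (fun t => ‖f t‖ ^ 2) μ :=
  (memLp_two_iff_integrable_sq_norm h.1).1 h

lemma eLpNorm_two_eq_of_memLp {f : α → E} (h : MemLp f 2 μ) :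
    eLpNorm f 2 μ = ENNReal.ofReal √(∫ t, ‖f t‖ ^ 2 ∂μ) := by
  rw [h.eLpNorm_eq_integral_rpow_norm (by norm_num) (by norm_num), Real.sqrt_eq_rpow]
  norm_num

lemma exists_limit_of_cauchy [CompleteSpace E] {f : ℕ → α → E} (hf : ∀ n, MemLp (f n) 2 μ)
    (hc : ∀ ε > 0, ∃ N, ∀ n ≥ N, ∀ m ≥ N, ∫ t, ‖f n t - f m t‖ ^ 2 ∂μ ≤ ε) :
    ∃ g, MemLp g 2 μ ∧ Tendsto (fun n => ∫ t, ‖f n t - g t‖ ^ 2 ∂μ) atTop (𝓝 0) := by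
  have hn : ∀ {u v : α → E} (hu : MemLp u 2 μ) (hv : MemLp v 2 μ),
      ‖hu.toLp - hv.toLp‖ ^ 2 = ∫ t, ‖u t - v t‖ ^ 2 ∂μ := by
    intro u v hu hv
    have h0 : 0 ≤ ∫ t, ‖(u - v) t‖ ^ 2 ∂μ := integral_nonneg fun t => sq_nonneg _
    rw [← MemLp.toLp_sub, Lp.norm_toLp, eLpNorm_two_eq_of_memLp (hu.sub hv),
      ENNReal.toReal_ofReal (Real.sqrt_nonneg _), Real.sq_sqrt h0]
    rfl
  have hcs : CauchySeq fun n => (hf n).toLp := by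
    rw [Metric.cauchySeq_iff]
    intro ε hε
    obtain ⟨N, hN⟩ := hc (ε ^ 2 / 2) (by positivity)
    refine ⟨N, fun m hm n hn' => ?_⟩
    rw [dist_eq_norm]
    refine abs_lt_of_sq_lt_sq' ?_ hε.le |>.2
    rw [hn]
    exact (hN m hm n hn').trans_lt (by linarith [pow_pos hε 2])
  obtain ⟨g, hg⟩ := cauchySeq_tendsto_of_complete hcs
  refine ⟨g, Lp.memLp g, ?_⟩
  have h1 := (tendsto_iff_norm_sub_tendsto_zero.1 hg).pow 2
  rw [zero_pow two_ne_zero] at h1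
  refine h1.congr fun n => ?_
  rw [← hn (hf n) (Lp.memLp g), Lp.toLp_coeFn]

/-- Mean square convergence implies mean convergence. -/
lemma tendsto_integral_norm_of_sq [IsFiniteMeasure μ] {f : ℕ → α → E} (hf : ∀ n, MemLp (f n) 2 μ)
    (h : Tendsto (fun n => ∫ t, ‖f n t‖ ^ 2 ∂μ) atTop (𝓝 0)) :
    Tendsto (fun n => ∫ t, ‖f n t‖ ∂μ) atTop (𝓝 0) := by
  have h1 : ∀ n, (∫ t, ‖f n t‖ ∂μ) ≤ √(∫ t, ‖f n t‖ ^ 2 ∂μ) * √(μ.real univ) := by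
    intro n
    have := integral_mul_norm_le_Lp_mul_Lq (μ := μ) (f := fun t => ‖f n t‖) (g := fun _ => (1 : ℝ))
      Real.HolderConjugate.two_two (by simpa using (hf n).norm) (memLp_const 1)
    simpa [Real.sqrt_eq_rpow] using this
  have h2 : Tendsto (fun n => √(∫ t, ‖f n t‖ ^ 2 ∂μ) * √(μ.real univ)) atTop (𝓝 0) := by
    simpa using ((Real.continuous_sqrt.tendsto 0).comp h).mul_const √(μ.real univ)
  exact squeeze_zero (fun n => integral_nonneg fun t => norm_nonneg _) h1 h2

lemma norm_add_sq_le_two (x y : E) : ‖x + y‖ ^ 2 ≤ 2 * (‖x‖ ^ 2 + ‖y‖ ^ 2) := by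
  have h := norm_add_le x y
  have h0 := norm_nonneg (x + y)
  nlinarith [sq_nonneg (‖x‖ - ‖y‖)]

lemma integral_norm_add_sq_le {f g : α → E} (hf : MemLp f 2 μ) (hg : MemLp g 2 μ) :
    ∫ t, ‖f t + g t‖ ^ 2 ∂μ ≤ 2 * (∫ t, ‖f t‖ ^ 2 ∂μ + ∫ t, ‖g t‖ ^ 2 ∂μ) := by
  rw [← integral_add (integrable_norm_sq_of_memLp hf) (integrable_norm_sq_of_memLp hg),
    ← integral_const_mul]
  exact integral_mono (integrable_norm_sq_of_memLp (hf.add hg))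
    (((integrable_norm_sq_of_memLp hf).add (integrable_norm_sq_of_memLp hg)).const_mul 2)
    fun t => norm_add_sq_le_two _ _

lemma cauchy_of_tendsto {f : ℕ → α → E} {g : α → E} (hf : ∀ n, MemLp (f n) 2 μ) (hg : MemLp g 2 μ)
    (h : Tendsto (fun n => ∫ t, ‖f n t - g t‖ ^ 2 ∂μ) atTop (𝓝 0)) :
    ∀ ε > 0, ∃ N, ∀ n ≥ N, ∀ m ≥ N, ∫ t, ‖f n t - f m t‖ ^ 2 ∂μ ≤ ε := by
  intro ε hε
  obtain ⟨N, hN⟩ := eventually_atTop.1 (h.eventually_le_const (show 0 < ε / 4 by positivity))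
  refine ⟨N, fun n hn m hm => ?_⟩
  have e : ∀ t, f n t - f m t = (f n t - g t) + -(f m t - g t) := fun t => by abel
  simp only [e]
  refine (integral_norm_add_sq_le ((hf n).sub hg) ((hf m).sub hg).neg).trans ?_
  simp only [Pi.neg_apply, norm_neg, Pi.sub_apply]
  linarith [hN n hn, hN m hm]

end L2Time

/-! ### Abstract Galerkin method -/

/-- A self-adjoint compact operator `K` (playing the role of `Λ^{-1/2}`) with spectral projections
`P n` and the operators `L n = Λ^{1/2} P n`. -/
structure GalerkinScale (E : Type*) [NormedAddCommGroup E] [InnerProductSpace ℝ E] where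
  K : E →L[ℝ] E
  P : ℕ → E →L[ℝ] E
  L : ℕ → E →L[ℝ] E
  compact_K : IsCompactOperator K
  norm_K_le : ∀ x, ‖K x‖ ≤ ‖x‖
  norm_P_le : ∀ n x, ‖P n x‖ ≤ ‖x‖
  inner_K : ∀ x y, inner ℝ (K x) y = inner ℝ x (K y)
  inner_L : ∀ n x y, inner ℝ (L n x) y = inner ℝ x (L n y)
  tendsto_P : ∀ x, Tendsto (fun n => P n x) atTop (𝓝 x)
  K_L : ∀ n x, K (L n x) = P n x
  P_P : ∀ {m n}, m ≤ n → ∀ x, P n (P m x) = P m x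
  L_P : ∀ {m n}, m ≤ n → ∀ x, L n (P m x) = L m x
  P_L : ∀ {m n}, m ≤ n → ∀ x, P n (L m x) = L m x

lemma memLp_of_continuousOn {E : Type*} [NormedAddCommGroup E] {f : ℝ → E} {T : ℝ}
    (hf : ContinuousOn f (Icc 0 T)) : MemLp f 2 (volume.restrict (Ioo 0 T)) := by
  obtain ⟨C, hC⟩ := isCompact_Icc.exists_bound_of_continuousOn hf
  refine MemLp.of_bound
    ((hf.mono Ioo_subset_Icc_self).aestronglyMeasurable measurableSet_Ioo) C ?_
  exact (ae_restrict_mem measurableSet_Ioo).mono fun t ht => hC t (Ioo_subset_Icc_self ht)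

lemma sub_le_setIntegral {f f' h : ℝ → ℝ} {b : ℝ} (hb : 0 ≤ b)
    (hf : ContinuousOn f (Icc 0 b)) (hd : ∀ t ∈ Ioo 0 b, HasDerivAt f (f' t) t)
    (hh : ContinuousOn h (Icc 0 b)) (hle : ∀ t ∈ Ioo 0 b, f' t ≤ h t) :
    f b - f 0 ≤ ∫ t in Ioo 0 b, h t := by
  rw [← integral_Ioc_eq_integral_Ioo, ← intervalIntegral.integral_of_le hb]
  exact sub_le_integral_of_hasDerivAt hb hf hd hh hle

/-- Arzelà–Ascoli for a sequence of curves. -/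
lemma exists_uniform_cauchy_subseq {E : Type*} [NormedAddCommGroup E] {T : ℝ} {s : Set E}
    (hs : IsCompact s) {w : ℕ → ℝ → E} (hw : ∀ n, ∀ t ∈ Icc 0 T, w n t ∈ s)
    (he : ∀ ε > 0, ∃ δ > 0, ∀ n, ∀ a ∈ Icc 0 T, ∀ b ∈ Icc 0 T, a ≤ b → b - a ≤ δ →
      ‖w n b - w n a‖ ≤ ε) :
    ∃ φ : ℕ → ℕ, StrictMono φ ∧ ∀ ε > 0, ∃ N, ∀ n ≥ N, ∀ m ≥ N, ∀ t ∈ Icc 0 T,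
      ‖w (φ n) t - w (φ m) t‖ ≤ ε := by
  have he' : ∀ ε > 0, ∃ δ > 0, ∀ n, ∀ a b : Icc 0 T, dist a b < δ →
      dist (w n a) (w n b) < ε := by
    intro ε hε
    obtain ⟨δ, hδ, h⟩ := he (ε / 2) (by positivity)
    refine ⟨δ, hδ, fun n a b hab => ?_⟩
    have hab' : |(a : ℝ) - b| < δ := hab
    rw [abs_lt] at hab'
    rcases le_total (a : ℝ) b with hl | hl
    · rw [dist_comm, dist_eq_norm]
      exact (h n a a.2 b b.2 hl (by linarith)).trans_lt (by linarith)
    · rw [dist_eq_norm]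
      exact (h n b b.2 a a.2 hl (by linarith)).trans_lt (by linarith)
  have hcont : ∀ n, Continuous fun t : Icc 0 T => w n t := by
    intro n
    rw [Metric.continuous_iff]
    intro b ε hε
    obtain ⟨δ, hδ, h⟩ := he' ε hε
    exact ⟨δ, hδ, fun a hab => h n a b hab⟩
  let W : ℕ → BoundedContinuousFunction (Icc 0 T) E := fun n =>
    BoundedContinuousFunction.mkOfCompact ⟨fun t => w n t, hcont n⟩
  have hcomp : IsCompact (closure (range W)) := by
    refine BoundedContinuousFunction.arzela_ascoli s hs _ ?_ ?_
    · rintro _ t ⟨n, rfl⟩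
      exact hw n t t.2
    · intro t U hU
      obtain ⟨ε, hε, hεU⟩ := Metric.mem_uniformity_dist.1 hU
      obtain ⟨δ, hδ, h⟩ := he' ε hε
      filter_upwards [Metric.ball_mem_nhds t hδ] with r hr
      rintro ⟨_, n, rfl⟩
      refine hεU (h n t r ?_)
      rwa [dist_comm]
  obtain ⟨g, -, φ, hφ, hlim⟩ := hcomp.tendsto_subseq fun n => subset_closure (mem_range_self (f := W) n)
  refine ⟨φ, hφ, fun ε hε => ?_⟩
  obtain ⟨N, hN⟩ := Metric.cauchySeq_iff.1 hlim.cauchySeq ε hε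
  refine ⟨N, fun n hn m hm t ht => ?_⟩
  rw [← dist_eq_norm]
  exact (BoundedContinuousFunction.dist_coe_le_dist (f := W (φ n)) (g := W (φ m)) ⟨t, ht⟩).trans
    (hN n hn m hm).le

namespace GalerkinScale

variable {E : Type*} [NormedAddCommGroup E] [InnerProductSpace ℝ E]

/-- The vector field of the `n`-th Galerkin system. -/
def field (S : GalerkinScale E) (F : E → E) (N : E →L[ℝ] E) (n : ℕ) (x : E) : E :=
  S.L n (F (S.L n x) - N (S.L n x))

/-- `F` is Hölder continuous with respect to the middle norm, with weight. -/
def IsSubcritical {X : Type*} [NormedAddCommGroup X] (S : GalerkinScale E) (F : E → X) : Prop :=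
  ∀ R : ℝ, ∃ C : ℝ, 0 ≤ C ∧ ∀ ξ η, ‖S.K ξ‖ ≤ R → ‖S.K η‖ ≤ R →
    ‖F ξ - F η‖ ^ 2 ≤ C * ‖S.K (ξ - η)‖ * (1 + ‖ξ‖ + ‖η‖)

variable (S : GalerkinScale E) {F : E → E} {N : E →L[ℝ] E}

lemma isLipschitzOnBalls_field (hF : IsLipschitzOnBalls F) (n : ℕ) :
    IsLipschitzOnBalls (S.field F N n) := by
  intro R
  obtain ⟨C, hC, h⟩ := hF (‖S.L n‖ * R)
  refine ⟨‖S.L n‖ * (C * ‖S.L n‖ + ‖N‖ * ‖S.L n‖), by positivity, fun x y hx hy => ?_⟩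
  have hb : ∀ z, ‖z‖ ≤ R → ‖S.L n z‖ ≤ ‖S.L n‖ * R := fun z hz =>
    (S.L n).le_opNorm_of_le hz
  have e : S.field F N n x - S.field F N n y
      = S.L n ((F (S.L n x) - F (S.L n y)) - N (S.L n (x - y))) := by
    simp only [field, map_sub]; abel
  rw [e]
  have h1 : ‖S.L n (x - y)‖ ≤ ‖S.L n‖ * ‖x - y‖ := (S.L n).le_opNorm _
  have h2 : ‖F (S.L n x) - F (S.L n y)‖ ≤ C * (‖S.L n‖ * ‖x - y‖) := by
    refine (h _ _ (hb x hx) (hb y hy)).trans ?_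
    rw [← map_sub]
    gcongr
  have h3 : ‖N (S.L n (x - y))‖ ≤ ‖N‖ * (‖S.L n‖ * ‖x - y‖) := N.le_opNorm_of_le h1
  calc _ ≤ ‖S.L n‖ * ‖(F (S.L n x) - F (S.L n y)) - N (S.L n (x - y))‖ := (S.L n).le_opNorm _
    _ ≤ ‖S.L n‖ * (C * (‖S.L n‖ * ‖x - y‖) + ‖N‖ * (‖S.L n‖ * ‖x - y‖)) := by
        gcongr
        exact (norm_sub_le _ _).trans (add_le_add h2 h3)
    _ = _ := by ring

/-- The vector field takes values in the range of `S.P n`, so ‖x - P x‖² has zero derivative, and it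
vanishes initially. -/
lemma P_flowLine {n : ℕ} {τ : ℝ} {x₀ : E} {x : ℝ → E} (hx0 : x 0 = S.P n x₀)
    (hx : IsFlowLine (S.field F N n) τ x) : ∀ t ∈ Icc 0 τ, S.P n (x t) = x t := by
  intro t ht
  have hx' := hx.mono ht.2
  have h := sub_le_setIntegral (f := fun t => ‖x t - S.P n (x t)‖ ^ 2)
    (f' := fun _ => 0) (h := fun _ => 0) ht.1
    ((hx'.continuousOn.sub ((S.P n).continuous.comp_continuousOn hx'.continuousOn)).norm.pow 2)
    (fun r hr => by
      have h1 := hx'.hasDerivAt r hr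
      have h2 := (h1.sub ((S.P n).hasFDerivAt.comp_hasDerivAt r h1)).norm_sq
      refine h2.congr_deriv ?_
      simp only [field, S.P_L le_rfl, sub_self, inner_zero_right, mul_zero])
    continuousOn_const (fun _ _ => le_rfl)
  simp only [integral_zero, hx0, S.P_P le_rfl, sub_self, norm_zero] at h
  have h3 : ‖x t - S.P n (x t)‖ = 0 := by
    have := norm_nonneg (x t - S.P n (x t))
    nlinarith
  exact (sub_eq_zero.1 (norm_eq_zero.1 h3)).symm

/-- Compare with η = 0, which `max R 0` makes admissible. While K ξ stays bounded, F grows only like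
the square root of ‖ξ‖, slowly enough for the dissipation to absorb it. -/
lemma exists_growth (hS : S.IsSubcritical F) (R : ℝ) :
    ∃ A : ℝ, 0 ≤ A ∧ ∀ ξ, ‖S.K ξ‖ ≤ R → ‖F ξ‖ ^ 2 ≤ A * (1 + ‖ξ‖) := by
  obtain ⟨C, hC, h⟩ := hS (max R 0)
  refine ⟨2 * (C * max R 0 + ‖F 0‖ ^ 2), by positivity, fun ξ hξ => ?_⟩
  have hξ' : ‖S.K ξ‖ ≤ max R 0 := hξ.trans (le_max_left _ _)
  have h1 := h ξ 0 hξ' (by simp)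
  rw [sub_zero, norm_zero, add_zero] at h1
  have h2 := norm_add_sq_le_two (F ξ - F 0) (F 0)
  rw [sub_add_cancel] at h2
  have h3 : C * ‖S.K ξ‖ * (1 + ‖ξ‖) ≤ C * max R 0 * (1 + ‖ξ‖) := by gcongr
  have h4 : ‖F 0‖ ^ 2 * 1 ≤ ‖F 0‖ ^ 2 * (1 + ‖ξ‖) := by
    gcongr
    linarith [norm_nonneg ξ]
  linarith

lemma hasDerivAt_flowLine_norm_sq {n : ℕ} {τ t : ℝ} {x : ℝ → E}
    (hx : IsFlowLine (S.field F N n) τ x) (ht : t ∈ Ioo 0 τ) :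
    HasDerivAt (fun t => ‖x t‖ ^ 2)
      (2 * inner ℝ (S.L n (x t)) (F (S.L n (x t)) - N (S.L n (x t)))) t := by
  refine (hx.hasDerivAt t ht).norm_sq.congr_deriv ?_
  rw [field, ← S.inner_L]

lemma continuousOn_L_flowLine {n : ℕ} {τ : ℝ} {x : ℝ → E}
    (hx : IsFlowLine (S.field F N n) τ x) : ContinuousOn (fun t => S.L n (x t)) (Icc 0 τ) :=
  (S.L n).continuous.comp_continuousOn hx.continuousOn

/-- Coercivity provides -2c‖ζ‖², and Young's inequality spends half of it. -/
lemma two_inner_le {c : ℝ} (hc : 0 < c) (hN : ∀ x, c * ‖x‖ ^ 2 ≤ inner ℝ x (N x)) (ζ g : E) :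
    2 * inner ℝ ζ (g - N ζ) ≤ -c * ‖ζ‖ ^ 2 + c⁻¹ * ‖g‖ ^ 2 := by
  have h1 := real_inner_le_norm ζ g
  have h2 := hN ζ
  rw [inner_sub_right]
  have h3 : 2 * (‖ζ‖ * ‖g‖) ≤ c * ‖ζ‖ ^ 2 + c⁻¹ * ‖g‖ ^ 2 := by
    have h4 : 0 ≤ c⁻¹ * (c * ‖ζ‖ - ‖g‖) ^ 2 := by positivity
    have h5 : c⁻¹ * (c * ‖ζ‖ - ‖g‖) ^ 2 = c * ‖ζ‖ ^ 2 + c⁻¹ * ‖g‖ ^ 2 - 2 * (‖ζ‖ * ‖g‖) := by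
      field_simp
      ring
    linarith
  linarith

lemma exists_integral_bound (hS : S.IsSubcritical F) {c : ℝ} (hc : 0 < c)
    (hN : ∀ x, c * ‖x‖ ^ 2 ≤ inner ℝ x (N x)) (R : ℝ) {T : ℝ} (hT : 0 ≤ T) :
    ∃ B : ℝ, ∀ n x, IsFlowLine (S.field F N n) T x → (∀ t ∈ Icc 0 T, S.P n (x t) = x t) →
      (∀ t ∈ Icc 0 T, ‖x t‖ ≤ R) → ∫ t in Ioo 0 T, ‖S.L n (x t)‖ ^ 2 ≤ B := by
  obtain ⟨A, hA, hAF⟩ := S.exists_growth hS R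
  -- What remains of c⁻¹ A (1 + a), for a = ‖ξ‖, once (c/2) a² has absorbed the part linear in a.
  let D := c⁻¹ * A + c⁻¹ * (c⁻¹ * A) ^ 2 / 2
  refine ⟨2 * c⁻¹ * (R ^ 2 + D * T), fun n x hx hP hR => ?_⟩
  have hcξ := S.continuousOn_L_flowLine hx
  have h := sub_le_setIntegral (f := fun t => ‖x t‖ ^ 2) (h := fun t => -(c / 2) * ‖S.L n (x t)‖ ^ 2 + D) hT
    (hx.continuousOn.norm.pow 2) (fun t ht => S.hasDerivAt_flowLine_norm_sq hx ht)
    ((continuousOn_const.mul (hcξ.norm.pow 2)).add continuousOn_const) (fun t ht => by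
      refine (two_inner_le hc hN _ _).trans ?_
      have h1 := hAF (S.L n (x t)) (by
        rw [S.K_L, hP t (Ioo_subset_Icc_self ht)]
        exact hR t (Ioo_subset_Icc_self ht))
      set a := ‖S.L n (x t)‖
      have h2 : c⁻¹ * ‖F (S.L n (x t))‖ ^ 2 ≤ c⁻¹ * (A * (1 + a)) := by gcongr
      have h3 : 0 ≤ c⁻¹ / 2 * (c * a - c⁻¹ * A) ^ 2 := by positivity
      have h4 : c⁻¹ / 2 * (c * a - c⁻¹ * A) ^ 2
          = c / 2 * a ^ 2 - c⁻¹ * A * a + c⁻¹ * (c⁻¹ * A) ^ 2 / 2 := by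
        field_simp
        ring
      simp only [D]
      linarith)
  have hi : Integrable (fun t => ‖S.L n (x t)‖ ^ 2) (volume.restrict (Ioo 0 T)) :=
    integrable_norm_sq_of_memLp (memLp_of_continuousOn hcξ)
  rw [integral_add (hi.const_mul _) (integrable_const _), integral_const_mul, integral_const] at h
  simp only [MeasurableSet.univ, measureReal_restrict_apply, univ_inter, Real.volume_real_Ioo, sub_zero,
    smul_eq_mul, max_eq_left hT] at h
  have h5 : ‖x 0‖ ^ 2 ≤ R ^ 2 := by
    have := hR 0 (left_mem_Icc.2 hT)
    gcongr
  have h6 : 0 ≤ ‖x T‖ ^ 2 := sq_nonneg _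
  have h7 : c / 2 * (∫ t in Ioo 0 T, ‖S.L n (x t)‖ ^ 2) ≤ R ^ 2 + D * T := by linarith
  calc ∫ t in Ioo 0 T, ‖S.L n (x t)‖ ^ 2
      = 2 * c⁻¹ * (c / 2 * ∫ t in Ioo 0 T, ‖S.L n (x t)‖ ^ 2) := by field_simp
    _ ≤ _ := by gcongr

end GalerkinScale

namespace GalerkinScale

variable {E : Type*} [NormedAddCommGroup E] [InnerProductSpace ℝ E]
  (S : GalerkinScale E) {F : E → E} {N : E →L[ℝ] E}

/-- Both vector fields are L_{max n m} applied to a difference P F - N. By self-adjointness this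
operator passes to x - y and turns it into the difference of the two ξ, on which N is coercive. The
nonlinear difference is left on the right as a source, not estimated by x - y. -/
lemma norm_sub_sq_add_le (hF : Continuous F) {c : ℝ} (hc : 0 < c)
    (hN : ∀ x, c * ‖x‖ ^ 2 ≤ inner ℝ x (N x)) (hNP : ∀ n x, S.P n (N x) = N (S.P n x))
    {T : ℝ} {n m : ℕ} {x y : ℝ → E} (hx : IsFlowLine (S.field F N n) T x)
    (hy : IsFlowLine (S.field F N m) T y) (hPx : ∀ t ∈ Icc 0 T, S.P n (x t) = x t)
    (hPy : ∀ t ∈ Icc 0 T, S.P m (y t) = y t) {t : ℝ} (ht : t ∈ Icc 0 T) :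
    ‖x t - y t‖ ^ 2 + c * ∫ r in Ioo 0 t, ‖S.L n (x r) - S.L m (y r)‖ ^ 2
      ≤ ‖x 0 - y 0‖ ^ 2
        + c⁻¹ * ∫ r in Ioo 0 T, ‖S.P n (F (S.L n (x r))) - S.P m (F (S.L m (y r)))‖ ^ 2 := by
  have c1 := S.continuousOn_L_flowLine hx
  have c2 := S.continuousOn_L_flowLine hy
  have c3 : ContinuousOn (fun r => S.P n (F (S.L n (x r))) - S.P m (F (S.L m (y r)))) (Icc 0 T) :=
    ((S.P n).continuous.comp_continuousOn (hF.comp_continuousOn c1)).sub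
      ((S.P m).continuous.comp_continuousOn (hF.comp_continuousOn c2))
  have hsub : Icc 0 t ⊆ Icc 0 T := Icc_subset_Icc_right ht.2
  have h := sub_le_setIntegral (f := fun t => ‖x t - y t‖ ^ 2)
    (h := fun r => -c * ‖S.L n (x r) - S.L m (y r)‖ ^ 2
      + c⁻¹ * ‖S.P n (F (S.L n (x r))) - S.P m (F (S.L m (y r)))‖ ^ 2) ht.1
    ((hx.continuousOn.sub hy.continuousOn).norm.pow 2 |>.mono hsub)
    (fun r hr => (((hx.mono ht.2).hasDerivAt r hr).sub ((hy.mono ht.2).hasDerivAt r hr)).norm_sq)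
    (((continuousOn_const.mul ((c1.sub c2).norm.pow 2)).add
      (continuousOn_const.mul (c3.norm.pow 2))).mono hsub)
    (fun r hr => by
      have hr' : r ∈ Icc 0 T := hsub (Ioo_subset_Icc_self hr)
      refine Eq.trans_le ?_ (two_inner_le hc hN _ _)
      have e1 : S.field F N n (x r) = S.L (max n m) (S.P n (F (S.L n (x r))) - N (S.L n (x r))) := by
        have : S.P n (F (S.L n (x r))) - N (S.L n (x r))
            = S.P n (F (S.L n (x r)) - N (S.L n (x r))) := by
          rw [map_sub, hNP, S.P_L le_rfl]
        rw [this, S.L_P (le_max_left n m), field]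
      have e2 : S.field F N m (y r) = S.L (max n m) (S.P m (F (S.L m (y r))) - N (S.L m (y r))) := by
        have : S.P m (F (S.L m (y r))) - N (S.L m (y r))
            = S.P m (F (S.L m (y r)) - N (S.L m (y r))) := by
          rw [map_sub, hNP, S.P_L le_rfl]
        rw [this, S.L_P (le_max_right n m), field]
      have e3 : S.L (max n m) (x r - y r) = S.L n (x r) - S.L m (y r) := by
        conv_lhs => rw [← hPx r hr', ← hPy r hr']
        rw [map_sub, S.L_P (le_max_left n m), S.L_P (le_max_right n m)]
      rw [Pi.sub_apply, e1, e2, ← map_sub, ← S.inner_L, e3]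
      congr 2
      rw [map_sub]
      abel)
  have i1 : IntegrableOn (fun r => ‖S.L n (x r) - S.L m (y r)‖ ^ 2) (Ioo 0 T) :=
    integrable_norm_sq_of_memLp (memLp_of_continuousOn (c1.sub c2))
  have i2 : IntegrableOn
      (fun r => ‖S.P n (F (S.L n (x r))) - S.P m (F (S.L m (y r)))‖ ^ 2) (Ioo 0 T) :=
    integrable_norm_sq_of_memLp (memLp_of_continuousOn c3)
  have hs : Ioo 0 t ⊆ Ioo 0 T := Ioo_subset_Ioo_right ht.2
  rw [integral_add ((i1.mono_set hs).const_mul _) ((i2.mono_set hs).const_mul _), integral_const_mul,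
    integral_const_mul] at h
  have h2 := setIntegral_mono_set i2 (Eventually.of_forall fun r => sq_nonneg _) hs.eventuallyLE
  have h3 := mul_le_mul_of_nonneg_left h2 (inv_pos.2 hc).le
  linarith

/-- Applying K removes the unbounded L_n in front of the vector field: (K x)' = P F(ξ) - N ξ, which
is at most M (1 + ‖ξ‖) and hence square integrable in time uniformly in n. -/
lemma equicontinuous_K [CompleteSpace E] (hF : Continuous F) (hS : S.IsSubcritical F)
    (hNP : ∀ n x, S.P n (N x) = N (S.P n x)) {T : ℝ} {x : ℕ → ℝ → E} {R B : ℝ}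
    (hx : ∀ n, IsFlowLine (S.field F N n) T (x n))
    (hP : ∀ n, ∀ t ∈ Icc 0 T, S.P n (x n t) = x n t) (hR : ∀ n, ∀ t ∈ Icc 0 T, ‖x n t‖ ≤ R)
    (hB : ∀ n, ∫ t in Ioo 0 T, ‖S.L n (x n t)‖ ^ 2 ≤ B) :
    ∀ ε > 0, ∃ δ > 0, ∀ n, ∀ a ∈ Icc 0 T, ∀ b ∈ Icc 0 T, a ≤ b → b - a ≤ δ →
      ‖S.K (x n b) - S.K (x n a)‖ ≤ ε := by
  intro ε hε
  obtain ⟨A, hA, hAF⟩ := S.exists_growth hS R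
  have hB0 : 0 ≤ B := (integral_nonneg fun t => sq_nonneg _).trans (hB 0)
  let M := 1 + A + ‖N‖
  have hM : 0 < M := by positivity
  -- In r ≤ θ⁻¹ + θ r² with r = ‖ξ‖, this θ makes the integral of the last term cost at most ε/2;
  -- the length of the interval is then restricted so that the constant terms cost the other half.
  let θ := ε / (2 * M * (B + 1))
  have hθ : 0 < θ := by positivity
  refine ⟨ε / (2 * M * (1 + θ⁻¹)), by positivity, fun n a ha b hb hab hd => ?_⟩
  have c1 := S.continuousOn_L_flowLine (hx n)
  let g : ℝ → E := fun t => S.P n (F (S.L n (x n t))) - N (S.L n (x n t))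
  have c2 : ContinuousOn g (Icc 0 T) :=
    ((S.P n).continuous.comp_continuousOn (hF.comp_continuousOn c1)).sub
      (N.continuous.comp_continuousOn c1)
  have hsub : Icc a b ⊆ Icc 0 T := Icc_subset_Icc ha.1 hb.2
  have hint := intervalIntegral.integral_eq_sub_of_hasDerivAt_of_le (f := fun t => S.K (x n t))
    (f' := g) hab (S.K.continuous.comp_continuousOn ((hx n).continuousOn.mono hsub))
    (fun t ht => by
      have h1 := (hx n).hasDerivAt t ⟨ha.1.trans_lt ht.1, ht.2.trans_le hb.2⟩
      refine (S.K.hasFDerivAt.comp_hasDerivAt t h1).congr_deriv ?_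
      rw [field, S.K_L, map_sub, hNP, S.P_L le_rfl])
    ((c2.mono hsub).intervalIntegrable_of_Icc hab)
  rw [← hint]
  have hi : IntegrableOn (fun t => ‖S.L n (x n t)‖ ^ 2) (Ioo 0 T) :=
    integrable_norm_sq_of_memLp (memLp_of_continuousOn c1)
  have hi2 : IntervalIntegrable (fun t => ‖S.L n (x n t)‖ ^ 2) volume a b :=
    ((c1.norm.pow 2).mono hsub).intervalIntegrable_of_Icc hab
  have hb2 := intervalIntegral.norm_integral_le_of_norm_le (μ := volume) (f := g)
    (g := fun t => M * (1 + θ⁻¹) + M * θ * ‖S.L n (x n t)‖ ^ 2) hab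
    (Eventually.of_forall fun t ht => by
      have ht' : t ∈ Icc 0 T := hsub (Ioc_subset_Icc_self ht)
      set r := ‖S.L n (x n t)‖ with hr
      have hr0 : 0 ≤ r := norm_nonneg _
      have h1 := hAF (S.L n (x n t)) (by rw [S.K_L, hP n t ht']; exact hR n t ht')
      have h2 : ‖F (S.L n (x n t))‖ ≤ 1 + A * (1 + r) := by
        nlinarith [sq_nonneg (‖F (S.L n (x n t))‖ - 1)]
      have h3 : ‖g t‖ ≤ (1 + A * (1 + r)) + ‖N‖ * r :=
        (norm_sub_le _ _).trans (add_le_add ((S.norm_P_le n _).trans h2) (N.le_opNorm _))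
      have h4 : r ≤ θ⁻¹ + θ * r ^ 2 := by
        have h5 : 0 ≤ θ * (r - θ⁻¹) ^ 2 := by positivity
        have h6 : θ * (r - θ⁻¹) ^ 2 = θ * r ^ 2 - 2 * r + θ⁻¹ := by
            field_simp
            ring
        linarith
      have h5 : ‖g t‖ ≤ M * (1 + r) := by
        refine h3.trans ?_
        have : 0 ≤ r + ‖N‖ := by positivity
        simp only [M]
        linarith
      have h6 : M * r ≤ M * (θ⁻¹ + θ * r ^ 2) := by gcongr
      linarith)
    (intervalIntegrable_const.add (hi2.const_mul _))
  refine hb2.trans ?_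
  rw [intervalIntegral.integral_add intervalIntegrable_const (hi2.const_mul _),
    intervalIntegral.integral_const, intervalIntegral.integral_const_mul, smul_eq_mul]
  have h7 : ∫ t in a..b, ‖S.L n (x n t)‖ ^ 2 ≤ B := by
    rw [intervalIntegral.integral_of_le hab, integral_Ioc_eq_integral_Ioo]
    exact (setIntegral_mono_set hi (Eventually.of_forall fun r => sq_nonneg _)
      (Ioo_subset_Ioo ha.1 hb.2).eventuallyLE).trans (hB n)
  have h8 : (b - a) * (M * (1 + θ⁻¹)) ≤ ε / 2 := by
    calc (b - a) * (M * (1 + θ⁻¹)) ≤ ε / (2 * M * (1 + θ⁻¹)) * (M * (1 + θ⁻¹)) := by gcongr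
      _ = ε / 2 := by field_simp
  have h9 : M * θ * ∫ t in a..b, ‖S.L n (x n t)‖ ^ 2 ≤ ε / 2 := by
    calc M * θ * ∫ t in a..b, ‖S.L n (x n t)‖ ^ 2 ≤ M * θ * (B + 1) := by
          gcongr
          linarith
      _ = ε / 2 := by simp only [θ]; field_simp
  linarith

variable {α : Type*} [MeasurableSpace α] {μ : Measure α} [IsFiniteMeasure μ]

lemma memLp_comp (hF : Continuous F) (hS : S.IsSubcritical F) {R : ℝ} {ξ : α → E}
    (hξ : MemLp ξ 2 μ) (hR : ∀ᵐ t ∂μ, ‖S.K (ξ t)‖ ≤ R) : MemLp (fun t => F (ξ t)) 2 μ := by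
  obtain ⟨A, hA, hAF⟩ := S.exists_growth hS R
  have hm : AEStronglyMeasurable (fun t => F (ξ t)) μ := hF.comp_aestronglyMeasurable hξ.1
  rw [memLp_two_iff_integrable_sq_norm hm]
  have h1 : Integrable (fun t => A * (1 + ‖ξ t‖)) μ :=
    ((integrable_const 1).add (hξ.integrable one_le_two).norm).const_mul A
  refine h1.mono' (hm.norm.pow 2) ?_
  filter_upwards [hR] with t ht
  rw [Real.norm_of_nonneg (by positivity)]
  exact hAF _ ht

/-- Young's inequality with a free parameter on ‖K (ξ - η)‖ (1 + ‖ξ‖ + ‖η‖). Smallness of K (ξ - η)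
in mean square is thereby enough even if ξ and η are merely bounded in mean square. -/
lemma integral_sub_sq_le (hF : Continuous F) (hS : S.IsSubcritical F) (R : ℝ) :
    ∃ C : ℝ, 0 ≤ C ∧ ∀ ξ η : α → E, MemLp ξ 2 μ → MemLp η 2 μ → (∀ᵐ t ∂μ, ‖S.K (ξ t)‖ ≤ R) →
      (∀ᵐ t ∂μ, ‖S.K (η t)‖ ≤ R) → ∀ δ > 0, ∫ t, ‖F (ξ t) - F (η t)‖ ^ 2 ∂μ
        ≤ C * (δ * (μ.real univ + ∫ t, ‖ξ t‖ ^ 2 ∂μ + ∫ t, ‖η t‖ ^ 2 ∂μ)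
          + δ⁻¹ * ∫ t, ‖S.K (ξ t - η t)‖ ^ 2 ∂μ) := by
  obtain ⟨C, hC, h⟩ := hS R
  refine ⟨3 * C, by positivity, fun ξ η hξ hη hξR hηR δ hδ => ?_⟩
  have i1 := integrable_norm_sq_of_memLp hξ
  have i2 := integrable_norm_sq_of_memLp hη
  have i3 : Integrable (fun t => ‖S.K (ξ t - η t)‖ ^ 2) μ :=
    integrable_norm_sq_of_memLp (S.K.comp_memLp' (hξ.sub hη))
  have i4 : Integrable (fun t => ‖F (ξ t) - F (η t)‖ ^ 2) μ := integrable_norm_sq_of_memLp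
    ((S.memLp_comp hF hS hξ hξR).sub (S.memLp_comp hF hS hη hηR))
  have i12 : Integrable (fun t => 1 + ‖ξ t‖ ^ 2 + ‖η t‖ ^ 2) μ := ((integrable_const 1).add i1).add i2
  have key : ∫ t, ‖F (ξ t) - F (η t)‖ ^ 2 ∂μ
      ≤ ∫ t, (3 * C) * (δ * (1 + ‖ξ t‖ ^ 2 + ‖η t‖ ^ 2) + δ⁻¹ * ‖S.K (ξ t - η t)‖ ^ 2) ∂μ := by
    refine integral_mono_ae i4 (((i12.const_mul δ).add (i3.const_mul _)).const_mul _) ?_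
    filter_upwards [hξR, hηR] with t h1 h2
    refine (h _ _ h1 h2).trans ?_
    generalize ‖S.K (ξ t - η t)‖ = k
    generalize ‖ξ t‖ = p
    generalize ‖η t‖ = q
    have h5 : 0 ≤ δ * ((1 + p + q) - δ⁻¹ * k) ^ 2 := by positivity
    have h6 : δ * ((1 + p + q) - δ⁻¹ * k) ^ 2
        = δ * (1 + p + q) ^ 2 - 2 * (k * (1 + p + q)) + δ⁻¹ * k ^ 2 := by
      field_simp
      ring
    have h7 : (1 + p + q) ^ 2 ≤ 3 * (1 + p ^ 2 + q ^ 2) := by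
      nlinarith [sq_nonneg (1 - p), sq_nonneg (1 - q), sq_nonneg (p - q)]
    have h8 := mul_le_mul_of_nonneg_left h7 hδ.le
    have h9 : 0 ≤ δ⁻¹ * k ^ 2 := by positivity
    have h10 : 0 ≤ δ * (1 + p ^ 2 + q ^ 2) := by positivity
    have h11 : k * (1 + p + q) ≤ 3 * (δ * (1 + p ^ 2 + q ^ 2) + δ⁻¹ * k ^ 2) := by linarith
    calc C * k * (1 + p + q) = C * (k * (1 + p + q)) := by ring
      _ ≤ C * (3 * (δ * (1 + p ^ 2 + q ^ 2) + δ⁻¹ * k ^ 2)) := by gcongr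
      _ = _ := by ring
  refine key.trans_eq ?_
  rw [integral_const_mul, integral_add (i12.const_mul δ) (i3.const_mul _), integral_const_mul,
    integral_const_mul, integral_add (f := fun t => 1 + ‖ξ t‖ ^ 2) ((integrable_const 1).add i1) i2,
    integral_add (integrable_const 1) i1]
  simp

end GalerkinScale

lemma tendsto_integral_smul {α E : Type*} [MeasurableSpace α] {μ : Measure α} [IsFiniteMeasure μ]
    [NormedAddCommGroup E] [NormedSpace ℝ E] {u : ℕ → α → E} {v : α → E}
    (hu : ∀ n, MemLp (u n) 2 μ) (hv : MemLp v 2 μ)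
    (h : Tendsto (fun n => ∫ t, ‖u n t - v t‖ ^ 2 ∂μ) atTop (𝓝 0)) {η : α → ℝ}
    (hη : AEStronglyMeasurable η μ) {M : ℝ} (hM : ∀ t, |η t| ≤ M) :
    Tendsto (fun n => ∫ t, η t • u n t ∂μ) atTop (𝓝 (∫ t, η t • v t ∂μ)) := by
  have hi : ∀ {w : α → E}, MemLp w 2 μ → Integrable (fun t => η t • w t) μ := fun hw =>
    (hw.integrable one_le_two).bdd_smul M hη (Eventually.of_forall hM)
  rw [tendsto_iff_norm_sub_tendsto_zero]
  have h1 := (tendsto_integral_norm_of_sq (fun n => (hu n).sub hv) h).const_mul M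
  rw [mul_zero] at h1
  refine squeeze_zero (fun n => norm_nonneg _) (fun n => ?_) h1
  rw [← integral_sub (hi (hu n)) (hi hv), ← integral_const_mul]
  refine (norm_integral_le_integral_norm _).trans ?_
  refine integral_mono ((hi (hu n)).sub (hi hv)).norm
    ((((hu n).sub hv).integrable one_le_two).norm.const_mul M) fun t => ?_
  simp only [Pi.sub_apply]
  rw [← smul_sub, norm_smul, Real.norm_eq_abs]
  exact mul_le_mul_of_nonneg_right (hM t) (norm_nonneg _)

/-- Choose δ first, to make the bounded part small, and only then the threshold for a, depending on
δ. -/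
lemma exists_young_parameters {C D ε : ℝ} (hC : 0 ≤ C) (hD : 0 ≤ D) (hε : 0 < ε) :
    ∃ δ > 0, ∃ θ > 0, ∀ a, a ≤ θ → C * (δ * D + δ⁻¹ * a) ≤ ε := by
  let δ := ε / (2 * (C + 1) * (D + 1))
  have hδ : 0 < δ := by positivity
  refine ⟨δ, hδ, δ * (ε / (2 * (C + 1))), by positivity, fun a ha => ?_⟩
  have h1 : δ⁻¹ * a ≤ ε / (2 * (C + 1)) := by
    rw [inv_mul_le_iff₀ hδ]
    exact ha
  have h2 : δ * D ≤ ε / (2 * (C + 1)) := by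
    calc δ * D ≤ δ * (D + 1) := by gcongr; linarith
      _ = ε / (2 * (C + 1)) := by simp only [δ]; field_simp
  calc C * (δ * D + δ⁻¹ * a) ≤ C * (ε / (2 * (C + 1)) + ε / (2 * (C + 1))) :=
        mul_le_mul_of_nonneg_left (add_le_add h2 h1) hC
    _ ≤ (C + 1) * (ε / (2 * (C + 1)) + ε / (2 * (C + 1))) := by
        gcongr
        linarith
    _ = ε := by field_simp; ring

lemma ae_eq_of_integral_norm_sub_sq {α E : Type*} [MeasurableSpace α] {μ : Measure α}
    [NormedAddCommGroup E] {u v : α → E} {w : ℕ → α → E} (hu : MemLp u 2 μ) (hv : MemLp v 2 μ)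
    (hw : ∀ n, MemLp (w n) 2 μ)
    (h1 : Tendsto (fun n => ∫ t, ‖w n t - u t‖ ^ 2 ∂μ) atTop (𝓝 0))
    (h2 : Tendsto (fun n => ∫ t, ‖w n t - v t‖ ^ 2 ∂μ) atTop (𝓝 0)) : u =ᵐ[μ] v := by
  have h3 : ∀ n, ∫ t, ‖u t - v t‖ ^ 2 ∂μ
      ≤ 2 * (∫ t, ‖w n t - v t‖ ^ 2 ∂μ + ∫ t, ‖w n t - u t‖ ^ 2 ∂μ) := by
    intro n
    have e : ∀ t, u t - v t = (w n t - v t) + -(w n t - u t) := fun t => by abel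
    simp only [e]
    refine (integral_norm_add_sq_le ((hw n).sub hv) ((hw n).sub hu).neg).trans_eq ?_
    simp only [Pi.neg_apply, norm_neg, Pi.sub_apply]
  have h4 : Tendsto (fun n => 2 * (∫ t, ‖w n t - v t‖ ^ 2 ∂μ + ∫ t, ‖w n t - u t‖ ^ 2 ∂μ))
      atTop (𝓝 0) := by simpa using (h2.add h1).const_mul 2
  have h5 : ∫ t, ‖u t - v t‖ ^ 2 ∂μ = 0 :=
    le_antisymm (ge_of_tendsto' h4 h3) (integral_nonneg fun t => sq_nonneg _)
  rw [integral_eq_zero_iff_of_nonneg (f := fun t => ‖u t - v t‖ ^ 2) (fun t => sq_nonneg _)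
    (integrable_norm_sq_of_memLp (hu.sub hv))] at h5
  filter_upwards [h5] with t ht
  simpa [sub_eq_zero] using ht

/-! ### Weak form of the Galerkin systems and passage to the limit -/

namespace GalerkinScale

variable {E : Type*} [NormedAddCommGroup E] [InnerProductSpace ℝ E]
  (S : GalerkinScale E) {F : E → E} {N : E →L[ℝ] E}

/-- The Galerkin solutions satisfy the equation of `K x` in the weak sense. -/
lemma weak_form_flowLine [CompleteSpace E] (hF : Continuous F)
    (hNP : ∀ n x, S.P n (N x) = N (S.P n x)) {T : ℝ} (hT : 0 ≤ T) {n : ℕ} {x : ℝ → E}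
    (hx : IsFlowLine (S.field F N n) T x) {η : ℝ → ℝ} (hη : ContDiff ℝ ∞ η)
    (hη' : tsupport η ⊆ Ioo 0 T) :
    ∫ t in Ioo 0 T, deriv η t • S.K (x t)
      = -∫ t in Ioo 0 T, η t • (S.P n (F (S.L n (x t))) - N (S.L n (x t))) := by
  have c1 := S.continuousOn_L_flowLine hx
  have c2 : ContinuousOn (fun t => S.P n (F (S.L n (x t))) - N (S.L n (x t))) (Icc 0 T) :=
    ((S.P n).continuous.comp_continuousOn (hF.comp_continuousOn c1)).sub
      (N.continuous.comp_continuousOn c1)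
  have c3 : ContinuousOn (fun t => S.K (x t)) (Icc 0 T) :=
    S.K.continuous.comp_continuousOn hx.continuousOn
  have hη0 : ∀ t, t ∉ Ioo 0 T → η t = 0 := fun t ht => by
    by_contra h0
    exact ht (hη' (subset_tsupport η h0))
  have c4 : ContinuousOn (fun t => η t • (S.P n (F (S.L n (x t))) - N (S.L n (x t)))) (Icc 0 T) :=
    hη.continuous.continuousOn.smul c2
  have c5 : ContinuousOn (fun t => deriv η t • S.K (x t)) (Icc 0 T) :=
    (hη.continuous_deriv (by simp)).continuousOn.smul c3
  have h := intervalIntegral.integral_eq_sub_of_hasDerivAt_of_le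
    (f := fun t => η t • S.K (x t)) hT (hη.continuous.continuousOn.smul c3)
    (fun t ht => by
      have h1 : HasDerivAt (fun t => S.K (x t))
          (S.P n (F (S.L n (x t))) - N (S.L n (x t))) t := by
        refine (S.K.hasFDerivAt.comp_hasDerivAt t (hx.hasDerivAt t ht)).congr_deriv ?_
        rw [field, S.K_L, map_sub, hNP, S.P_L le_rfl]
      exact ((hη.differentiable (by simp) t).hasDerivAt).smul h1)
    ((c4.add c5).intervalIntegrable_of_Icc hT)
  rw [hη0 T (by simp), hη0 0 (by simp), zero_smul, zero_smul, sub_zero,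
    intervalIntegral.integral_of_le hT, integral_Ioc_eq_integral_Ioo, integral_add'
    ((c4.integrableOn_compact isCompact_Icc).mono_set Ioo_subset_Icc_self)
    ((c5.integrableOn_compact isCompact_Icc).mono_set Ioo_subset_Icc_self)] at h
  rw [eq_neg_iff_add_eq_zero, add_comm]
  exact h

/-- Existence for `(K x)' = F ξ - N ξ`, `x = K ξ`, from a priori bounds on the Galerkin
approximations. -/
theorem exists_solution [CompleteSpace E] (hFL : IsLipschitzOnBalls F) (hS : S.IsSubcritical F)
    {c : ℝ} (hc : 0 < c) (hN : ∀ x, c * ‖x‖ ^ 2 ≤ inner ℝ x (N x))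
    (hNP : ∀ n x, S.P n (N x) = N (S.P n x)) {T : ℝ} (hT : 0 < T) (x₀ : E)
    (hbound : ∃ R, ∀ n τ, 0 ≤ τ → τ ≤ T → ∀ x, x 0 = S.P n x₀ → IsFlowLine (S.field F N n) τ x →
      (∀ t ∈ Icc 0 τ, S.P n (x t) = x t) → ‖x τ‖ ≤ R) :
    ∃ x ξ : ℝ → E, ContinuousOn x (Icc 0 T) ∧ x 0 = x₀ ∧
      MemLp ξ 2 (volume.restrict (Ioo 0 T)) ∧
      (∀ᵐ t ∂volume.restrict (Ioo 0 T), S.K (ξ t) = x t) ∧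
      MemLp (fun t => F (ξ t)) 2 (volume.restrict (Ioo 0 T)) ∧
      IsTimeDeriv T (fun t => S.K (x t)) (fun t => F (ξ t) - N (ξ t)) := by
  have hF := hFL.continuous
  obtain ⟨R, hR⟩ := hbound
  have hex := fun n => exists_isFlowLine (S.isLipschitzOnBalls_field (N := N) hFL n) hT.le
    fun τ h0 h1 x hx0 hx => hR n τ h0 h1 x hx0 hx (S.P_flowLine hx0 hx)
  choose X hX0 hX using hex
  have hXP : ∀ n, ∀ t ∈ Icc 0 T, S.P n (X n t) = X n t := fun n => S.P_flowLine (hX0 n) (hX n)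
  have hXR : ∀ n, ∀ t ∈ Icc 0 T, ‖X n t‖ ≤ R := fun n t ht =>
    hR n t ht.1 ht.2 (X n) (hX0 n) ((hX n).mono ht.2)
      fun r hr => hXP n r ⟨hr.1, hr.2.trans ht.2⟩
  obtain ⟨B, hB'⟩ := S.exists_integral_bound hS hc hN R hT.le
  have hXB := fun n => hB' n (X n) (hX n) (hXP n) (hXR n)
  have hB0 : 0 ≤ B := (integral_nonneg fun t => sq_nonneg _).trans (hXB 0)
  -- Compactness enters here: K sends the ball of radius R, which contains every Galerkin solution,
  -- into one compact set.
  obtain ⟨p, hp, hpc⟩ := exists_uniform_cauchy_subseq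
    (S.compact_K.isCompact_closure_image_closedBall R) (w := fun n t => S.K (X n t))
    (fun n t ht => subset_closure ⟨X n t, by simpa using hXR n t ht, rfl⟩)
    (S.equicontinuous_K hF hS hNP hX hXP hXR hXB)
  let μ : Measure ℝ := volume.restrict (Ioo 0 T)
  have hμ : ∀ᵐ t ∂μ, t ∈ Icc 0 T :=
    (ae_restrict_mem measurableSet_Ioo).mono fun t ht => Ioo_subset_Icc_self ht
  have hμT : μ.real univ = T := by simp [μ, hT.le]
  let y : ℕ → ℝ → E := fun n => X (p n)
  let ξ : ℕ → ℝ → E := fun n t => S.L (p n) (y n t)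
  have hKξ : ∀ n, ∀ t ∈ Icc 0 T, S.K (ξ n t) = y n t := fun n t ht => by
    rw [S.K_L]; exact hXP _ t ht
  have cξ : ∀ n, ContinuousOn (ξ n) (Icc 0 T) := fun n => S.continuousOn_L_flowLine (hX (p n))
  have mξ : ∀ n, MemLp (ξ n) 2 μ := fun n => memLp_of_continuousOn (cξ n)
  have mF : ∀ n, MemLp (fun t => F (ξ n t)) 2 μ := fun n =>
    memLp_of_continuousOn (hF.comp_continuousOn (cξ n))
  have hξB : ∀ n, ∫ t, ‖ξ n t‖ ^ 2 ∂μ ≤ B := fun n => hXB (p n)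
  have hξR : ∀ n, ∀ᵐ t ∂μ, ‖S.K (ξ n t)‖ ≤ R := fun n => hμ.mono fun t ht => by
    rw [hKξ n t ht]; exact hXR _ t ht
  obtain ⟨C, hC, hFC⟩ := S.integral_sub_sq_le (μ := μ) hF hS R
  -- the nonlinear terms form a Cauchy sequence
  have hKc : ∀ ε > 0, ∃ N, ∀ n ≥ N, ∀ m ≥ N, ∫ t, ‖S.K (ξ n t - ξ m t)‖ ^ 2 ∂μ ≤ ε := by
    intro ε hε
    obtain ⟨M, hM⟩ := hpc (ε / (T + 4 * B)) (by positivity)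
    refine ⟨M, fun n hn m hm => ?_⟩
    have i1 := integrable_norm_sq_of_memLp (mξ n)
    have i2 := integrable_norm_sq_of_memLp (mξ m)
    have h1 : ∫ t, ‖S.K (ξ n t - ξ m t)‖ ^ 2 ∂μ
        ≤ ∫ t, ε / (T + 4 * B) * (1 + (2 * ‖ξ n t‖ ^ 2 + 2 * ‖ξ m t‖ ^ 2)) ∂μ := by
      refine integral_mono_ae
        (integrable_norm_sq_of_memLp (S.K.comp_memLp' ((mξ n).sub (mξ m))))
        (((integrable_const 1).add ((i1.const_mul 2).add (i2.const_mul 2))).const_mul _) ?_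
      filter_upwards [hμ] with t ht
      have e : S.K (S.K (ξ n t - ξ m t)) = S.K (X (p n) t) - S.K (X (p m) t) := by
        rw [map_sub, hKξ n t ht, hKξ m t ht, map_sub]
      have h2 := hM n hn m hm t ht
      rw [← e] at h2
      have h3 := norm_add_sq_le_two (ξ n t) (-ξ m t)
      rw [norm_neg, ← sub_eq_add_neg] at h3
      set ζ := ξ n t - ξ m t
      have h0 := norm_nonneg ζ
      -- Interpolation ‖K ζ‖² ≤ ‖ζ‖ ‖K² ζ‖: the factor K² ζ = K x_n - K x_m is uniformly small,
      -- while ‖ζ‖ is bounded by 1 plus quantities of integral at most 4B. Hence the T + 4B in the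
      -- choice of M.
      calc ‖S.K ζ‖ ^ 2 = inner ℝ ζ (S.K (S.K ζ)) := by
            rw [← real_inner_self_eq_norm_sq, S.inner_K]
        _ ≤ ‖ζ‖ * (ε / (T + 4 * B)) :=
            (real_inner_le_norm _ _).trans (by gcongr)
        _ ≤ (1 + (2 * ‖ξ n t‖ ^ 2 + 2 * ‖ξ m t‖ ^ 2)) * (ε / (T + 4 * B)) := by
            gcongr
            nlinarith [sq_nonneg (‖ζ‖ - 1)]
        _ = _ := mul_comm _ _
    refine h1.trans ?_
    rw [integral_const_mul, integral_add (g := fun t => 2 * ‖ξ n t‖ ^ 2 + 2 * ‖ξ m t‖ ^ 2) (integrable_const 1)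
        ((i1.const_mul 2).add (i2.const_mul 2)),
      integral_add (i1.const_mul 2) (i2.const_mul 2), integral_const_mul, integral_const_mul,
      integral_const, hμT, smul_eq_mul, mul_one]
    calc _ ≤ ε / (T + 4 * B) * (T + 4 * B) := by
          have := hξB n
          have := hξB m
          gcongr
          linarith
      _ = ε := by field_simp
  have hFc : ∀ ε > 0, ∃ N, ∀ n ≥ N, ∀ m ≥ N, ∫ t, ‖F (ξ n t) - F (ξ m t)‖ ^ 2 ∂μ ≤ ε := by
    intro ε hε
    obtain ⟨δ, hδ, θ, hθ, h⟩ := exists_young_parameters hC (show 0 ≤ T + B + B by positivity) hε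
    obtain ⟨M, hM⟩ := hKc θ hθ
    refine ⟨M, fun n hn m hm => ?_⟩
    refine (hFC _ _ (mξ n) (mξ m) (hξR n) (hξR m) δ hδ).trans (le_trans ?_ (h _ (hM n hn m hm)))
    rw [hμT]
    have := hξB n
    have := hξB m
    gcongr
  obtain ⟨f, mf, hf⟩ := exists_limit_of_cauchy mF hFc
  have hpt : Tendsto p atTop atTop := hp.tendsto_atTop
  have mPF : ∀ n, MemLp (fun t => S.P (p n) (F (ξ n t))) 2 μ := fun n =>
    (S.P (p n)).comp_memLp' (mF n)
  have hPf : Tendsto (fun n => ∫ t, ‖S.P (p n) (f t) - f t‖ ^ 2 ∂μ) atTop (𝓝 0) := by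
    have h0 : ∫ _, (0 : ℝ) ∂μ = 0 := integral_zero _ _
    rw [← h0]
    refine tendsto_integral_of_dominated_convergence (fun t => 4 * ‖f t‖ ^ 2)
      (fun n => ((((S.P (p n)).comp_memLp' mf).sub mf).1.norm.pow 2))
      ((integrable_norm_sq_of_memLp mf).const_mul 4)
      (fun n => Eventually.of_forall fun t => ?_) (Eventually.of_forall fun t => ?_)
    · rw [Real.norm_of_nonneg (sq_nonneg _)]
      have h1 := norm_add_sq_le_two (S.P (p n) (f t)) (-f t)
      rw [norm_neg, ← sub_eq_add_neg] at h1
      have h2 : ‖S.P (p n) (f t)‖ ^ 2 ≤ ‖f t‖ ^ 2 := by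
        gcongr
        exact S.norm_P_le _ _
      linarith
    · have h1 := ((S.tendsto_P (f t)).comp hpt).sub_const (f t)
      simpa using h1.norm.pow 2
  have hPFf : Tendsto (fun n => ∫ t, ‖S.P (p n) (F (ξ n t)) - f t‖ ^ 2 ∂μ) atTop (𝓝 0) := by
    have h1 := (hf.add hPf).const_mul 2
    rw [add_zero, mul_zero] at h1
    refine squeeze_zero (fun n => integral_nonneg fun t => sq_nonneg _) (fun n => ?_) h1
    have e : ∀ t, S.P (p n) (F (ξ n t)) - f t
        = S.P (p n) (F (ξ n t) - f t) + (S.P (p n) (f t) - f t) := fun t => by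
      rw [map_sub]; abel
    simp only [e]
    refine (integral_norm_add_sq_le ((S.P (p n)).comp_memLp' ((mF n).sub mf))
      (((S.P (p n)).comp_memLp' mf).sub mf)).trans ?_
    simp only [Pi.sub_apply]
    gcongr 2 * (?_ + _)
    refine integral_mono
      (integrable_norm_sq_of_memLp ((S.P (p n)).comp_memLp' ((mF n).sub mf)))
      (integrable_norm_sq_of_memLp ((mF n).sub mf)) fun t => ?_
    simp only [Function.comp, Pi.sub_apply]
    gcongr
    exact S.norm_P_le _ _
  -- the approximations form a Cauchy sequence
  have hyc : ∀ ε > 0, ∃ M, ∀ n ≥ M, ∀ m ≥ M, ∀ t ∈ Icc 0 T,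
      ‖y n t - y m t‖ ^ 2 + c * ∫ r in Ioo 0 t, ‖ξ n r - ξ m r‖ ^ 2 ≤ ε := by
    intro ε hε
    obtain ⟨M₁, h₁⟩ := Metric.cauchySeq_iff.1 ((S.tendsto_P x₀).comp hpt).cauchySeq √(ε / 2)
      (by positivity)
    obtain ⟨M₂, h₂⟩ := cauchy_of_tendsto mPF mf hPFf (c * (ε / 2)) (by positivity)
    refine ⟨max M₁ M₂, fun n hn m hm t ht => ?_⟩
    refine (S.norm_sub_sq_add_le hF hc hN hNP (hX (p n)) (hX (p m)) (hXP _) (hXP _) ht).trans ?_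
    have h3 := h₂ n ((le_max_right _ _).trans hn) m ((le_max_right _ _).trans hm)
    have h4 := h₁ n ((le_max_left _ _).trans hn) m ((le_max_left _ _).trans hm)
    rw [dist_eq_norm, Real.lt_sqrt (norm_nonneg _)] at h4
    have h5 := mul_le_mul_of_nonneg_left h3 (inv_pos.2 hc).le
    rw [inv_mul_cancel_left₀ hc.ne'] at h5
    rw [hX0, hX0]
    simp only [Function.comp] at h4
    simp only [ξ, y, μ] at h5
    linarith
  have hξc : ∀ ε > 0, ∃ M, ∀ n ≥ M, ∀ m ≥ M, ∫ t, ‖ξ n t - ξ m t‖ ^ 2 ∂μ ≤ ε := by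
    intro ε hε
    obtain ⟨M, hM⟩ := hyc (c * ε) (by positivity)
    refine ⟨M, fun n hn m hm => ?_⟩
    have h1 := hM n hn m hm T (right_mem_Icc.2 hT.le)
    have h2 : c * ∫ r in Ioo 0 T, ‖ξ n r - ξ m r‖ ^ 2 ≤ c * ε := by
      linarith [sq_nonneg ‖y n T - y m T‖]
    exact le_of_mul_le_mul_left h2 hc
  obtain ⟨ζ, mζ, hζ⟩ := exists_limit_of_cauchy mξ hξc
  have hyu : UniformCauchySeqOn y atTop (Icc 0 T) := by
    rw [Metric.uniformCauchySeqOn_iff]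
    intro ε hε
    obtain ⟨M, hM⟩ := hyc (ε ^ 2 / 2) (by positivity)
    refine ⟨M, fun n hn m hm t ht => ?_⟩
    rw [dist_eq_norm]
    refine abs_lt_of_sq_lt_sq' ?_ hε.le |>.2
    have h1 := hM n hn m hm t ht
    have h2 : 0 ≤ c * ∫ r in Ioo 0 t, ‖ξ n r - ξ m r‖ ^ 2 :=
      mul_nonneg hc.le (integral_nonneg fun r => sq_nonneg _)
    linarith [pow_pos hε 2]
  let x : ℝ → E := fun t => limUnder atTop fun n => y n t
  have hyx : ∀ t ∈ Icc 0 T, Tendsto (fun n => y n t) atTop (𝓝 (x t)) := fun t ht =>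
    (hyu.cauchySeq ht).tendsto_limUnder
  have hyxu : TendstoUniformlyOn y x atTop (Icc 0 T) := hyu.tendstoUniformlyOn_of_tendsto hyx
  have cx : ContinuousOn x (Icc 0 T) :=
    hyxu.continuousOn (Frequently.of_forall fun n => (hX (p n)).continuousOn)
  have mx : MemLp x 2 μ := memLp_of_continuousOn cx
  have my : ∀ n, MemLp (y n) 2 μ := fun n => memLp_of_continuousOn (hX (p n)).continuousOn
  have hyx2 : Tendsto (fun n => ∫ t, ‖y n t - x t‖ ^ 2 ∂μ) atTop (𝓝 0) := by
    have h0 : ∫ _, (0 : ℝ) ∂μ = 0 := integral_zero _ _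
    rw [← h0]
    refine tendsto_integral_of_dominated_convergence (fun _ => (2 * R) ^ 2)
      (fun n => ((my n).sub mx).1.norm.pow 2) (integrable_const _) (fun n => ?_) ?_
    · filter_upwards [hμ] with t ht
      rw [Real.norm_of_nonneg (sq_nonneg _)]
      have h1 : ‖x t‖ ≤ R := le_of_tendsto (hyx t ht).norm (Eventually.of_forall fun n => hXR _ t ht)
      have h2 : ‖y n t‖ ≤ R := hXR _ t ht
      gcongr
      linarith [norm_sub_le (y n t) (x t)]
    · filter_upwards [hμ] with t ht
      have h1 := (hyx t ht).sub_const (x t)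
      simpa using h1.norm.pow 2
  have hKζ2 : Tendsto (fun n => ∫ t, ‖S.K (ξ n t - ζ t)‖ ^ 2 ∂μ) atTop (𝓝 0) := by
    refine squeeze_zero (fun n => integral_nonneg fun t => sq_nonneg _) (fun n => ?_) hζ
    refine integral_mono (integrable_norm_sq_of_memLp (S.K.comp_memLp' ((mξ n).sub mζ)))
      (integrable_norm_sq_of_memLp ((mξ n).sub mζ)) fun t => ?_
    beta_reduce
    gcongr
    exact S.norm_K_le _
  have hKζ : (fun t => S.K (ζ t)) =ᵐ[μ] x := by
    refine ae_eq_of_integral_norm_sub_sq (w := y) (S.K.comp_memLp' mζ) mx my ?_ hyx2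
    refine hKζ2.congr fun n => integral_congr_ae ?_
    filter_upwards [hμ] with t ht
    rw [map_sub, hKξ n t ht]
  have hζR : ∀ᵐ t ∂μ, ‖S.K (ζ t)‖ ≤ R := by
    filter_upwards [hμ, hKζ] with t ht h1
    rw [h1]
    exact le_of_tendsto (hyx t ht).norm (Eventually.of_forall fun n => hXR _ t ht)
  have mFζ := S.memLp_comp hF hS mζ hζR
  -- The limit of F(ξ_n) is identified by the same mean square estimate, now between ξ_n and its
  -- limit ζ.
  have hFζ : f =ᵐ[μ] fun t => F (ζ t) := by
    refine ae_eq_of_integral_norm_sub_sq mf mFζ mF hf ?_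
    rw [Metric.tendsto_atTop]
    intro ε hε
    have hζ0 : 0 ≤ ∫ t, ‖ζ t‖ ^ 2 ∂μ := integral_nonneg fun t => sq_nonneg _
    obtain ⟨δ, hδ, θ, hθ, h⟩ := exists_young_parameters hC
      (show 0 ≤ T + B + ∫ t, ‖ζ t‖ ^ 2 ∂μ by positivity) (half_pos hε)
    obtain ⟨M, hM⟩ := eventually_atTop.1 (hKζ2.eventually_le_const hθ)
    refine ⟨M, fun n hn => ?_⟩
    rw [Real.dist_eq, sub_zero, abs_of_nonneg (integral_nonneg fun t => sq_nonneg _)]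
    refine lt_of_le_of_lt ?_ (half_lt_self hε)
    refine (hFC _ _ (mξ n) mζ (hξR n) hζR δ hδ).trans (le_trans ?_ (h _ (hM n hn)))
    rw [hμT]
    have := hξB n
    gcongr
  refine ⟨x, ζ, cx, ?_, mζ, hKζ, mFζ, fun η hη hηc hηs => ?_⟩
  · refine tendsto_nhds_unique (hyx 0 (left_mem_Icc.2 hT.le)) ?_
    refine ((S.tendsto_P x₀).comp hpt).congr fun n => ?_
    exact (hX0 (p n)).symm
  · have hd : HasCompactSupport (deriv η) := hηc.deriv
    obtain ⟨M₁, hM₁⟩ := hη.continuous.bounded_above_of_compact_support hηc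
    obtain ⟨M₂, hM₂⟩ := (hη.continuous_deriv (by simp)).bounded_above_of_compact_support hd
    have l1 := tendsto_integral_smul (μ := μ) (fun n => S.K.comp_memLp' (my n)) (S.K.comp_memLp' mx)
      (squeeze_zero (fun n => integral_nonneg fun t => sq_nonneg _) (fun n => by
        refine integral_mono (integrable_norm_sq_of_memLp
          ((S.K.comp_memLp' (my n)).sub (S.K.comp_memLp' mx)))
          (integrable_norm_sq_of_memLp ((my n).sub mx)) fun t => ?_
        simp only [Function.comp]
        rw [← map_sub]
        gcongr
        exact S.norm_K_le _) hyx2)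
      (hη.continuous_deriv (by simp)).aestronglyMeasurable hM₂
    have mN : ∀ n, MemLp (fun t => N (ξ n t)) 2 μ := fun n => N.comp_memLp' (mξ n)
    have mNζ : MemLp (fun t => N (ζ t)) 2 μ := N.comp_memLp' mζ
    have lN : Tendsto (fun n => ∫ t, ‖N (ξ n t) - N (ζ t)‖ ^ 2 ∂μ) atTop (𝓝 0) := by
      have h1 := hζ.const_mul (‖N‖ ^ 2)
      rw [mul_zero] at h1
      refine squeeze_zero (fun n => integral_nonneg fun t => sq_nonneg _) (fun n => ?_) h1
      rw [← integral_const_mul]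
      refine integral_mono (integrable_norm_sq_of_memLp ((mN n).sub mNζ))
        ((integrable_norm_sq_of_memLp ((mξ n).sub mζ)).const_mul _) fun t => ?_
      beta_reduce
      rw [← map_sub, ← mul_pow]
      gcongr
      exact N.le_opNorm _
    have l2 := tendsto_integral_smul (μ := μ) mPF mf hPFf hη.continuous.aestronglyMeasurable hM₁
    have l3 := tendsto_integral_smul (μ := μ) mN mNζ lN hη.continuous.aestronglyMeasurable hM₁
    have hi : ∀ {w : ℝ → E}, MemLp w 2 μ → Integrable (fun t => η t • w t) μ := fun hw =>
      (hw.integrable one_le_two).bdd_smul M₁ hη.continuous.aestronglyMeasurable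
        (Eventually.of_forall hM₁)
    refine tendsto_nhds_unique l1 ?_
    have e1 : ∫ t in Ioo 0 T, η t • (F (ζ t) - N (ζ t))
        = ∫ t, η t • f t ∂μ - ∫ t, η t • N (ζ t) ∂μ := by
      rw [← integral_sub (hi mf) (hi mNζ)]
      refine integral_congr_ae ?_
      filter_upwards [hFζ] with t ht
      rw [ht, smul_sub]
    rw [e1]
    refine (l2.sub l3).neg.congr fun n => ?_
    rw [← integral_sub (hi (mPF n)) (hi (mN n))]
    refine Eq.trans ?_ (S.weak_form_flowLine hF hNP hT.le (hX (p n)) hη hηs).symm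
    simp only [smul_sub]
    rfl

end GalerkinScale

/-! ### The nonlinear terms -/

instance : ENNReal.HolderTriple 4 4 2 := ⟨by
  rw [← two_mul, show (4 : ℝ≥0∞) = 2 * 2 by norm_num, ENNReal.mul_inv (by simp) (by simp),
    ← mul_assoc, ENNReal.mul_inv_cancel (by simp) (by simp), one_mul]⟩

/-- The product `L⁴ × L⁴ → L²`. -/
noncomputable def mulFour : Lp ℝ 4 vol →L[ℝ] Lp ℝ 4 vol →L[ℝ] L2 :=
  (ContinuousLinearMap.mul ℝ ℝ).holderL vol 4 4 2

/-- The product `L^∞ × L² → L²`. -/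
noncomputable def mulTop : Lp ℝ ∞ vol →L[ℝ] L2 →L[ℝ] L2 :=
  (ContinuousLinearMap.mul ℝ ℝ).holderL vol ∞ 2 2

lemma coeFn_mulFour (f g : Lp ℝ 4 vol) : mulFour f g =ᵐ[vol] fun x => f x * g x :=
  (ContinuousLinearMap.mul ℝ ℝ).coeFn_holder f g

lemma coeFn_mulTop (f : Lp ℝ ∞ vol) (g : L2) : mulTop f g =ᵐ[vol] fun x => f x * g x :=
  (ContinuousLinearMap.mul ℝ ℝ).coeFn_holder f g

lemma norm_mulFour_le (f g : Lp ℝ 4 vol) : ‖mulFour f g‖ ≤ ‖f‖ * ‖g‖ := by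
  refine ((ContinuousLinearMap.mul ℝ ℝ).norm_holder_apply_apply_le f g).trans ?_
  rw [ContinuousLinearMap.opNorm_mul, one_mul]

/-- `(1 - Δ)^{-1/2}` on fields. -/
noncomputable abbrev besselV : L2Vec →L[ℝ] L2Vec := vecMap bessel

lemma norm_L2Vec_sq (w : L2Vec) : ‖w‖ ^ 2 = ‖w 0‖ ^ 2 + ‖w 1‖ ^ 2 := by
  rw [PiLp.norm_sq_eq_of_L2, Fin.sum_univ_two]

lemma norm_L2Vec_le (w : L2Vec) : ‖w‖ ≤ ‖w 0‖ + ‖w 1‖ := by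
  refine abs_le_of_sq_le_sq' ?_ (by positivity) |>.2
  rw [norm_L2Vec_sq]
  nlinarith [norm_nonneg (w 0), norm_nonneg (w 1)]

lemma norm_besselV_le (w : L2Vec) : ‖besselV w‖ ≤ ‖w‖ := by
  refine abs_le_of_sq_le_sq' ?_ (by positivity) |>.2
  rw [norm_L2Vec_sq, norm_L2Vec_sq]
  have h0 := norm_bessel_le (w 0)
  have h1 := norm_bessel_le (w 1)
  simp only [vecMap_apply]
  gcongr

/-- The transport term `(u · ∇) w`, in terms of `(1 - Δ) u` and `(1 - Δ) w`. -/
noncomputable def adv (u w : L2Vec) : L2Vec :=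
  WithLp.toLp 2 fun i => ∑ j, mulFour (besselL4 (bessel (u j))) (besselL4 (riesz j (w i)))

/-- The transport term `u · ∇ f`, in terms of `(1 - Δ) u` and `(1 - Δ)^{1/2} f`. -/
noncomputable def advScalar (u : L2Vec) (φ : L2) : L2 :=
  ∑ j, mulTop (besselLinf (u j)) (riesz j φ)

lemma adv_apply (u w : L2Vec) (i : Fin 2) :
    adv u w i = ∑ j, mulFour (besselL4 (bessel (u j))) (besselL4 (riesz j (w i))) := rfl

lemma coeFn_finset_sum {ι : Type*} (s : Finset ι) (f : ι → L2) :
    ⇑(∑ i ∈ s, f i) =ᵐ[vol] fun x => ∑ i ∈ s, f i x := by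
  classical
  induction s using Finset.induction_on with
  | empty =>
    simp only [Finset.sum_empty]
    exact Lp.coeFn_zero ℝ 2 vol
  | insert a s ha ih =>
    simp only [Finset.sum_insert ha]
    filter_upwards [Lp.coeFn_add (f a) (∑ i ∈ s, f i), ih] with x h1 h2
    rw [h1, Pi.add_apply, h2]

lemma coeFn_adv (u w : L2Vec) (i : Fin 2) :
    adv u w i =ᵐ[vol] fun x => ∑ j, bessel (bessel (u j)) x * riesz j (bessel (w i)) x := by
  rw [adv_apply]
  refine (coeFn_finset_sum _ _).trans ?_
  have h : ∀ j, mulFour (besselL4 (bessel (u j))) (besselL4 (riesz j (w i)))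
      =ᵐ[vol] fun x => bessel (bessel (u j)) x * riesz j (bessel (w i)) x := by
    intro j
    filter_upwards [coeFn_mulFour (besselL4 (bessel (u j))) (besselL4 (riesz j (w i))),
      coeFn_besselL4 (bessel (u j)), coeFn_besselL4 (riesz j (w i))] with x h1 h2 h3
    rw [h1, h2, h3, bessel_riesz]
  filter_upwards [h 0, h 1] with x h0 h1
  rw [Fin.sum_univ_two, Fin.sum_univ_two, h0, h1]

lemma coeFn_advScalar (u : L2Vec) (φ : L2) :
    advScalar u φ =ᵐ[vol] fun x => ∑ j, bessel (bessel (u j)) x * riesz j φ x := by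
  rw [advScalar]
  refine (coeFn_finset_sum _ _).trans ?_
  have h : ∀ j, mulTop (besselLinf (u j)) (riesz j φ)
      =ᵐ[vol] fun x => bessel (bessel (u j)) x * riesz j φ x := by
    intro j
    filter_upwards [coeFn_mulTop (besselLinf (u j)) (riesz j φ),
      coeFn_besselLinf (u j)] with x h1 h2
    rw [h1, h2]
  filter_upwards [h 0, h 1] with x h0 h1
  rw [Fin.sum_univ_two, Fin.sum_univ_two, h0, h1]

/-- Two readings of one pointwise product. The L⁴ · L⁴ reading carries the sharp norm bounds; the
L^∞ · L² reading tolerates a less regular second factor and suits integration by parts. -/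
lemma adv_apply_eq_advScalar (u w : L2Vec) (i : Fin 2) :
    adv u w i = advScalar u (bessel (w i)) :=
  Lp.ext ((coeFn_adv u w i).trans (coeFn_advScalar u (bessel (w i))).symm)

lemma adv_sub_left (u u' w : L2Vec) : adv (u - u') w = adv u w - adv u' w := by
  ext1 i
  simp [adv_apply, Finset.sum_sub_distrib]

lemma adv_sub_right (u w w' : L2Vec) : adv u (w - w') = adv u w - adv u w' := by
  ext1 i
  simp [adv_apply, Finset.sum_sub_distrib]

lemma advScalar_sub_left (u u' : L2Vec) (φ : L2) :
    advScalar (u - u') φ = advScalar u φ - advScalar u' φ := by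
  simp [advScalar, Finset.sum_sub_distrib]

lemma advScalar_sub_right (u : L2Vec) (φ φ' : L2) :
    advScalar u (φ - φ') = advScalar u φ - advScalar u φ' := by
  simp [advScalar, Finset.sum_sub_distrib]

lemma continuous_advScalar (u : L2Vec) : Continuous (advScalar u) := by
  unfold advScalar
  fun_prop

lemma norm_besselL4_le (f : L2) : ‖besselL4 f‖ ≤ 2 * ‖f‖ := by
  refine abs_le_of_sq_le_sq' ?_ (by positivity) |>.2
  refine (norm_besselL4_sq_le f).trans ?_
  nlinarith [norm_bessel_le f, norm_nonneg f, norm_nonneg (bessel f)]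

lemma norm_besselL4_field_sq_le (u : L2Vec) (j : Fin 2) :
    ‖besselL4 (bessel (u j))‖ ^ 2 ≤ 3 * ‖besselV (besselV u)‖ * ‖besselV u‖ := by
  refine (norm_besselL4_sq_le _).trans ?_
  gcongr
  · exact PiLp.norm_apply_le (besselV (besselV u)) j
  · exact PiLp.norm_apply_le (besselV u) j

lemma norm_besselL4_riesz_sq_le (j : Fin 2) (f : L2) :
    ‖besselL4 (riesz j f)‖ ^ 2 ≤ 3 * ‖bessel f‖ * ‖f‖ := by
  refine (norm_besselL4_sq_le _).trans ?_
  rw [bessel_riesz]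
  gcongr
  · exact norm_riesz_le j _
  · exact norm_riesz_le j f

/-- Hölder in L⁴ · L⁴, then Ladyzhenskaya on each factor. In terms of the actual fields the bound is
by |u|_{L²} |u|_{H¹} |w|_{H¹} |w|_{H²}. Each of the four products is at most 3√(AB), so the sum is
at most 12√(AB), and 144 = 12². -/
lemma norm_adv_sq_le (u w : L2Vec) : ‖adv u w‖ ^ 2
    ≤ 144 * (‖besselV (besselV u)‖ * ‖besselV u‖ * (‖besselV w‖ * ‖w‖)) := by
  set A := ‖besselV (besselV u)‖ * ‖besselV u‖
  set B := ‖besselV w‖ * ‖w‖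
  have hA : 0 ≤ A := by positivity
  have hB : 0 ≤ B := by positivity
  have h1 : ∀ i j, ‖mulFour (besselL4 (bessel (u j))) (besselL4 (riesz j (w i)))‖ ≤ 3 * √(A * B) := by
    intro i j
    refine abs_le_of_sq_le_sq' ?_ (by positivity) |>.2
    rw [mul_pow, Real.sq_sqrt (by positivity)]
    have e1 : ‖besselL4 (bessel (u j))‖ ^ 2 ≤ 3 * A :=
      (norm_besselL4_field_sq_le u j).trans_eq (by ring)
    have e2 : ‖besselL4 (riesz j (w i))‖ ^ 2 ≤ 3 * B := by
      refine (norm_besselL4_riesz_sq_le j (w i)).trans ?_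
      rw [mul_assoc]
      gcongr
      exact mul_le_mul (PiLp.norm_apply_le (besselV w) i) (PiLp.norm_apply_le w i)
        (norm_nonneg _) (norm_nonneg _)
    calc _ ≤ (‖besselL4 (bessel (u j))‖ * ‖besselL4 (riesz j (w i))‖) ^ 2 := by
          gcongr; exact norm_mulFour_le _ _
      _ ≤ (3 * A) * (3 * B) := by rw [mul_pow]; gcongr
      _ = 3 ^ 2 * (A * B) := by ring
  have h2 : ∀ i, ‖adv u w i‖ ≤ 6 * √(A * B) := by
    intro i
    rw [adv_apply, Fin.sum_univ_two]
    refine (norm_add_le _ _).trans ?_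
    linarith [h1 i 0, h1 i 1]
  have h3 : ‖adv u w‖ ≤ 12 * √(A * B) := (norm_L2Vec_le _).trans (by linarith [h2 0, h2 1])
  calc ‖adv u w‖ ^ 2 ≤ (12 * √(A * B)) ^ 2 := by gcongr
    _ = 144 * (A * B) := by rw [mul_pow, Real.sq_sqrt (by positivity)]; norm_num

/-- Skew symmetry of the transport term. -/
lemma inner_advScalar_skew {u : L2Vec} (hu : u ∈ HSpace) (φ ψ : L2) :
    inner ℝ (advScalar u φ) (bessel ψ) = -inner ℝ (advScalar u ψ) (bessel φ) := by
  -- For truncated φ and ψ the product of the two trigonometric polynomials is a legitimate test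
  -- function for the weak divergence of the velocity, and that divergence is zero.
  have key : ∀ n, inner ℝ (advScalar u (proj n φ)) (bessel (proj n ψ))
      + inner ℝ (advScalar u (proj n ψ)) (bessel (proj n φ)) = 0 := by
    intro n
    let a : Fin 2 → L2 := fun j => bessel (bessel (u j))
    let f := trigFn n (bessel φ)
    let h := trigFn n (bessel ψ)
    have hf : IsSmooth f := isSmooth_trigFn n _
    have hh : IsSmooth h := isSmooth_trigFn n _
    have e1 : ∀ χ ρ : L2, inner ℝ (advScalar u (proj n χ)) (bessel (proj n ρ))
        = ∫ x, ∑ j, a j x * (pderiv j (trigFn n (bessel χ)) x * trigFn n (bessel ρ) x) ∂vol := by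
      intro χ ρ
      rw [L2.inner_def]
      refine integral_congr_ae ?_
      rw [bessel_proj]
      filter_upwards [coeFn_advScalar u (proj n χ), coeFn_proj n (bessel ρ),
        coeFn_proj n (riesz 0 χ), coeFn_proj n (riesz 1 χ)] with x h1 h2 h3 h4
      simp only [Fin.sum_univ_two, riesz_proj] at h1
      simp only [h1, h2, h3, h4, Fin.sum_univ_two, pderiv_trigFn_bessel, a]
      simp
      ring
    have i1 : ∀ {p : T2 → ℝ} (_ : Continuous p) j, Integrable (fun x => a j x * p x) vol :=
      fun hp j => integrable_mul (a j) hp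
    have c1 : ∀ j, Continuous fun x => pderiv j f x * h x := fun j =>
      (hf.continuous_pderiv j).mul hh.continuous
    have c2 : ∀ j, Continuous fun x => pderiv j h x * f x := fun j =>
      (hh.continuous_pderiv j).mul hf.continuous
    rw [e1, e1, integral_finsetSum _ (fun j _ => i1 (c1 j) j),
      integral_finsetSum _ (fun j _ => i1 (c2 j) j), ← Finset.sum_add_distrib]
    have e2 : ∀ j, ∫ x, a j x * (pderiv j f x * h x) ∂vol + ∫ x, a j x * (pderiv j h x * f x) ∂vol
        = -∫ x, riesz j (bessel (u j)) x * (f x * h x) ∂vol := by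
      intro j
      rw [← integral_add (i1 (c1 j) j) (i1 (c2 j) j),
        ← isWeakPartial_bessel j (bessel (u j)) _ (hf.mul hh)]
      congr 1
      funext x
      rw [pderiv_mul hf hh]
      ring
    have hd : ∑ j, riesz j (bessel (u j)) = 0 :=
      sum_riesz_eq_zero (isMultiplier_bessel.vecMap_mem hu)
    refine (Finset.sum_congr rfl fun j _ => e2 j).trans ?_
    rw [Finset.sum_neg_distrib, neg_eq_zero, ← integral_finsetSum _
      (fun j _ => integrable_mul (riesz j (bessel (u j))) (hf.mul hh).continuous)]
    rw [← integral_zero T2 ℝ]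
    refine integral_congr_ae ?_
    have h0 := coeFn_finset_sum Finset.univ fun j => riesz j (bessel (u j))
    rw [hd] at h0
    filter_upwards [h0, Lp.coeFn_zero ℝ 2 vol] with x h1 h2
    rw [← Finset.sum_mul, ← h1, h2, Pi.zero_apply, zero_mul]
  have hc : Tendsto (fun n => inner ℝ (advScalar u (proj n φ)) (bessel (proj n ψ))
      + inner ℝ (advScalar u (proj n ψ)) (bessel (proj n φ))) atTop
      (𝓝 (inner ℝ (advScalar u φ) (bessel ψ) + inner ℝ (advScalar u ψ) (bessel φ))) := by
    have t1 : ∀ χ, Tendsto (fun n => advScalar u (proj n χ)) atTop (𝓝 (advScalar u χ)) := fun χ =>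
      ((continuous_advScalar u).tendsto χ).comp (tendsto_proj χ)
    have t2 : ∀ χ, Tendsto (fun n => bessel (proj n χ)) atTop (𝓝 (bessel χ)) := fun χ =>
      (bessel.continuous.tendsto χ).comp (tendsto_proj χ)
    exact ((t1 φ).inner (t2 ψ)).add ((t1 ψ).inner (t2 φ))
  simp only [key] at hc
  rw [eq_neg_iff_add_eq_zero]
  exact tendsto_nhds_unique hc tendsto_const_nhds

lemma inner_adv_skew {u : L2Vec} (hu : u ∈ HSpace) (v w : L2Vec) :
    inner ℝ (adv u v) (besselV (besselV w)) = -inner ℝ (adv u w) (besselV (besselV v)) := by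
  simp only [PiLp.inner_apply, adv_apply_eq_advScalar, vecMap_apply]
  rw [← Finset.sum_neg_distrib]
  exact Finset.sum_congr rfl fun i _ => inner_advScalar_skew hu _ _

lemma inner_adv_self {u : L2Vec} (hu : u ∈ HSpace) (v : L2Vec) :
    inner ℝ (adv u v) (besselV (besselV v)) = 0 := by
  linarith [inner_adv_skew hu v v]

lemma norm_le_of_inner_le {X : Type*} [NormedAddCommGroup X] [InnerProductSpace ℝ X] {x : X} {C : ℝ}
    (hC : 0 ≤ C) (h : ∀ y, inner ℝ x y ≤ C * ‖y‖) : ‖x‖ ≤ C := by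
  have h1 := h x
  rw [real_inner_self_eq_norm_sq] at h1
  rcases (norm_nonneg x).eq_or_lt with h0 | h0
  · rwa [← h0]
  · nlinarith

/-- Duality: skew symmetry moves the derivative onto the test function, so φ enters undifferentiated
and Ladyzhenskaya applies to it. This is the H^{-1} bound on u · ∇θ, in which the H¹ norm of θ
appears only to the first power. -/
lemma norm_bessel_advScalar_sq_le {u : L2Vec} (hu : u ∈ HSpace) (φ : L2) :
    ‖bessel (advScalar u φ)‖ ^ 2
      ≤ 36 * (‖besselV (besselV u)‖ * ‖besselV u‖ * (‖bessel φ‖ * ‖φ‖)) := by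
  set A := ‖besselV (besselV u)‖ * ‖besselV u‖
  set B := ‖bessel φ‖ * ‖φ‖
  have hA : 0 ≤ A := by positivity
  have hB : 0 ≤ B := by positivity
  have h1 : ∀ j, ‖mulFour (besselL4 (bessel (u j))) (besselL4 φ)‖ ≤ 3 * √(A * B) := by
    intro j
    refine abs_le_of_sq_le_sq' ?_ (by positivity) |>.2
    rw [mul_pow, Real.sq_sqrt (by positivity)]
    have e1 : ‖besselL4 (bessel (u j))‖ ^ 2 ≤ 3 * A :=
      (norm_besselL4_field_sq_le u j).trans_eq (by ring)
    have e2 : ‖besselL4 φ‖ ^ 2 ≤ 3 * B := (norm_besselL4_sq_le φ).trans_eq (by ring)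
    calc _ ≤ (‖besselL4 (bessel (u j))‖ * ‖besselL4 φ‖) ^ 2 := by
          gcongr; exact norm_mulFour_le _ _
      _ ≤ (3 * A) * (3 * B) := by rw [mul_pow]; gcongr
      _ = 3 ^ 2 * (A * B) := by ring
  have h2 : ‖bessel (advScalar u φ)‖ ≤ 6 * √(A * B) := by
    refine norm_le_of_inner_le (by positivity) fun ψ => ?_
    rw [inner_bessel_left, inner_advScalar_skew hu]
    have e : inner ℝ (advScalar u ψ) (bessel φ)
        = ∑ j, inner ℝ (mulFour (besselL4 (bessel (u j))) (besselL4 φ)) (riesz j ψ) := by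
      rw [advScalar, sum_inner]
      refine Finset.sum_congr rfl fun j _ => ?_
      rw [L2.inner_def, L2.inner_def]
      refine integral_congr_ae ?_
      filter_upwards [coeFn_mulFour (besselL4 (bessel (u j))) (besselL4 φ),
        coeFn_besselL4 (bessel (u j)), coeFn_besselL4 φ,
        coeFn_mulTop (besselLinf (u j)) (riesz j ψ), coeFn_besselLinf (u j)] with x h1 h2 h3 h4 h5
      rw [h1, h2, h3, h4, h5]
      simp
      ring
    rw [e, ← Finset.sum_neg_distrib, Fin.sum_univ_two]
    have e2 : ∀ j, -inner ℝ (mulFour (besselL4 (bessel (u j))) (besselL4 φ)) (riesz j ψ)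
        ≤ 3 * √(A * B) * ‖ψ‖ := fun j =>
      (neg_le_abs _).trans ((abs_real_inner_le_norm _ _).trans
        (mul_le_mul (h1 j) (norm_riesz_le j ψ) (norm_nonneg _) (by positivity)))
    linarith [e2 0, e2 1]
  calc ‖bessel (advScalar u φ)‖ ^ 2 ≤ (6 * √(A * B)) ^ 2 := by gcongr
    _ = 36 * (A * B) := by rw [mul_pow, Real.sq_sqrt (by positivity)]; norm_num

lemma casL_eq_smul_bessel (k : Fin 2 → ℤ) : casL k = √(lam k) • bessel (casL k) := by
  refine ext_coef fun l => ?_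
  rw [map_smul, coef_bessel, coef_casL, smul_eq_mul]
  split_ifs with h
  · rw [h, mul_one, mul_inv_cancel₀ (sqrt_lam_pos k).ne']
  · simp

lemma riesz_casL (j : Fin 2) (k : Fin 2 → ℤ) :
    riesz j (casL k) = (2 * Real.pi * k j * (√(lam k))⁻¹) • casL (-k) := by
  refine ext_coef fun l => ?_
  rw [map_smul, coef_riesz, coef_casL, coef_casL, smul_eq_mul]
  by_cases h : l = -k
  · subst h
    simp [lam_neg]
  · have h' : -l ≠ k := fun h' => h (by rw [← h', neg_neg])
    simp [h, h']

lemma mulTop_besselLinf_comm (f g : L2) :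
    mulTop (besselLinf f) (bessel (bessel g)) = mulTop (besselLinf g) (bessel (bessel f)) := by
  refine Lp.ext ?_
  filter_upwards [coeFn_mulTop (besselLinf f) (bessel (bessel g)), coeFn_besselLinf f,
    coeFn_mulTop (besselLinf g) (bessel (bessel f)), coeFn_besselLinf g] with x h1 h2 h3 h4
  rw [h1, h2, h3, h4, mul_comm]

lemma inner_mulTop_left (a : Lp ℝ ∞ vol) (f g : L2) :
    inner ℝ (mulTop a f) g = inner ℝ (mulTop a g) f := by
  rw [L2.inner_def, L2.inner_def]
  refine integral_congr_ae ?_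
  filter_upwards [coeFn_mulTop a f, coeFn_mulTop a g] with x h1 h2
  simp only [h1, h2, RCLike.inner_apply, conj_trivial]
  ring

/-- The divergence form of the transport term. -/
lemma coef_advScalar_bessel {u : L2Vec} (hu : u ∈ HSpace) (f : L2) (k : Fin 2 → ℤ) :
    coef k (advScalar u (bessel f))
      = -∑ j, 2 * Real.pi * k j * coef (-k) (mulTop (besselLinf (u j)) (bessel (bessel f))) := by
  -- `cas k` is an eigenfunction of (1 - Δ)^{-1/2}, hence lies in its range, which is the form that
  -- skew symmetry asks for.
  rw [coef_eq_inner, real_inner_comm, casL_eq_smul_bessel, inner_smul_right, inner_advScalar_skew hu,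
    advScalar, sum_inner, mul_neg, Finset.mul_sum]
  congr 1
  refine Finset.sum_congr rfl fun j _ => ?_
  rw [riesz_casL, map_smul, inner_smul_left, inner_mulTop_left, coef_eq_inner, real_inner_comm]
  have := (sqrt_lam_pos k).ne'
  simp
  field_simp

/-- In divergence form the i-th component is ∑_j ∂_j (b_j u_i - u_j b_i), with an antisymmetric
tensor: it has zero mean, and its divergence cancels in pairs. This is why the magnetic equation
carries no pressure. -/
lemma adv_sub_adv_mem {u b : L2Vec} (hu : u ∈ HSpace) (hb : b ∈ HSpace) :
    adv b u - adv u b ∈ HSpace := by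
  rw [mem_HSpace_iff, mem_solenoidal]
  have h : ∀ k i, coef k ((adv b u - adv u b) i)
      = -∑ j, 2 * Real.pi * k j * (coef (-k) (mulTop (besselLinf (b j)) (bessel (bessel (u i))))
        - coef (-k) (mulTop (besselLinf (u j)) (bessel (bessel (b i))))) := by
    intro k i
    rw [PiLp.sub_apply, map_sub, adv_apply_eq_advScalar, adv_apply_eq_advScalar,
      coef_advScalar_bessel hb, coef_advScalar_bessel hu]
    simp only [mul_sub, Finset.sum_sub_distrib]
    ring
  refine ⟨fun i => by rw [h]; simp, fun k => ?_⟩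
  simp only [h, Fin.sum_univ_two]
  rw [mulTop_besselLinf_comm (b 0) (u 0), mulTop_besselLinf_comm (b 1) (u 1),
    mulTop_besselLinf_comm (b 1) (u 0), mulTop_besselLinf_comm (b 0) (u 1)]
  ring

/-! ### The calmed Ohmic heating -/

section Calmed

variable {ε : ℝ} {ζ : ℝ → ℝ}

lemma IsCalming.exists_bound (hζ : IsCalming ε ζ) : ∃ M : ℝ, 0 ≤ M ∧ ∀ x, |ζ x| ≤ M := by
  obtain ⟨M, hM, h⟩ := hζ.bounded
  exact ⟨M, hM.le, fun x => (le_add_of_nonneg_right (abs_nonneg _)).trans (h x)⟩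

lemma IsCalming.continuous (hζ : IsCalming ε ζ) : Continuous ζ := hζ.lipschitz.choose_spec.continuous

lemma IsCalming.memLp (hζ : IsCalming ε ζ) (c : L2) :
    MemLp (fun x => ζ |c x| * |c x|) 2 vol := by
  obtain ⟨M, -, hM⟩ := hζ.exists_bound
  have hc := (Lp.memLp c).abs
  refine MemLp.of_le_mul (c := M) (Lp.memLp c)
    ((hζ.continuous.comp_aestronglyMeasurable hc.1).mul hc.1) (Eventually.of_forall fun x => ?_)
  rw [norm_mul, Real.norm_eq_abs, Real.norm_eq_abs, Real.norm_eq_abs, abs_abs]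
  gcongr
  exact hM _

/-- `ζ(|c|) |c|`. -/
noncomputable def IsCalming.heat (hζ : IsCalming ε ζ) (c : L2) : L2 := (hζ.memLp c).toLp _

lemma IsCalming.coeFn_heat (hζ : IsCalming ε ζ) (c : L2) :
    hζ.heat c =ᵐ[vol] fun x => ζ |c x| * |c x| := (hζ.memLp c).coeFn_toLp

lemma IsCalming.norm_heat_le (hζ : IsCalming ε ζ) :
    ∃ M : ℝ, 0 ≤ M ∧ ∀ c, ‖hζ.heat c‖ ≤ M * ‖c‖ := by
  obtain ⟨M, h0, hM⟩ := hζ.exists_bound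
  refine ⟨M, h0, fun c => Lp.norm_le_mul_norm_of_ae_le_mul ?_⟩
  filter_upwards [hζ.coeFn_heat c] with x hx
  rw [hx, norm_mul, Real.norm_eq_abs, Real.norm_eq_abs, Real.norm_eq_abs, abs_abs]
  gcongr
  exact hM _

/-- The function s ζ(s) need not be globally Lipschitz. The bound on ζ handles the variation of the
factor s, and the Lipschitz constant of ζ leaves a weight, placed on a alone. -/
lemma IsCalming.abs_heat_sub_le (hζ : IsCalming ε ζ) : ∃ M : ℝ, 0 ≤ M ∧ ∀ a b : ℝ,
    |(ζ |a| * |a|) - (ζ |b| * |b|)| ≤ M * (|a - b| + |a| * |a - b|) := by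
  obtain ⟨M, h0, hM⟩ := hζ.exists_bound
  obtain ⟨L, hL⟩ := hζ.lipschitz
  refine ⟨max M L, le_max_of_le_left h0, fun a b => ?_⟩
  have h1 : |(ζ |a|) - (ζ |b|)| ≤ L * |a - b| := by
    have := hL.dist_le_mul |a| |b|
    rw [Real.dist_eq, Real.dist_eq] at this
    exact this.trans (mul_le_mul_of_nonneg_left (abs_abs_sub_abs_le a b) L.2)
  have e : ζ |a| * |a| - ζ |b| * |b| = (ζ |a| - ζ |b|) * |a| + ζ |b| * (|a| - |b|) := by ring
  rw [e]
  refine (abs_add_le _ _).trans ?_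
  rw [abs_mul, abs_mul, abs_abs]
  calc |(ζ |a|) - (ζ |b|)| * |a| + |(ζ |b|)| * |(|a|) - (|b|)|
      ≤ max M L * |a - b| * |a| + max M L * |a - b| :=
        add_le_add
          (mul_le_mul_of_nonneg_right (h1.trans (by gcongr; exact le_max_right _ _)) (abs_nonneg _))
          (mul_le_mul ((hM _).trans (le_max_left _ _)) (abs_abs_sub_abs_le a b) (abs_nonneg _)
            (le_max_of_le_left h0))
    _ = _ := by ring

/-- Duality again: smoothing puts the test function in L⁴, the weight is also measured in L⁴, and
the difference of the arguments needs only L². -/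
lemma IsCalming.norm_bessel_heat_sub_le (hζ : IsCalming ε ζ) : ∃ M : ℝ, 0 ≤ M ∧ ∀ p q : L2,
    ‖bessel (hζ.heat (bessel p) - hζ.heat (bessel q))‖
      ≤ M * (1 + ‖besselL4 p‖) * ‖bessel (p - q)‖ := by
  obtain ⟨M, h0, hM⟩ := hζ.abs_heat_sub_le
  refine ⟨2 * M, by positivity, fun p q => ?_⟩
  refine norm_le_of_inner_le (by positivity) fun ψ => ?_
  set d := bessel (p - q) with hd
  have h1 : inner ℝ (bessel (hζ.heat (bessel p) - hζ.heat (bessel q))) ψ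
      ≤ ∫ x, M * (|d x * bessel ψ x| + |mulFour (besselL4 p) (besselL4 ψ) x * d x|) ∂vol := by
    rw [inner_bessel_left, L2.inner_def]
    refine integral_mono_ae (L2.integrable_inner _ _)
      (((integrable_mul_L2 _ _).abs.add (integrable_mul_L2 _ _).abs).const_mul _) ?_
    have hsub : d =ᵐ[vol] fun x => bessel p x - bessel q x := by
      rw [hd, map_sub]; exact Lp.coeFn_sub _ _
    filter_upwards [Lp.coeFn_sub (hζ.heat (bessel p)) (hζ.heat (bessel q)), hζ.coeFn_heat (bessel p),
      hζ.coeFn_heat (bessel q), hsub, coeFn_mulFour (besselL4 p) (besselL4 ψ), coeFn_besselL4 p,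
      coeFn_besselL4 ψ] with x e1 e2 e3 e4 e5 e6 e7
    simp only [e1, e2, e3, e4, e5, e6, e7, Pi.sub_apply, RCLike.inner_apply, conj_trivial]
    refine (le_abs_self _).trans ?_
    rw [abs_mul]
    refine (mul_le_mul_of_nonneg_left (hM _ _) (abs_nonneg _)).trans_eq ?_
    simp only [abs_mul]
    ring
  refine h1.trans ?_
  rw [integral_const_mul, integral_add (integrable_mul_L2 _ _).abs (integrable_mul_L2 _ _).abs]
  have h2 : ‖mulFour (besselL4 p) (besselL4 ψ)‖ ≤ ‖besselL4 p‖ * (2 * ‖ψ‖) :=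
    (norm_mulFour_le _ _).trans (by gcongr; exact norm_besselL4_le ψ)
  have h3 : ∫ x, |d x * bessel ψ x| ∂vol ≤ ‖d‖ * ‖ψ‖ :=
    (integral_abs_mul_le _ _).trans (by gcongr; exact norm_bessel_le ψ)
  have h4 : ∫ x, |mulFour (besselL4 p) (besselL4 ψ) x * d x| ∂vol
      ≤ ‖besselL4 p‖ * (2 * ‖ψ‖) * ‖d‖ :=
    (integral_abs_mul_le _ _).trans (by gcongr)
  have h5 : 0 ≤ ‖d‖ * ‖ψ‖ := by positivity
  calc _ ≤ M * (‖d‖ * ‖ψ‖ + ‖besselL4 p‖ * (2 * ‖ψ‖) * ‖d‖) := by gcongr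
    _ ≤ M * (2 * (‖d‖ * ‖ψ‖) + ‖besselL4 p‖ * (2 * ‖ψ‖) * ‖d‖) := by
        refine mul_le_mul_of_nonneg_left ?_ h0; linarith
    _ = _ := by ring

end Calmed

/-! ### The Galerkin scale on the phase space -/

lemma ext_prod {α β : Type*} {x y : WithLp 2 (α × β)} (h₁ : x.fst = y.fst) (h₂ : x.snd = y.snd) :
    x = y :=
  WithLp.ofLp_injective 2 (Prod.ext h₁ h₂)

section Prod

variable {E₁ E₂ : Type*} [NormedAddCommGroup E₁] [InnerProductSpace ℝ E₁] [NormedAddCommGroup E₂]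
  [InnerProductSpace ℝ E₂]

/-- `x ↦ (x, 0)`. -/
noncomputable def inlL : E₁ →L[ℝ] WithLp 2 (E₁ × E₂) :=
  (WithLp.prodContinuousLinearEquiv 2 ℝ E₁ E₂).symm.toContinuousLinearMap.comp
    (ContinuousLinearMap.inl ℝ E₁ E₂)

/-- `y ↦ (0, y)`. -/
noncomputable def inrL : E₂ →L[ℝ] WithLp 2 (E₁ × E₂) :=
  (WithLp.prodContinuousLinearEquiv 2 ℝ E₁ E₂).symm.toContinuousLinearMap.comp
    (ContinuousLinearMap.inr ℝ E₁ E₂)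

/-- `(x, y) ↦ (T₁ x, T₂ y)`. -/
noncomputable def diagL (T₁ : E₁ →L[ℝ] E₁) (T₂ : E₂ →L[ℝ] E₂) :
    WithLp 2 (E₁ × E₂) →L[ℝ] WithLp 2 (E₁ × E₂) :=
  inlL.comp (T₁.comp (WithLp.fstL 2 ℝ E₁ E₂)) + inrL.comp (T₂.comp (WithLp.sndL 2 ℝ E₁ E₂))

@[simp] lemma fst_inlL (x : E₁) : (inlL x : WithLp 2 (E₁ × E₂)).fst = x := rfl
@[simp] lemma snd_inlL (x : E₁) : (inlL x : WithLp 2 (E₁ × E₂)).snd = 0 := rfl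
@[simp] lemma fst_inrL (x : E₂) : (inrL x : WithLp 2 (E₁ × E₂)).fst = 0 := rfl
@[simp] lemma snd_inrL (x : E₂) : (inrL x : WithLp 2 (E₁ × E₂)).snd = x := rfl

@[simp] lemma fst_diagL (T₁ : E₁ →L[ℝ] E₁) (T₂ : E₂ →L[ℝ] E₂) (x : WithLp 2 (E₁ × E₂)) :
    (diagL T₁ T₂ x).fst = T₁ x.fst := by
  simp [diagL]

@[simp] lemma snd_diagL (T₁ : E₁ →L[ℝ] E₁) (T₂ : E₂ →L[ℝ] E₂) (x : WithLp 2 (E₁ × E₂)) :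
    (diagL T₁ T₂ x).snd = T₂ x.snd := by
  simp [diagL]

lemma diagL_eq_toLp (T₁ : E₁ →L[ℝ] E₁) (T₂ : E₂ →L[ℝ] E₂) (x : WithLp 2 (E₁ × E₂)) :
    diagL T₁ T₂ x = WithLp.toLp 2 (T₁ x.fst, T₂ x.snd) :=
  ext_prod (fst_diagL _ _ _) (snd_diagL _ _ _)

lemma norm_diagL_le {T₁ : E₁ →L[ℝ] E₁} {T₂ : E₂ →L[ℝ] E₂} (h₁ : ∀ x, ‖T₁ x‖ ≤ ‖x‖)
    (h₂ : ∀ x, ‖T₂ x‖ ≤ ‖x‖) (x : WithLp 2 (E₁ × E₂)) : ‖diagL T₁ T₂ x‖ ≤ ‖x‖ := by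
  refine abs_le_of_sq_le_sq' ?_ (norm_nonneg _) |>.2
  rw [WithLp.prod_norm_sq_eq_of_L2, WithLp.prod_norm_sq_eq_of_L2, fst_diagL, snd_diagL]
  have := h₁ x.fst
  have := h₂ x.snd
  gcongr

lemma isCompactOperator_diagL {T₁ : E₁ →L[ℝ] E₁} {T₂ : E₂ →L[ℝ] E₂} (h₁ : IsCompactOperator T₁)
    (h₂ : IsCompactOperator T₂) : IsCompactOperator (diagL T₁ T₂) := by
  have a : IsCompactOperator ((inlL (E₂ := E₂)).comp (T₁.comp (WithLp.fstL 2 ℝ E₁ E₂))) :=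
    IsCompactOperator.clm_comp (f := T₁.comp (WithLp.fstL 2 ℝ E₁ E₂)) (h₁.comp_clm _) inlL
  have b : IsCompactOperator ((inrL (E₁ := E₁)).comp (T₂.comp (WithLp.sndL 2 ℝ E₁ E₂))) :=
    IsCompactOperator.clm_comp (f := T₂.comp (WithLp.sndL 2 ℝ E₁ E₂)) (h₂.comp_clm _) inrL
  exact a.add b

lemma inner_prod (x y : WithLp 2 (E₁ × E₂)) :
    inner ℝ x y = inner ℝ x.fst y.fst + inner ℝ x.snd y.snd := WithLp.prod_inner_apply x y

/-- The product of two Galerkin scales. -/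
noncomputable def GalerkinScale.prod (S₁ : GalerkinScale E₁) (S₂ : GalerkinScale E₂) :
    GalerkinScale (WithLp 2 (E₁ × E₂)) where
  K := diagL S₁.K S₂.K
  P n := diagL (S₁.P n) (S₂.P n)
  L n := diagL (S₁.L n) (S₂.L n)
  compact_K := isCompactOperator_diagL S₁.compact_K S₂.compact_K
  norm_K_le := norm_diagL_le S₁.norm_K_le S₂.norm_K_le
  norm_P_le n := norm_diagL_le (S₁.norm_P_le n) (S₂.norm_P_le n)
  inner_K x y := by simp [S₁.inner_K, S₂.inner_K]
  inner_L n x y := by simp [S₁.inner_L, S₂.inner_L]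
  tendsto_P x := by
    simp only [diagL_eq_toLp]
    exact ((WithLp.prod_continuous_toLp 2 E₁ E₂).tendsto (x.fst, x.snd)).comp
      ((S₁.tendsto_P x.fst).prodMk_nhds (S₂.tendsto_P x.snd))
  K_L n x := ext_prod (by simp [S₁.K_L]) (by simp [S₂.K_L])
  P_P h x := ext_prod (by simp [S₁.P_P h]) (by simp [S₂.P_P h])
  L_P h x := ext_prod (by simp [S₁.L_P h]) (by simp [S₂.L_P h])
  P_L h x := ext_prod (by simp [S₁.P_L h]) (by simp [S₂.P_L h])

end Prod

lemma isCompactOperator_proj (n : ℕ) : IsCompactOperator (proj n) := by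
  have h : (proj n : L2 → L2) = fun f => ∑ k ∈ box n, coef k f • casL k :=
    funext fun f => proj_eq_sum n f
  rw [h]
  generalize box n = s
  classical
  induction s using Finset.induction_on with
  | empty =>
    simp only [Finset.sum_empty]
    exact isCompactOperator_zero
  | insert a s ha ih =>
    simp only [Finset.sum_insert ha]
    refine IsCompactOperator.add ?_ ih
    have h1 : IsCompactOperator (coef a) := isCompactOperator_of_locallyCompactSpace_dom _
    exact h1.clm_comp (ContinuousLinearMap.toSpanSingleton ℝ (casL a))

/-- A frequency outside the box has some |k_j| ≥ n + 1, so √λ_k ≥ 2π (n + 1). -/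
lemma norm_bessel_sub_proj_le (n : ℕ) (f : L2) :
    ‖bessel f - proj n (bessel f)‖ ≤ ((n : ℝ) + 1)⁻¹ * ‖f‖ := by
  have h0 : (0 : ℝ) < (n : ℝ) + 1 := by positivity
  have h : ‖bessel f - proj n (bessel f)‖ ≤ ‖((n : ℝ) + 1)⁻¹ • f‖ := by
    refine norm_sq_le_of_coef 1 fun k => ?_
    simp only [map_sub, coef_bessel, coef_proj, map_smul, smul_eq_mul, Equiv.Perm.coe_one, id_eq]
    rw [abs_mul (_⁻¹), abs_of_pos (inv_pos.2 h0)]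
    split_ifs with hk
    · simp only [one_mul, sub_self, abs_zero]
      positivity
    · rw [zero_mul, sub_zero, abs_mul, abs_of_pos (inv_pos.2 (sqrt_lam_pos k))]
      gcongr
      rw [mem_box] at hk
      push Not at hk
      obtain ⟨j, hj⟩ := hk
      refine le_trans ?_ (abs_le_sqrt_lam k j)
      rw [abs_mul, abs_of_pos (by positivity)]
      have hj' : (n : ℝ) + 1 ≤ |(k j : ℝ)| := by exact_mod_cast hj
      nlinarith [Real.pi_gt_three]
  rwa [norm_smul, norm_inv, Real.norm_of_nonneg h0.le] at h

/-- A limit in operator norm of compact truncations. This is Rellich's theorem for H¹ in L². -/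
lemma isCompactOperator_bessel : IsCompactOperator bessel := by
  refine isCompactOperator_of_tendsto (F := fun n : ℕ => (proj n).comp bessel) (l := atTop) ?_
    (Eventually.of_forall fun n => (isCompactOperator_proj n).comp_clm bessel)
  rw [tendsto_iff_norm_sub_tendsto_zero]
  refine squeeze_zero (fun _ => norm_nonneg _) (fun n => ?_) tendsto_one_div_add_atTop_nhds_zero_nat
  refine ContinuousLinearMap.opNorm_le_bound _ (by positivity) fun f => ?_
  rw [sub_apply, norm_sub_rev, one_div]
  exact norm_bessel_sub_proj_le n f

/-- The scale of `L²(𝕋²)`. -/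
noncomputable def scalarScale : GalerkinScale L2 where
  K := bessel
  P := proj
  L := rough
  compact_K := isCompactOperator_bessel
  norm_K_le := norm_bessel_le
  norm_P_le := norm_proj_le
  inner_K := inner_bessel_left
  inner_L := inner_rough_left
  tendsto_P := tendsto_proj
  K_L := bessel_rough
  P_P h := proj_proj h
  L_P h := rough_proj h
  P_L h := proj_rough h

/-- A Fourier multiplier on `H`. -/
noncomputable def solMap (T : L2 →L[ℝ] L2) (hT : IsMultiplier T) : HSpace →L[ℝ] HSpace :=
  ((vecMap T).comp HSpace.subtypeL).codRestrict HSpace fun w => hT.vecMap_mem w.2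

@[simp] lemma coe_solMap (T : L2 →L[ℝ] L2) (hT : IsMultiplier T) (w : HSpace) :
    (solMap T hT w : L2Vec) = vecMap T w := rfl

lemma ext_solenoidal {v w : HSpace} (h : ∀ i, (v : L2Vec) i = (w : L2Vec) i) : v = w :=
  Subtype.ext (PiLp.ext h)

lemma norm_solMap_le {T : L2 →L[ℝ] L2} (hT : IsMultiplier T) (h : ∀ f, ‖T f‖ ≤ ‖f‖) (w : HSpace) :
    ‖solMap T hT w‖ ≤ ‖w‖ := by
  refine abs_le_of_sq_le_sq' ?_ (norm_nonneg _) |>.2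
  rw [Submodule.coe_norm, Submodule.coe_norm, norm_L2Vec_sq, norm_L2Vec_sq, coe_solMap,
    vecMap_apply, vecMap_apply]
  have := h ((w : L2Vec) 0)
  have := h ((w : L2Vec) 1)
  gcongr

lemma inner_solMap {T : L2 →L[ℝ] L2} (hT : IsMultiplier T)
    (h : ∀ f g, inner ℝ (T f) g = inner ℝ f (T g)) (v w : HSpace) :
    inner ℝ (solMap T hT v) w = inner ℝ v (solMap T hT w) := by
  simp only [Submodule.coe_inner, PiLp.inner_apply, coe_solMap, vecMap_apply, h]

lemma isCompactOperator_vecMap {T : L2 →L[ℝ] L2} (hT : IsCompactOperator T) :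
    IsCompactOperator (vecMap T) := by
  let ι : Fin 2 → L2 →L[ℝ] L2Vec := fun i =>
    (PiLp.continuousLinearEquiv 2 ℝ fun _ : Fin 2 => L2).symm.toContinuousLinearMap.comp
      (ContinuousLinearMap.single ℝ (fun _ : Fin 2 => L2) i : L2 →L[ℝ] (Fin 2 → L2))
  have h : (vecMap T : L2Vec → L2Vec) = fun w => ι 0 (T (w 0)) + ι 1 (T (w 1)) := by
    funext w
    ext1 i
    fin_cases i <;> simp [ι]
  rw [h]
  have hc : ∀ i, IsCompactOperator (ι i ∘ T ∘ fun w : L2Vec => w i) := fun i =>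
    (hT.comp_clm (PiLp.proj (𝕜 := ℝ) 2 (fun _ : Fin 2 => L2) i)).clm_comp (ι i)
  exact (hc 0).add (hc 1)

/-- The scale of `H`. -/
noncomputable def solenoidalScale : GalerkinScale HSpace where
  K := solMap bessel isMultiplier_bessel
  P n := solMap (proj n) (isMultiplier_proj n)
  L n := solMap (rough n) (isMultiplier_rough n)
  compact_K := ((isCompactOperator_vecMap isCompactOperator_bessel).comp_clm
    HSpace.subtypeL).codRestrict _ (Submodule.isClosed_topologicalClosure _)
  norm_K_le := norm_solMap_le _ norm_bessel_le
  norm_P_le n := norm_solMap_le _ (norm_proj_le n)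
  inner_K := inner_solMap _ inner_bessel_left
  inner_L n := inner_solMap _ (inner_rough_left n)
  tendsto_P w := tendsto_subtype_rng.2 (tendsto_vecMap_proj w)
  K_L n _ := ext_solenoidal fun _ => bessel_rough n _
  P_P h _ := ext_solenoidal fun _ => proj_proj h _
  L_P h _ := ext_solenoidal fun _ => rough_proj h _
  P_L h _ := ext_solenoidal fun _ => proj_rough h _

/-- The phase space of the velocity, the magnetic field and the temperature. -/
def State : Type := WithLp 2 (HSpace × WithLp 2 (HSpace × L2))

namespace State

noncomputable instance : NormedAddCommGroup State :=
  inferInstanceAs (NormedAddCommGroup (WithLp 2 (HSpace × WithLp 2 (HSpace × L2))))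

noncomputable instance : InnerProductSpace ℝ State :=
  inferInstanceAs (InnerProductSpace ℝ (WithLp 2 (HSpace × WithLp 2 (HSpace × L2))))

instance : CompleteSpace State :=
  inferInstanceAs (CompleteSpace (WithLp 2 (HSpace × WithLp 2 (HSpace × L2))))

/-- The velocity component. -/
noncomputable def vel : State →L[ℝ] HSpace := WithLp.fstL 2 ℝ HSpace (WithLp 2 (HSpace × L2))

/-- The magnetic component. -/
noncomputable def mag : State →L[ℝ] HSpace :=
  (WithLp.fstL 2 ℝ HSpace L2).comp (WithLp.sndL 2 ℝ HSpace (WithLp 2 (HSpace × L2)))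

/-- The temperature component. -/
noncomputable def temp : State →L[ℝ] L2 :=
  (WithLp.sndL 2 ℝ HSpace L2).comp (WithLp.sndL 2 ℝ HSpace (WithLp 2 (HSpace × L2)))

/-- The inclusion of the velocities. -/
noncomputable def inVel : HSpace →L[ℝ] State :=
  inlL (E₁ := HSpace) (E₂ := WithLp 2 (HSpace × L2))

/-- The inclusion of the magnetic fields. -/
noncomputable def inMag : HSpace →L[ℝ] State :=
  (inrL (E₁ := HSpace) (E₂ := WithLp 2 (HSpace × L2))).comp inlL

/-- The inclusion of the temperatures. -/
noncomputable def inTemp : L2 →L[ℝ] State :=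
  (inrL (E₁ := HSpace) (E₂ := WithLp 2 (HSpace × L2))).comp inrL

@[simp] lemma vel_inVel (u : HSpace) : vel (inVel u) = u := rfl
@[simp] lemma vel_inMag (b : HSpace) : vel (inMag b) = 0 := rfl
@[simp] lemma vel_inTemp (θ : L2) : vel (inTemp θ) = 0 := rfl
@[simp] lemma mag_inVel (u : HSpace) : mag (inVel u) = 0 := rfl
@[simp] lemma mag_inMag (b : HSpace) : mag (inMag b) = b := rfl
@[simp] lemma mag_inTemp (θ : L2) : mag (inTemp θ) = 0 := rfl
@[simp] lemma temp_inVel (u : HSpace) : temp (inVel u) = 0 := rfl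
@[simp] lemma temp_inMag (b : HSpace) : temp (inMag b) = 0 := rfl
@[simp] lemma temp_inTemp (θ : L2) : temp (inTemp θ) = θ := rfl

/-- The state with the given components. -/
noncomputable def mk (u b : HSpace) (θ : L2) : State := inVel u + inMag b + inTemp θ

@[simp] lemma vel_mk (u b : HSpace) (θ : L2) : vel (mk u b θ) = u := by simp [mk]
@[simp] lemma mag_mk (u b : HSpace) (θ : L2) : mag (mk u b θ) = b := by simp [mk]
@[simp] lemma temp_mk (u b : HSpace) (θ : L2) : temp (mk u b θ) = θ := by simp [mk]

lemma ext_state {x y : State} (h₁ : vel x = vel y) (h₂ : mag x = mag y) (h₃ : temp x = temp y) :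
    x = y :=
  ext_prod h₁ (ext_prod h₂ h₃)

lemma norm_sq_eq (x : State) : ‖x‖ ^ 2 = ‖vel x‖ ^ 2 + ‖mag x‖ ^ 2 + ‖temp x‖ ^ 2 := by
  refine (WithLp.prod_norm_sq_eq_of_L2 (α := HSpace) (β := WithLp 2 (HSpace × L2)) x).trans ?_
  rw [WithLp.prod_norm_sq_eq_of_L2, ← add_assoc]
  rfl

lemma inner_eq (x y : State) : inner ℝ x y
    = inner ℝ (vel x) (vel y) + inner ℝ (mag x) (mag y) + inner ℝ (temp x) (temp y) := by
  refine (inner_prod (E₁ := HSpace) (E₂ := WithLp 2 (HSpace × L2)) x y).trans ?_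
  rw [inner_prod, ← add_assoc]
  rfl

lemma norm_vel_le (x : State) : ‖vel x‖ ≤ ‖x‖ :=
  abs_le_of_sq_le_sq' (by rw [norm_sq_eq x]; nlinarith [sq_nonneg ‖mag x‖, sq_nonneg ‖temp x‖])
    (norm_nonneg _) |>.2

lemma norm_mag_le (x : State) : ‖mag x‖ ≤ ‖x‖ :=
  abs_le_of_sq_le_sq' (by rw [norm_sq_eq x]; nlinarith [sq_nonneg ‖vel x‖, sq_nonneg ‖temp x‖])
    (norm_nonneg _) |>.2

lemma norm_temp_le (x : State) : ‖temp x‖ ≤ ‖x‖ :=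
  abs_le_of_sq_le_sq' (by rw [norm_sq_eq x]; nlinarith [sq_nonneg ‖vel x‖, sq_nonneg ‖mag x‖])
    (norm_nonneg _) |>.2

/-- The Galerkin scale of the phase space. -/
noncomputable def scale : GalerkinScale State := solenoidalScale.prod (solenoidalScale.prod scalarScale)

@[simp] lemma vel_K (x : State) : vel (scale.K x) = solMap bessel isMultiplier_bessel (vel x) :=
  fst_diagL _ _ _

@[simp] lemma mag_K (x : State) : mag (scale.K x) = solMap bessel isMultiplier_bessel (mag x) :=
  (congrArg WithLp.fst (snd_diagL _ _ _)).trans (fst_diagL _ _ _)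

@[simp] lemma temp_K (x : State) : temp (scale.K x) = bessel (temp x) :=
  (congrArg WithLp.snd (snd_diagL _ _ _)).trans (snd_diagL _ _ _)

@[simp] lemma vel_P (n : ℕ) (x : State) :
    vel (scale.P n x) = solMap (proj n) (isMultiplier_proj n) (vel x) :=
  fst_diagL _ _ _

@[simp] lemma mag_P (n : ℕ) (x : State) :
    mag (scale.P n x) = solMap (proj n) (isMultiplier_proj n) (mag x) :=
  (congrArg WithLp.fst (snd_diagL _ _ _)).trans (fst_diagL _ _ _)

@[simp] lemma temp_P (n : ℕ) (x : State) : temp (scale.P n x) = proj n (temp x) :=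
  (congrArg WithLp.snd (snd_diagL _ _ _)).trans (snd_diagL _ _ _)

@[simp] lemma vel_L (n : ℕ) (x : State) :
    vel (scale.L n x) = solMap (rough n) (isMultiplier_rough n) (vel x) :=
  fst_diagL _ _ _

@[simp] lemma mag_L (n : ℕ) (x : State) :
    mag (scale.L n x) = solMap (rough n) (isMultiplier_rough n) (mag x) :=
  (congrArg WithLp.fst (snd_diagL _ _ _)).trans (fst_diagL _ _ _)

@[simp] lemma temp_L (n : ℕ) (x : State) : temp (scale.L n x) = rough n (temp x) :=
  (congrArg WithLp.snd (snd_diagL _ _ _)).trans (snd_diagL _ _ _)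

end State

/-! ### Continuity of the nonlinearity -/

section Tame

variable {E X Y : Type*} [NormedAddCommGroup E] [InnerProductSpace ℝ E] [NormedAddCommGroup X]
  [NormedAddCommGroup Y] {S : GalerkinScale E}

/-- A modulus of continuity that gives both local Lipschitz continuity and subcriticality. -/
def GalerkinScale.IsTame (S : GalerkinScale E) (G : E → X) : Prop :=
  ∀ R : ℝ, 0 ≤ R → ∃ C : ℝ, 0 ≤ C ∧ ∀ ξ η, ‖S.K ξ‖ ≤ R → ‖S.K η‖ ≤ R →
    ‖G ξ - G η‖ ^ 2 ≤ C * ‖S.K (ξ - η)‖ * (‖S.K (ξ - η)‖ * (1 + ‖ξ‖) + ‖ξ - η‖)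

lemma GalerkinScale.norm_K_sub_le {R : ℝ} {ξ η : E} (h₁ : ‖S.K ξ‖ ≤ R) (h₂ : ‖S.K η‖ ≤ R) :
    ‖S.K (ξ - η)‖ ≤ 2 * R := by
  rw [map_sub]
  linarith [norm_sub_le (S.K ξ) (S.K η)]

namespace GalerkinScale.IsTame

/-- Bounding K by the full norm leaves a multiple of ‖ξ - η‖². This is what the Galerkin
differential equations need. -/
lemma isLipschitzOnBalls {G : E → X} (h : S.IsTame G) : IsLipschitzOnBalls G := by
  intro R
  obtain ⟨C, hC, hG⟩ := h |R| (abs_nonneg R)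
  refine ⟨√(C * (2 + |R|)), by positivity, fun ξ η hξ hη => ?_⟩
  have hR := le_abs_self R
  refine abs_le_of_sq_le_sq' ?_ (by positivity) |>.2
  refine (hG ξ η ((S.norm_K_le ξ).trans (hξ.trans hR)) ((S.norm_K_le η).trans (hη.trans hR))).trans ?_
  rw [mul_pow, Real.sq_sqrt (by positivity)]
  have hK := S.norm_K_le (ξ - η)
  calc C * ‖S.K (ξ - η)‖ * (‖S.K (ξ - η)‖ * (1 + ‖ξ‖) + ‖ξ - η‖)
      ≤ C * ‖ξ - η‖ * (‖ξ - η‖ * (1 + |R|) + ‖ξ - η‖) := by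
        gcongr; exact hξ.trans hR
    _ = _ := by ring

/-- Keep one factor ‖K (ξ - η)‖ and bound the rest crudely. This is what the passage to the limit
needs. -/
lemma isSubcritical {G : E → X} (h : S.IsTame G) : S.IsSubcritical G := by
  intro R
  obtain ⟨C, hC, hG⟩ := h |R| (abs_nonneg R)
  refine ⟨C * (2 * |R| + 1), by positivity, fun ξ η hξ hη => ?_⟩
  have hξ' := hξ.trans (le_abs_self R)
  have hη' := hη.trans (le_abs_self R)
  refine (hG ξ η hξ' hη').trans ?_
  have hK := norm_K_sub_le hξ' hη'
  have hd := norm_sub_le ξ η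
  calc C * ‖S.K (ξ - η)‖ * (‖S.K (ξ - η)‖ * (1 + ‖ξ‖) + ‖ξ - η‖)
      ≤ C * ‖S.K (ξ - η)‖ * (2 * |R| * (1 + ‖ξ‖ + ‖η‖) + (1 + ‖ξ‖ + ‖η‖)) := by
        have h1 : 1 + ‖ξ‖ ≤ 1 + ‖ξ‖ + ‖η‖ := le_add_of_nonneg_right (norm_nonneg η)
        have h2 : ‖ξ - η‖ ≤ 1 + ‖ξ‖ + ‖η‖ := by linarith
        gcongr
    _ = _ := by ring

lemma add {G H : E → X} (hG : S.IsTame G) (hH : S.IsTame H) : S.IsTame fun ξ => G ξ + H ξ := by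
  intro R hR
  obtain ⟨C, hC, h1⟩ := hG R hR
  obtain ⟨D, hD, h2⟩ := hH R hR
  refine ⟨2 * (C + D), by positivity, fun ξ η hξ hη => ?_⟩
  rw [add_sub_add_comm]
  refine (norm_add_sq_le_two _ _).trans ?_
  linarith [h1 ξ η hξ hη, h2 ξ η hξ hη]

lemma of_norm_sub_le {G : E → X} {M C : ℝ} (hM : 0 ≤ M) (hC : 0 ≤ C)
    (h : ∀ ξ η, ‖G ξ - G η‖ ^ 2 ≤ M * (1 + C * ‖S.K ξ‖ * ‖ξ‖) * ‖S.K (ξ - η)‖ ^ 2) : S.IsTame G := by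
  intro R hR
  refine ⟨M * (1 + C * R), by positivity, fun ξ η hξ _ => (h ξ η).trans ?_⟩
  have h1 : 1 + C * ‖S.K ξ‖ * ‖ξ‖ ≤ (1 + C * R) * (1 + ‖ξ‖) := by
    have : C * ‖S.K ξ‖ * ‖ξ‖ ≤ C * R * ‖ξ‖ := by gcongr
    nlinarith [norm_nonneg ξ, mul_nonneg hC hR]
  calc M * (1 + C * ‖S.K ξ‖ * ‖ξ‖) * ‖S.K (ξ - η)‖ ^ 2
      ≤ M * ((1 + C * R) * (1 + ‖ξ‖)) * ‖S.K (ξ - η)‖ ^ 2 := by gcongr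
    _ = M * (1 + C * R) * ‖S.K (ξ - η)‖ * (‖S.K (ξ - η)‖ * (1 + ‖ξ‖) + 0) := by ring
    _ ≤ _ := by gcongr; exact norm_nonneg _

/-- Split B(ξ,ξ) - B(η,η) = B(d,ξ) + B(η,d) with d = ξ - η. The strong norm falls on ξ in the first
term and on d in the second, which explains the two summands in `IsTame`. -/
lemma of_bilinear {B : E → E → X} (hl : ∀ ξ ξ' η, B (ξ - ξ') η = B ξ η - B ξ' η)
    (hr : ∀ ξ η η', B ξ (η - η') = B ξ η - B ξ η') {C : ℝ} (hC : 0 ≤ C)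
    (h : ∀ ξ η, ‖B ξ η‖ ^ 2 ≤ C * (‖S.K ξ‖ ^ 2 * (‖S.K η‖ * ‖η‖))) :
    S.IsTame fun ξ => B ξ ξ := by
  intro R hR
  refine ⟨2 * C * (R + R ^ 2), by positivity, fun ξ η hξ hη => ?_⟩
  have e : B ξ ξ - B η η = B (ξ - η) ξ + B η (ξ - η) := by rw [hl, hr]; abel
  rw [e]
  refine (norm_add_sq_le_two _ _).trans ?_
  set d := ξ - η
  have h1 : ‖B d ξ‖ ^ 2 ≤ C * (‖S.K d‖ ^ 2 * (R * ‖ξ‖)) := (h _ _).trans (by gcongr)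
  have h2 : ‖B η d‖ ^ 2 ≤ C * (R ^ 2 * (‖S.K d‖ * ‖d‖)) := (h _ _).trans (by gcongr)
  have h3 : C * (‖S.K d‖ ^ 2 * (R * ‖ξ‖)) ≤ C * (‖S.K d‖ ^ 2 * ((R + R ^ 2) * (1 + ‖ξ‖))) := by
    gcongr
    · nlinarith
    · linarith
  have h4 : C * (R ^ 2 * (‖S.K d‖ * ‖d‖)) ≤ C * ((R + R ^ 2) * (‖S.K d‖ * ‖d‖)) := by
    gcongr; linarith
  calc _ ≤ 2 * (C * (‖S.K d‖ ^ 2 * ((R + R ^ 2) * (1 + ‖ξ‖))))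
        + 2 * (C * ((R + R ^ 2) * (‖S.K d‖ * ‖d‖))) := by linarith
    _ = _ := by ring

variable [NormedSpace ℝ X] [NormedSpace ℝ Y]

lemma clm_comp {G : E → X} (hG : S.IsTame G) (T : X →L[ℝ] Y) : S.IsTame fun ξ => T (G ξ) := by
  intro R hR
  obtain ⟨C, hC, h⟩ := hG R hR
  refine ⟨‖T‖ ^ 2 * C, by positivity, fun ξ η hξ hη => ?_⟩
  rw [← map_sub]
  calc ‖T (G ξ - G η)‖ ^ 2 ≤ (‖T‖ * ‖G ξ - G η‖) ^ 2 := by gcongr; exact T.le_opNorm _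
    _ = ‖T‖ ^ 2 * ‖G ξ - G η‖ ^ 2 := by ring
    _ ≤ ‖T‖ ^ 2 * (C * ‖S.K (ξ - η)‖ * (‖S.K (ξ - η)‖ * (1 + ‖ξ‖) + ‖ξ - η‖)) :=
        mul_le_mul_of_nonneg_left (h ξ η hξ hη) (by positivity)
    _ = _ := by ring

lemma sub {G H : E → X} (hG : S.IsTame G) (hH : S.IsTame H) : S.IsTame fun ξ => G ξ - H ξ := by
  simpa [sub_eq_add_neg] using hG.add (hH.clm_comp (-ContinuousLinearMap.id ℝ X))

lemma const_smul {G : E → X} (c : ℝ) (hG : S.IsTame G) : S.IsTame fun ξ => c • G ξ :=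
  hG.clm_comp (c • ContinuousLinearMap.id ℝ X)

lemma of_linear (T : E →L[ℝ] X) {C : ℝ} (h : ∀ ξ, ‖T ξ‖ ≤ C * ‖S.K ξ‖) : S.IsTame T := by
  refine of_norm_sub_le (M := C ^ 2) (C := 0) (by positivity) le_rfl fun ξ η => ?_
  rw [← map_sub, zero_mul, zero_mul, add_zero, mul_one, ← mul_pow]
  gcongr
  exact h _

end GalerkinScale.IsTame

end Tame

/-! ### Tameness of the terms of the MHD–Boussinesq system -/

namespace State

open GalerkinScale

lemma norm_besselV_le_K_vel (ξ : State) : ‖besselV (vel ξ)‖ ≤ ‖scale.K ξ‖ := by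
  have h := norm_vel_le (scale.K ξ)
  rwa [vel_K] at h

lemma norm_besselV_le_K_mag (ξ : State) : ‖besselV (mag ξ)‖ ≤ ‖scale.K ξ‖ := by
  have h := norm_mag_le (scale.K ξ)
  rwa [mag_K] at h

lemma norm_bessel_le_K_temp (ξ : State) : ‖bessel (temp ξ)‖ ≤ ‖scale.K ξ‖ := by
  rw [← temp_K]; exact norm_temp_le _

lemma isTame_adv {p q : State →L[ℝ] HSpace} (hp : ∀ ξ, ‖besselV (p ξ)‖ ≤ ‖scale.K ξ‖)
    (hq : ∀ ξ, ‖besselV (q ξ)‖ ≤ ‖scale.K ξ‖) (hq' : ∀ ξ, ‖q ξ‖ ≤ ‖ξ‖) :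
    scale.IsTame fun ξ => adv (p ξ) (q ξ) := by
  refine IsTame.of_bilinear (B := fun ξ η => adv (p ξ) (q η))
    (fun ξ ξ' η => by simp [adv_sub_left]) (fun ξ η η' => by simp [adv_sub_right])
    (C := 144) (by norm_num) fun ξ η => ?_
  refine (norm_adv_sq_le _ _).trans ?_
  have h1 := (norm_besselV_le (besselV (p ξ))).trans (hp ξ)
  have h2 := hp ξ
  have h3 := hq η
  have h4 : ‖(q η : L2Vec)‖ ≤ ‖η‖ := hq' η
  rw [sq]
  gcongr

lemma isTame_advScalar :
    scale.IsTame fun ξ => bessel (advScalar (vel ξ) (temp ξ)) := by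
  refine IsTame.of_bilinear (B := fun ξ η => bessel (advScalar (vel ξ) (temp η)))
    (fun ξ ξ' η => by simp [advScalar_sub_left]) (fun ξ η η' => by simp [advScalar_sub_right])
    (C := 36) (by norm_num) fun ξ η => ?_
  refine (norm_bessel_advScalar_sq_le (vel ξ).2 _).trans ?_
  have h1 := (norm_besselV_le (besselV (vel ξ))).trans (norm_besselV_le_K_vel ξ)
  have h2 := norm_besselV_le_K_vel ξ
  have h3 := norm_bessel_le_K_temp η
  have h4 := norm_temp_le η
  rw [sq]
  gcongr

/-- `∇ × b`, up to `(1 - Δ)^{-1/2}`. -/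
noncomputable def vort (ξ : State) : L2 := riesz 0 ((mag ξ : L2Vec) 1) - riesz 1 ((mag ξ : L2Vec) 0)

lemma vort_sub (ξ η : State) : vort (ξ - η) = vort ξ - vort η := by
  simp only [vort, map_sub, Submodule.coe_sub, PiLp.sub_apply]
  abel

lemma norm_bessel_vort_le (ξ : State) : ‖bessel (vort ξ)‖ ≤ 2 * ‖besselV (mag ξ)‖ := by
  have h : ∀ i j, ‖riesz i (bessel ((mag ξ : L2Vec) j))‖ ≤ ‖besselV (mag ξ)‖ := fun i j =>
    (norm_riesz_le i _).trans (PiLp.norm_apply_le (besselV (mag ξ)) j)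
  rw [vort, map_sub, bessel_riesz, bessel_riesz]
  refine (norm_sub_le _ _).trans ?_
  linarith [h 0 1, h 1 0]

lemma norm_vort_le (ξ : State) : ‖vort ξ‖ ≤ 2 * ‖mag ξ‖ := by
  have h : ∀ i j, ‖riesz i ((mag ξ : L2Vec) j)‖ ≤ ‖mag ξ‖ := fun i j =>
    (norm_riesz_le i _).trans (PiLp.norm_apply_le (mag ξ : L2Vec) j)
  rw [vort]
  refine (norm_sub_le _ _).trans ?_
  linarith [h 0 1, h 1 0]

/-- Ladyzhenskaya bounds the square of the L⁴ weight by 12 ‖K ξ‖ ‖ξ‖, so the strong norm enters to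
the first power only, as tameness allows. -/
lemma isTame_heat {ε : ℝ} {ζ : ℝ → ℝ} (hζ : IsCalming ε ζ) :
    scale.IsTame fun ξ => bessel (hζ.heat (bessel (vort ξ))) := by
  obtain ⟨M, hM, h⟩ := hζ.norm_bessel_heat_sub_le
  refine IsTame.of_norm_sub_le (M := 8 * M ^ 2) (C := 12) (by positivity) (by norm_num) fun ξ η => ?_
  have h1 : ‖bessel (hζ.heat (bessel (vort ξ))) - bessel (hζ.heat (bessel (vort η)))‖
      ≤ M * (1 + ‖besselL4 (vort ξ)‖) * (2 * ‖scale.K (ξ - η)‖) := by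
    rw [← map_sub]
    refine (h _ _).trans ?_
    rw [← vort_sub]
    gcongr
    exact (norm_bessel_vort_le _).trans (by gcongr; exact norm_besselV_le_K_mag _)
  have h2 : ‖besselL4 (vort ξ)‖ ^ 2 ≤ 12 * ‖scale.K ξ‖ * ‖ξ‖ := by
    have a : ‖bessel (vort ξ)‖ ≤ 2 * ‖scale.K ξ‖ :=
      (norm_bessel_vort_le _).trans (by gcongr; exact norm_besselV_le_K_mag _)
    have b : ‖vort ξ‖ ≤ 2 * ‖ξ‖ := (norm_vort_le _).trans (by gcongr; exact norm_mag_le _)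
    calc _ ≤ 3 * ‖bessel (vort ξ)‖ * ‖vort ξ‖ := norm_besselL4_sq_le _
      _ ≤ 3 * (2 * ‖scale.K ξ‖) * (2 * ‖ξ‖) := by gcongr
      _ = _ := by ring
  have h3 : (1 + ‖besselL4 (vort ξ)‖) ^ 2 ≤ 2 * (1 + 12 * ‖scale.K ξ‖ * ‖ξ‖) := by
    nlinarith [sq_nonneg (1 - ‖besselL4 (vort ξ)‖)]
  calc _ ≤ (M * (1 + ‖besselL4 (vort ξ)‖) * (2 * ‖scale.K (ξ - η)‖)) ^ 2 := by gcongr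
    _ = 4 * M ^ 2 * (1 + ‖besselL4 (vort ξ)‖) ^ 2 * ‖scale.K (ξ - η)‖ ^ 2 := by ring
    _ ≤ 4 * M ^ 2 * (2 * (1 + 12 * ‖scale.K ξ‖ * ‖ξ‖)) * ‖scale.K (ξ - η)‖ ^ 2 := by gcongr
    _ = _ := by ring

/-- The field `θ e₂`, as a linear map. -/
noncomputable def buoyancyL : L2 →L[ℝ] L2Vec :=
  (PiLp.continuousLinearEquiv 2 ℝ fun _ : Fin 2 => L2).symm.toContinuousLinearMap.comp
    (ContinuousLinearMap.single ℝ (fun _ : Fin 2 => L2) 1 : L2 →L[ℝ] (Fin 2 → L2))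

lemma buoyancyL_apply (θ : L2) : buoyancyL θ = buoyancy θ := by
  ext1 i
  fin_cases i <;> simp [buoyancyL, buoyancy]

lemma norm_buoyancy (θ : L2) : ‖buoyancy θ‖ = ‖θ‖ := by
  rw [← sq_eq_sq₀ (norm_nonneg _) (norm_nonneg _), norm_L2Vec_sq]
  simp [buoyancy]

/-- The orthogonal projection onto `H`. -/
noncomputable abbrev PH : L2Vec →L[ℝ] HSpace := HSpace.orthogonalProjectionOnto

section Forcing

variable (ν μ κ g α : ℝ) {ε : ℝ} {ζ : ℝ → ℝ} (hζ : IsCalming ε ζ)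

/-- The terms of the momentum equation other than `ν (1 - Δ) u`. -/
noncomputable def velForce (ξ : State) : HSpace :=
  PH (adv (mag ξ) (mag ξ) - adv (vel ξ) (vel ξ) + g • buoyancy (bessel (temp ξ)))
    + ν • vel (scale.K (scale.K ξ))

/-- The terms of the magnetic equation other than `μ (1 - Δ) b`. -/
noncomputable def magForce (ξ : State) : HSpace :=
  PH (adv (mag ξ) (vel ξ) - adv (vel ξ) (mag ξ)) + μ • mag (scale.K (scale.K ξ))

/-- The terms of the temperature equation other than `κ (1 - Δ) θ`. -/
noncomputable def tempForce (ξ : State) : L2 :=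
  (α * μ) • bessel (hζ.heat (bessel (vort ξ))) - bessel (advScalar (vel ξ) (temp ξ))
    + κ • temp (scale.K (scale.K ξ))

/-- The right hand side of the system. -/
noncomputable def force (ξ : State) : State :=
  mk (velForce ν g ξ) (magForce μ ξ) (tempForce μ κ α hζ ξ)

lemma isTame_K_K {X : Type*} [NormedAddCommGroup X] [NormedSpace ℝ X] (T : State →L[ℝ] X) :
    scale.IsTame fun ξ => T (scale.K (scale.K ξ)) :=
  (IsTame.of_linear (scale.K.comp scale.K) (C := 1) fun ξ => by
    rw [one_mul]; exact scale.norm_K_le _).clm_comp T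

lemma isTame_force : scale.IsTame (force ν μ κ g α hζ) := by
  have hu := norm_besselV_le_K_vel
  have hb := norm_besselV_le_K_mag
  have huu := isTame_adv hu hu norm_vel_le
  have hbb := isTame_adv hb hb norm_mag_le
  have hub := isTame_adv hu hb norm_mag_le
  have hbu := isTame_adv hb hu norm_vel_le
  have hθ : scale.IsTame fun ξ => buoyancy (bessel (temp ξ)) := by
    have := (IsTame.of_linear (S := scale) (bessel.comp temp) (C := 1) fun ξ => by
      rw [one_mul]; exact norm_bessel_le_K_temp _).clm_comp buoyancyL
    simpa only [buoyancyL_apply, ContinuousLinearMap.comp_apply] using this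
  have h1 : scale.IsTame (velForce ν g) :=
    (((hbb.sub huu).add (hθ.const_smul g)).clm_comp PH).add ((isTame_K_K vel).const_smul ν)
  have h2 : scale.IsTame (magForce μ) :=
    ((hbu.sub hub).clm_comp PH).add ((isTame_K_K mag).const_smul μ)
  have h3 : scale.IsTame (tempForce μ κ α hζ) :=
    (((isTame_heat hζ).const_smul (α * μ)).sub isTame_advScalar).add
      ((isTame_K_K temp).const_smul κ)
  exact ((h1.clm_comp inVel).add (h2.clm_comp inMag)).add (h3.clm_comp inTemp)

/-- The viscosities, acting diagonally. -/
noncomputable def visc : State →L[ℝ] State :=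
  inVel.comp (ν • vel) + inMag.comp (μ • mag) + inTemp.comp (κ • temp)

@[simp] lemma vel_visc (ξ : State) : vel (visc ν μ κ ξ) = ν • vel ξ := by simp [visc]
@[simp] lemma mag_visc (ξ : State) : mag (visc ν μ κ ξ) = μ • mag ξ := by simp [visc]
@[simp] lemma temp_visc (ξ : State) : temp (visc ν μ κ ξ) = κ • temp ξ := by simp [visc]

lemma P_visc (n : ℕ) (x : State) : scale.P n (visc ν μ κ x) = visc ν μ κ (scale.P n x) :=
  ext_state (by simp) (by simp) (by simp)

lemma le_inner_visc (x : State) :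
    min ν (min μ κ) * ‖x‖ ^ 2 ≤ inner ℝ x (visc ν μ κ x) := by
  rw [inner_eq, norm_sq_eq, vel_visc, mag_visc, temp_visc]
  have h : ∀ (c : ℝ) (w : HSpace), inner ℝ w (c • w) = c * ‖w‖ ^ 2 := fun c w => by
    rw [← real_inner_self_eq_norm_sq]
    exact real_inner_smul_right w w c
  rw [h, h, real_inner_smul_right, real_inner_self_eq_norm_sq]
  have h1 : min ν (min μ κ) ≤ ν := min_le_left _ _
  have h2 : min ν (min μ κ) ≤ μ := (min_le_right _ _).trans (min_le_left _ _)
  have h3 : min ν (min μ κ) ≤ κ := (min_le_right _ _).trans (min_le_right _ _)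
  rw [mul_add, mul_add]
  gcongr

end Forcing

end State

/-! ### A priori bounds -/

/-- Gronwall bounds both e and a ∫ Y by E₁. Dividing the second inequality by 1 + Y then gives (log
(1 + Y))' ≤ A (1 + E₁) (1 + Y), whose integral is already controlled; one of the two powers of Y is
paid for by the dissipation. The bound R depends only on a, A, T and E₀. -/
lemma exists_bound_of_energy {a A T E₀ : ℝ} (ha : 0 < a) (hA : 0 ≤ A) (hE : 0 ≤ E₀) :
    ∃ R : ℝ, ∀ τ, 0 ≤ τ → τ ≤ T → ∀ e Y e' Y' : ℝ → ℝ,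
      ContinuousOn e (Icc 0 τ) → ContinuousOn Y (Icc 0 τ) → (∀ t, 0 ≤ e t) → (∀ t, 0 ≤ Y t) →
      (∀ t ∈ Ioo 0 τ, HasDerivAt e (e' t) t) → (∀ t ∈ Ioo 0 τ, HasDerivAt Y (Y' t) t) →
      (∀ t ∈ Ioo 0 τ, e' t ≤ -(a * Y t) + A * e t) →
      (∀ t ∈ Ioo 0 τ, Y' t ≤ A * (1 + e t) * (1 + Y t) ^ 2) →
      e 0 ≤ E₀ → Y 0 ≤ E₀ → e τ + Y τ ≤ R := by
  let E₁ := E₀ * Real.exp (A * T)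
  refine ⟨E₁ + (1 + E₀) * Real.exp (A * (1 + E₁) * (T + E₁ / a)), ?_⟩
  intro τ h0 hT e Y e' Y' hec hYc he hY hed hYd h1 h2 he0 hY0
  have key : ∀ t ∈ Icc 0 τ, e t ≤ E₁ ∧ ∫ s in Ioo 0 t, Y s ≤ E₁ / a := by
    intro t ht
    have hsub : Icc 0 t ⊆ Icc 0 τ := Icc_subset_Icc_right ht.2
    have hsub' : Ioo 0 t ⊆ Ioo 0 τ := Ioo_subset_Ioo_right ht.2
    -- Integrating factor. For s ≤ t the weight exp(-A s) is at least exp(-A t), so a constant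
    -- weight can be kept in front of the integral of Y.
    have h := sub_le_setIntegral (f := fun s => e s * Real.exp (-(A * s)))
      (f' := fun s => (e' s - A * e s) * Real.exp (-(A * s)))
      (h := fun s => -(a * Real.exp (-(A * t))) * Y s) ht.1
      ((hec.mono hsub).mul (by fun_prop)) (fun s hs => by
        have d1 : HasDerivAt (fun s => Real.exp (-(A * s))) (Real.exp (-(A * s)) * -(A * 1)) s :=
          (((hasDerivAt_id s).const_mul A).neg).exp
        refine ((hed s (hsub' hs)).mul d1).congr_deriv ?_
        ring)
      (continuousOn_const.mul (hYc.mono hsub)) (fun s hs => by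
        have d1 := h1 s (hsub' hs)
        have d2 : Real.exp (-(A * t)) ≤ Real.exp (-(A * s)) := by
          gcongr; exact hs.2.le
        have d3 : 0 ≤ a * Y s := mul_nonneg ha.le (hY s)
        have d4 := Real.exp_pos (-(A * s))
        nlinarith [mul_le_mul_of_nonneg_left d2 d3])
    rw [integral_const_mul] at h
    simp only [mul_zero, neg_zero, Real.exp_zero, mul_one] at h
    have hI : 0 ≤ ∫ s in Ioo 0 t, Y s := integral_nonneg hY
    have hexp : Real.exp (-(A * t)) * Real.exp (A * t) = 1 := by
      rw [← Real.exp_add, neg_add_cancel, Real.exp_zero]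
    have hE1 : E₀ * Real.exp (A * t) ≤ E₁ := by
      have := ht.2
      simp only [E₁]
      gcongr
      linarith
    have h3 : e t + a * ∫ s in Ioo 0 t, Y s ≤ E₁ := by
      refine le_trans ?_ hE1
      calc e t + a * ∫ s in Ioo 0 t, Y s
          = (e t * Real.exp (-(A * t)) + a * Real.exp (-(A * t)) * ∫ s in Ioo 0 t, Y s)
            * Real.exp (A * t) := by
              linear_combination -(e t + a * ∫ s in Ioo 0 t, Y s) * hexp
        _ ≤ E₀ * Real.exp (A * t) := by
              gcongr
              linarith
    refine ⟨by nlinarith, ?_⟩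
    rw [le_div_iff₀ ha]
    nlinarith [he t]
  have hE1 : 0 ≤ E₁ := by positivity
  have hY1 : ∀ t, 0 < 1 + Y t := fun t => by linarith [hY t]
  have h := sub_le_setIntegral (f := fun s => Real.log (1 + Y s)) (f' := fun s => Y' s / (1 + Y s))
      (h := fun s => A * (1 + E₁) * (1 + Y s)) h0
      (ContinuousOn.log (continuousOn_const.add hYc) fun t _ => (hY1 t).ne')
      (fun s hs => ((hYd s hs).const_add 1).log (hY1 s).ne')
      (continuousOn_const.mul (continuousOn_const.add hYc)) (fun s hs => by
        rw [div_le_iff₀ (hY1 s)]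
        refine (h2 s hs).trans ?_
        have := (key s (Ioo_subset_Icc_self hs)).1
        have h3 : A * (1 + e s) * (1 + Y s) ^ 2 ≤ A * (1 + E₁) * (1 + Y s) ^ 2 := by gcongr
        linarith [h3])
  have hYi : IntegrableOn Y (Ioo 0 τ) := (hYc.integrableOn_Icc).mono_set Ioo_subset_Icc_self
  rw [integral_const_mul, integral_add (integrable_const _) hYi] at h
  have hτI := (key τ ⟨h0, le_rfl⟩).2
  have hτe := (key τ ⟨h0, le_rfl⟩).1
  have h4 : A * (1 + E₁) * ((∫ _ in Ioo 0 τ, (1 : ℝ)) + ∫ s in Ioo 0 τ, Y s)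
      ≤ A * (1 + E₁) * (T + E₁ / a) := by
    have : ∫ _ in Ioo 0 τ, (1 : ℝ) = τ := by simp [h0]
    rw [this]
    gcongr
  have h5 : 1 + Y τ ≤ (1 + E₀) * Real.exp (A * (1 + E₁) * (T + E₁ / a)) := by
    rw [← Real.exp_log (hY1 τ)]
    have h6 : Real.exp (Real.log (1 + Y 0)) ≤ 1 + E₀ := by rw [Real.exp_log (hY1 0)]; linarith
    refine le_trans (Real.exp_le_exp.2
      (show Real.log (1 + Y τ) ≤ Real.log (1 + Y 0) + A * (1 + E₁) * (T + E₁ / a) by linarith)) ?_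
    rw [Real.exp_add]
    gcongr
  linarith

/-! ### The energy and enstrophy inequalities -/

namespace State

variable {ν μ κ g α ε : ℝ} {ζ : ℝ → ℝ} (hζ : IsCalming ε ζ)

lemma inner_PH {v : L2Vec} (hv : v ∈ HSpace) (w : L2Vec) : inner ℝ v (PH w : L2Vec) = inner ℝ v w :=
  Submodule.inner_orthogonalProjectionOnto_eq_of_mem_left (K := HSpace) ⟨v, hv⟩ w

lemma inner_besselV_left (v w : L2Vec) : inner ℝ (besselV v) w = inner ℝ v (besselV w) := by
  simp only [PiLp.inner_apply, vecMap_apply, inner_bessel_left]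

lemma inner_velForce {w : L2Vec} (hw : w ∈ HSpace) (ξ : State) :
    inner ℝ w ((velForce ν g ξ : L2Vec) - ν • (vel ξ : L2Vec))
      = inner ℝ (adv (mag ξ) (mag ξ)) w - inner ℝ (adv (vel ξ) (vel ξ)) w
        + g * inner ℝ w (buoyancy (bessel (temp ξ)))
        + ν * (inner ℝ w (besselV (besselV (vel ξ))) - inner ℝ w (vel ξ : L2Vec)) := by
  simp only [velForce, Submodule.coe_add, Submodule.coe_smul, vel_K, coe_solMap, inner_sub_right,
    inner_add_right, inner_PH hw, real_inner_smul_right, real_inner_comm w]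
  ring

lemma inner_magForce {w : L2Vec} (hw : w ∈ HSpace) (ξ : State) :
    inner ℝ w ((magForce μ ξ : L2Vec) - μ • (mag ξ : L2Vec))
      = inner ℝ (adv (mag ξ) (vel ξ)) w - inner ℝ (adv (vel ξ) (mag ξ)) w
        + μ * (inner ℝ w (besselV (besselV (mag ξ))) - inner ℝ w (mag ξ : L2Vec)) := by
  simp only [magForce, Submodule.coe_add, Submodule.coe_smul, mag_K, coe_solMap, inner_sub_right,
    inner_add_right, inner_PH hw, real_inner_smul_right, real_inner_comm w]
  ring

lemma inner_tempForce (ξ : State) :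
    inner ℝ (temp ξ) (tempForce μ κ α hζ ξ - κ • temp ξ)
      = α * μ * inner ℝ (bessel (temp ξ)) (hζ.heat (bessel (vort ξ)))
        + κ * (‖bessel (temp ξ)‖ ^ 2 - ‖temp ξ‖ ^ 2) := by
  have h1 : inner ℝ (temp ξ) (bessel (advScalar (vel ξ) (temp ξ))) = 0 := by
    have h := inner_advScalar_skew (vel ξ).2 (temp ξ) (temp ξ)
    rw [← inner_bessel_left, real_inner_comm]
    linarith
  simp only [tempForce, temp_K, inner_sub_right, inner_add_right, real_inner_smul_right,
    ← inner_bessel_left, real_inner_self_eq_norm_sq] at h1 ⊢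
  rw [h1]
  ring

/-- Half the rate of change of the energy. -/
noncomputable def energyRate (ν μ κ g α : ℝ) {ε : ℝ} {ζ : ℝ → ℝ} (hζ : IsCalming ε ζ) (ξ : State) : ℝ :=
  inner ℝ (besselV (besselV (vel ξ))) ((velForce ν g ξ : L2Vec) - ν • (vel ξ : L2Vec))
    + inner ℝ (besselV (besselV (mag ξ))) ((magForce μ ξ : L2Vec) - μ • (mag ξ : L2Vec))
    + inner ℝ (temp ξ) (tempForce μ κ α hζ ξ - κ • temp ξ)

/-- Half the rate of change of the enstrophy. -/
noncomputable def enstrophyRate (ν μ g : ℝ) (ξ : State) : ℝ :=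
  inner ℝ (vel ξ : L2Vec) ((velForce ν g ξ : L2Vec) - ν • (vel ξ : L2Vec))
    + inner ℝ (mag ξ : L2Vec) ((magForce μ ξ : L2Vec) - μ • (mag ξ : L2Vec))

/-- The energy, in terms of `(1 - Δ)^{1/2}` of the state. -/
noncomputable def energy (x : State) : ℝ :=
  ‖besselV (vel x)‖ ^ 2 + ‖besselV (mag x)‖ ^ 2 + ‖temp x‖ ^ 2

/-- The enstrophy, in terms of `(1 - Δ)^{1/2}` of the state. -/
noncomputable def enstrophy (x : State) : ℝ := ‖vel x‖ ^ 2 + ‖mag x‖ ^ 2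

/-- Tested against (u, b, θ), transport by u contributes nothing, and (b·∇)b against u cancels
(b·∇)u against b. Since ζ is bounded, the heating is linear in the curl and Young charges it to half
of the magnetic dissipation; hence μ rather than 2μ next to 2ν in the choice of a. -/
lemma energyRate_le (hν : 0 < ν) (hμ : 0 < μ) (hκ : 0 < κ) (hg : 0 < g) :
    ∃ a A : ℝ, 0 < a ∧ 0 ≤ A ∧ ∀ ξ : State,
      2 * energyRate ν μ κ g α hζ ξ ≤ -(a * enstrophy (scale.K ξ)) + A * energy (scale.K ξ) := by
  obtain ⟨M, hM, hh⟩ := hζ.norm_heat_le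
  refine ⟨min (2 * ν) μ, 2 * (ν + μ + κ + g + 2 * α ^ 2 * μ * M ^ 2), by positivity, by positivity,
    fun ξ => ?_⟩
  have hu := isMultiplier_bessel.vecMap_mem (isMultiplier_bessel.vecMap_mem (vel ξ).2)
  have hb := isMultiplier_bessel.vecMap_mem (isMultiplier_bessel.vecMap_mem (mag ξ).2)
  rw [energyRate, inner_velForce hu, inner_magForce hb, inner_tempForce,
    inner_adv_self (vel ξ).2, inner_adv_self (vel ξ).2,
    inner_adv_skew (mag ξ).2 (vel ξ) (mag ξ)]
  rw [inner_besselV_left (besselV (vel ξ)) (vel ξ), inner_besselV_left (besselV (mag ξ)) (mag ξ)]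
  simp only [real_inner_self_eq_norm_sq]
  have e1 : energy (scale.K ξ) = ‖besselV (besselV (vel ξ))‖ ^ 2 + ‖besselV (besselV (mag ξ))‖ ^ 2
      + ‖bessel (temp ξ)‖ ^ 2 := by simp [energy]
  have e2 : enstrophy (scale.K ξ) = ‖besselV (vel ξ)‖ ^ 2 + ‖besselV (mag ξ)‖ ^ 2 := by
    simp [enstrophy]
  rw [e1, e2]
  have b1 : inner ℝ (besselV (besselV (vel ξ))) (buoyancy (bessel (temp ξ)))
      ≤ ‖besselV (besselV (vel ξ))‖ * ‖bessel (temp ξ)‖ := by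
    rw [← norm_buoyancy]; exact real_inner_le_norm _ _
  have b2 : α * μ * inner ℝ (bessel (temp ξ)) (hζ.heat (bessel (vort ξ)))
      ≤ |α| * μ * (‖bessel (temp ξ)‖ * (M * (2 * ‖besselV (mag ξ)‖))) := by
    refine (le_abs_self _).trans ?_
    rw [abs_mul, abs_mul, abs_of_pos hμ]
    gcongr
    refine (abs_real_inner_le_norm _ _).trans ?_
    gcongr
    exact (hh _).trans (by gcongr; exact norm_bessel_vort_le ξ)
  set p := ‖besselV (besselV (vel ξ))‖
  set q := ‖besselV (besselV (mag ξ))‖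
  set r := ‖bessel (temp ξ)‖
  set P := ‖besselV (vel ξ)‖
  set Q := ‖besselV (mag ξ)‖
  have c1 : g * inner ℝ (besselV (besselV (vel ξ))) (buoyancy (bessel (temp ξ)))
      ≤ g * (p ^ 2 + r ^ 2) := by
    gcongr
    nlinarith [sq_nonneg (p - r), sq_nonneg p, sq_nonneg r]
  have c2 : |α| * μ * (r * (M * (2 * Q))) ≤ μ * (Q ^ 2 / 2) + 2 * α ^ 2 * μ * M ^ 2 * r ^ 2 := by
    rw [← sq_abs α]
    nlinarith [mul_nonneg hμ.le (sq_nonneg (Q - 2 * |α| * M * r))]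
  have c3 : min (2 * ν) μ * (P ^ 2 + Q ^ 2) ≤ 2 * ν * P ^ 2 + μ * Q ^ 2 := by
    rw [mul_add]
    gcongr
    · exact min_le_left _ _
    · exact min_le_right _ _
  have d1 : 0 ≤ 2 * α ^ 2 * μ * M ^ 2 * (p ^ 2 + q ^ 2) := by positivity
  have d2 : 0 ≤ g * q ^ 2 := by positivity
  have d3 : 0 ≤ ν * (q ^ 2 + r ^ 2) := by positivity
  have d4 : 0 ≤ μ * (p ^ 2 + r ^ 2) := by positivity
  have d5 : 0 ≤ κ * (p ^ 2 + q ^ 2) := by positivity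
  have d6 : 0 ≤ κ * ‖temp ξ‖ ^ 2 := by positivity
  linarith

/-- Young's inequality for the transport term. -/
lemma abs_inner_adv_le {δ : ℝ} (hδ : 0 < δ) {v w z : HSpace} {e Y D : ℝ} (he : 0 ≤ e)
    (hY : 0 ≤ Y) (hD : 0 ≤ D)
    (h1 : ‖besselV (besselV v)‖ ^ 2 ≤ e) (h2 : ‖besselV v‖ ^ 2 ≤ Y) (h3 : ‖besselV w‖ ^ 2 ≤ Y)
    (h4 : ‖w‖ ^ 2 ≤ D) (h5 : ‖z‖ ^ 2 ≤ D) :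
    |inner ℝ (adv v w) (z : L2Vec)| ≤ 2 * δ * D + (36 / δ) ^ 2 / (4 * δ) * (e * Y ^ 2) := by
  have a1 : ‖besselV (besselV v)‖ ≤ √e := Real.le_sqrt_of_sq_le h1
  have a2 : ‖besselV v‖ ≤ √Y := Real.le_sqrt_of_sq_le h2
  have a3 : ‖besselV w‖ ≤ √Y := Real.le_sqrt_of_sq_le h3
  have a4 : ‖(w : L2Vec)‖ ≤ √D := Real.le_sqrt_of_sq_le h4
  -- Young is used twice below, first to split off z, then to split √e Y √D, and each use costs δ D.
  -- The number 36/δ is 144/(4δ).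
  have b : ‖adv v w‖ ^ 2 ≤ 144 * (√e * Y * √D) := by
    refine (norm_adv_sq_le _ _).trans ?_
    calc _ ≤ 144 * (√e * √Y * (√Y * √D)) := by gcongr
      _ = 144 * (√e * (√Y * √Y) * √D) := by ring
      _ = _ := by rw [Real.mul_self_sqrt hY]
  have c1 : |inner ℝ (adv v w) (z : L2Vec)| ≤ ‖adv v w‖ * ‖(z : L2Vec)‖ := abs_real_inner_le_norm _ _
  have h5' : ‖(z : L2Vec)‖ ^ 2 ≤ D := h5
  have c2 : ‖adv v w‖ * ‖(z : L2Vec)‖ ≤ δ * D + 1 / (4 * δ) * ‖adv v w‖ ^ 2 := by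
    have : 0 ≤ (2 * δ * ‖(z : L2Vec)‖ - ‖adv v w‖) ^ 2 / (4 * δ) := by positivity
    have e : (2 * δ * ‖(z : L2Vec)‖ - ‖adv v w‖) ^ 2 / (4 * δ)
        = δ * ‖(z : L2Vec)‖ ^ 2 - ‖adv v w‖ * ‖(z : L2Vec)‖ + 1 / (4 * δ) * ‖adv v w‖ ^ 2 := by
      field_simp
      ring
    nlinarith
  have c3 : 1 / (4 * δ) * ‖adv v w‖ ^ 2 ≤ 36 / δ * (√e * Y) * √D := by
    calc _ ≤ 1 / (4 * δ) * (144 * (√e * Y * √D)) := by gcongr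
      _ = _ := by field_simp; ring
  have c4 : 36 / δ * (√e * Y) * √D ≤ δ * D + (36 / δ) ^ 2 / (4 * δ) * (e * Y ^ 2) := by
    have : 0 ≤ (2 * δ * √D - 36 / δ * (√e * Y)) ^ 2 / (4 * δ) := by positivity
    have e : (2 * δ * √D - 36 / δ * (√e * Y)) ^ 2 / (4 * δ)
        = δ * √D ^ 2 - 36 / δ * (√e * Y) * √D + (36 / δ) ^ 2 / (4 * δ) * (√e ^ 2 * Y ^ 2) := by
      field_simp
      ring
    rw [Real.sq_sqrt hD, Real.sq_sqrt he] at e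
    linarith
  linarith

lemma inner_buoyancy_le {δ : ℝ} (hδ : 0 < δ) (hg : 0 < g) {v : HSpace} {θ : L2} {D e : ℝ}
    (hD : ‖v‖ ^ 2 ≤ D) (he : ‖θ‖ ^ 2 ≤ e) :
    g * inner ℝ (v : L2Vec) (buoyancy θ) ≤ δ * D + g ^ 2 / (4 * δ) * e := by
  have h1 : inner ℝ (v : L2Vec) (buoyancy θ) ≤ ‖v‖ * ‖θ‖ := by
    rw [← norm_buoyancy]; exact real_inner_le_norm _ _
  have h2 : 0 ≤ (2 * δ * ‖v‖ - g * ‖θ‖) ^ 2 / (4 * δ) := by positivity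
  have h3 : (2 * δ * ‖v‖ - g * ‖θ‖) ^ 2 / (4 * δ)
      = δ * ‖v‖ ^ 2 - g * (‖v‖ * ‖θ‖) + g ^ 2 / (4 * δ) * ‖θ‖ ^ 2 := by
    field_simp
    ring
  have h4 : δ * ‖v‖ ^ 2 ≤ δ * D := by gcongr
  have h5 : g ^ 2 / (4 * δ) * ‖θ‖ ^ 2 ≤ g ^ 2 / (4 * δ) * e := by gcongr
  have h6 := mul_le_mul_of_nonneg_left h1 hg.le
  linarith

lemma le_one_add_mul_sq {e Y : ℝ} (he : 0 ≤ e) (hY : 0 ≤ Y) :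
    Y ≤ (1 + e) * (1 + Y) ^ 2 ∧ e * Y ^ 2 ≤ (1 + e) * (1 + Y) ^ 2 ∧ e ≤ (1 + e) * (1 + Y) ^ 2 := by
  refine ⟨?_, by gcongr <;> linarith, ?_⟩
  · nlinarith [mul_nonneg he (sq_nonneg (1 + Y))]
  · nlinarith [mul_nonneg he (sq_nonneg Y), mul_nonneg he hY]

lemma enstrophyRate_le (hν : 0 < ν) (hμ : 0 < μ) (hg : 0 < g) :
    ∃ A : ℝ, 0 ≤ A ∧ ∀ ξ : State, 2 * enstrophyRate ν μ g ξ
      ≤ A * (1 + energy (scale.K ξ)) * (1 + enstrophy (scale.K ξ)) ^ 2 := by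
  -- Nine shares of the dissipation: the four transport terms, estimated separately without any
  -- cancellation, take 2δ D each, and the buoyancy takes δ D.
  let δ := min ν μ / 9
  have hδ : 0 < δ := by positivity
  let B := (36 / δ) ^ 2 / (4 * δ)
  have hB : 0 ≤ B := by positivity
  refine ⟨2 * (ν + μ + 4 * B + g ^ 2 / (4 * δ)), by positivity, fun ξ => ?_⟩
  set e := energy (scale.K ξ) with e1
  set Y := enstrophy (scale.K ξ) with e2
  have e1 : e = ‖besselV (besselV (vel ξ))‖ ^ 2 + ‖besselV (besselV (mag ξ))‖ ^ 2
      + ‖bessel (temp ξ)‖ ^ 2 := by simp [e1, energy]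
  have e2 : Y = ‖besselV (vel ξ)‖ ^ 2 + ‖besselV (mag ξ)‖ ^ 2 := by simp [e2, enstrophy]
  have s1 := sq_nonneg ‖besselV (besselV (vel ξ))‖
  have s2 := sq_nonneg ‖besselV (besselV (mag ξ))‖
  have s3 := sq_nonneg ‖bessel (temp ξ)‖
  have s4 := sq_nonneg ‖besselV (vel ξ)‖
  have s5 := sq_nonneg ‖besselV (mag ξ)‖
  have s6 := sq_nonneg ‖vel ξ‖
  have s7 := sq_nonneg ‖mag ξ‖
  set D := ‖vel ξ‖ ^ 2 + ‖mag ξ‖ ^ 2 with hD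
  have he : 0 ≤ e := by linarith
  have hY : 0 ≤ Y := by linarith
  have hD0 : 0 ≤ D := by linarith
  have a1 := abs_le.1 (abs_inner_adv_le hδ (v := mag ξ) (w := mag ξ) (z := vel ξ) he hY hD0
    (by linarith) (by linarith) (by linarith) (by linarith) (by linarith))
  have a2 := abs_le.1 (abs_inner_adv_le hδ (v := vel ξ) (w := vel ξ) (z := vel ξ) he hY hD0
    (by linarith) (by linarith) (by linarith) (by linarith) (by linarith))
  have a3 := abs_le.1 (abs_inner_adv_le hδ (v := mag ξ) (w := vel ξ) (z := mag ξ) he hY hD0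
    (by linarith) (by linarith) (by linarith) (by linarith) (by linarith))
  have a4 := abs_le.1 (abs_inner_adv_le hδ (v := vel ξ) (w := mag ξ) (z := mag ξ) he hY hD0
    (by linarith) (by linarith) (by linarith) (by linarith) (by linarith))
  rw [enstrophyRate, inner_velForce (vel ξ).2, inner_magForce (mag ξ).2,
    ← inner_besselV_left (vel ξ), ← inner_besselV_left (mag ξ)]
  simp only [real_inner_self_eq_norm_sq]
  have b1 : g * inner ℝ (vel ξ : L2Vec) (buoyancy (bessel (temp ξ)))
      ≤ δ * D + g ^ 2 / (4 * δ) * e :=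
    inner_buoyancy_le hδ hg (le_add_of_nonneg_right s7) (by linarith)
  have b2 : 9 * δ * D ≤ ν * ‖(vel ξ : L2Vec)‖ ^ 2 + μ * ‖(mag ξ : L2Vec)‖ ^ 2 := by
    have : 9 * δ = min ν μ := by simp only [δ]; ring
    rw [this, hD, mul_add]
    gcongr ?_ * _ + ?_ * _
    · exact min_le_left _ _
    · exact min_le_right _ _
  have b3 : ν * ‖besselV (vel ξ)‖ ^ 2 + μ * ‖besselV (mag ξ)‖ ^ 2 ≤ (ν + μ) * Y := by
    rw [e2]
    nlinarith
  obtain ⟨t1, t2, t3⟩ := le_one_add_mul_sq he hY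
  have u1 := mul_le_mul_of_nonneg_left t1 (add_pos hν hμ).le
  have u2 := mul_le_mul_of_nonneg_left t2 hB
  have u3 := mul_le_mul_of_nonneg_left t3 (show 0 ≤ g ^ 2 / (4 * δ) by positivity)
  linarith [a1.2, a2.1, a3.2, a4.1]

end State

/-- Since K L_n = P_n is self-adjoint and fixes f, the truncation disappears. Testing a Galerkin
system in the weaker energy norm thus gives the same expression as for the full system. -/
lemma inner_bessel_bessel_rough {n : ℕ} {f : L2} (hf : proj n f = f) (h : L2) :
    inner ℝ (bessel f) (bessel (rough n h)) = inner ℝ (bessel f) h := by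
  rw [bessel_rough, ← inner_proj_left, ← bessel_proj, hf]

lemma inner_besselV_besselV_rough {n : ℕ} {v : L2Vec} (hv : vecMap (proj n) v = v) (w : L2Vec) :
    inner ℝ (besselV v) (besselV (vecMap (rough n) w)) = inner ℝ (besselV v) w := by
  simp only [PiLp.inner_apply, vecMap_apply]
  exact Finset.sum_congr rfl fun i _ => inner_bessel_bessel_rough (congrArg (fun y : L2Vec => y i) hv) _

lemma hasDerivAt_besselV {v : ℝ → HSpace} {v' : HSpace} {t : ℝ} (h : HasDerivAt v v' t) :
    HasDerivAt (fun s => besselV (v s)) (besselV v') t :=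
  (besselV.comp HSpace.subtypeL).hasFDerivAt.comp_hasDerivAt t h

/-! ### Energy and enstrophy along the Galerkin solutions -/

namespace State

variable {ν μ κ g α ε : ℝ} {ζ : ℝ → ℝ} {hζ : IsCalming ε ζ}

lemma coe_inner_solenoidal (v w : HSpace) : inner ℝ v w = inner ℝ (v : L2Vec) (w : L2Vec) := rfl

lemma hasDerivAt_enstrophy {n : ℕ} {x : ℝ → State} {t : ℝ}
    (hx : HasDerivAt x (scale.field (force ν μ κ g α hζ) (visc ν μ κ) n (x t)) t) :
    HasDerivAt (fun s => enstrophy (x s)) (2 * enstrophyRate ν μ g (scale.L n (x t))) t := by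
  refine ((vel.hasFDerivAt.comp_hasDerivAt t hx).norm_sq.add
    (mag.hasFDerivAt.comp_hasDerivAt t hx).norm_sq).congr_deriv ?_
  rw [enstrophyRate, mul_add]
  congr 2
  · simp only [Function.comp_apply, GalerkinScale.field, vel_L]
    rw [← inner_solMap _ (inner_rough_left n), coe_inner_solenoidal, map_sub, vel_visc, force, vel_mk]
    simp
  · simp only [Function.comp_apply, GalerkinScale.field, mag_L]
    rw [← inner_solMap _ (inner_rough_left n), coe_inner_solenoidal, map_sub, mag_visc, force, mag_mk]
    simp

lemma hasDerivAt_energy {n : ℕ} {x : ℝ → State} {t : ℝ}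
    (hx : HasDerivAt x (scale.field (force ν μ κ g α hζ) (visc ν μ κ) n (x t)) t)
    (hP : scale.P n (x t) = x t) :
    HasDerivAt (fun s => energy (x s)) (2 * energyRate ν μ κ g α hζ (scale.L n (x t))) t := by
  have hK : scale.K (scale.L n (x t)) = x t := by rw [scale.K_L, hP]
  have hv : vecMap (proj n) (vel (x t) : L2Vec) = vel (x t) := by
    rw [← coe_solMap _ (isMultiplier_proj n), ← vel_P, hP]
  have hm : vecMap (proj n) (mag (x t) : L2Vec) = mag (x t) := by
    rw [← coe_solMap _ (isMultiplier_proj n), ← mag_P, hP]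
  have hv' : besselV (vel (scale.L n (x t))) = (vel (x t) : L2Vec) := by
    rw [← coe_solMap _ isMultiplier_bessel, ← vel_K, hK]
  have hm' : besselV (mag (scale.L n (x t))) = (mag (x t) : L2Vec) := by
    rw [← coe_solMap _ isMultiplier_bessel, ← mag_K, hK]
  have d1 : HasDerivAt (fun s => besselV (vel (x s)))
      (besselV (vel (scale.field (force ν μ κ g α hζ) (visc ν μ κ) n (x t)))) t :=
    hasDerivAt_besselV (vel.hasFDerivAt.comp_hasDerivAt t hx)
  have d2 : HasDerivAt (fun s => besselV (mag (x s)))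
      (besselV (mag (scale.field (force ν μ κ g α hζ) (visc ν μ κ) n (x t)))) t :=
    hasDerivAt_besselV (mag.hasFDerivAt.comp_hasDerivAt t hx)
  have d3 : HasDerivAt (fun s => temp (x s))
      (temp (scale.field (force ν μ κ g α hζ) (visc ν μ κ) n (x t))) t :=
    temp.hasFDerivAt.comp_hasDerivAt t hx
  refine ((d1.norm_sq.add d2.norm_sq).add d3.norm_sq).congr_deriv ?_
  rw [energyRate, mul_add, mul_add, hv', hm', GalerkinScale.field, vel_L, mag_L, temp_L, coe_solMap,
    coe_solMap, inner_besselV_besselV_rough hv, inner_besselV_besselV_rough hm, ← inner_rough_left,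
    ← temp_L, map_sub, map_sub, map_sub, vel_visc, mag_visc, temp_visc, force, vel_mk, mag_mk, temp_mk]
  rfl

lemma energy_nonneg (x : State) : 0 ≤ energy x := by unfold energy; positivity

lemma enstrophy_nonneg (x : State) : 0 ≤ enstrophy x := by unfold enstrophy; positivity

lemma energy_le (x : State) : energy x ≤ ‖x‖ ^ 2 := by
  rw [norm_sq_eq, energy]
  have h1 := norm_besselV_le (vel x)
  have h2 := norm_besselV_le (mag x)
  simp only [Submodule.coe_norm]
  gcongr

lemma enstrophy_le (x : State) : enstrophy x ≤ ‖x‖ ^ 2 := by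
  rw [norm_sq_eq, enstrophy]
  linarith [sq_nonneg ‖temp x‖]

lemma norm_sq_le_enstrophy_add_energy (x : State) : ‖x‖ ^ 2 ≤ energy x + enstrophy x := by
  rw [norm_sq_eq, enstrophy, energy]
  linarith [sq_nonneg ‖besselV (vel x)‖, sq_nonneg ‖besselV (mag x)‖]

/-- At ξ = L_n x one has K ξ = x, so both rate inequalities become differential inequalities for the
energy and enstrophy of x, with constants independent of n. Since P_n is a contraction, ‖x₀‖² bounds
both initial values. -/
lemma exists_bound_flowLine (hζ : IsCalming ε ζ) (hν : 0 < ν) (hμ : 0 < μ) (hκ : 0 < κ) (hg : 0 < g)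
    (T : ℝ) (x₀ : State) : ∃ R, ∀ n τ, 0 ≤ τ → τ ≤ T → ∀ x : ℝ → State, x 0 = scale.P n x₀ →
      IsFlowLine (scale.field (force ν μ κ g α hζ) (visc ν μ κ) n) τ x →
      (∀ t ∈ Icc 0 τ, scale.P n (x t) = x t) → ‖x τ‖ ≤ R := by
  obtain ⟨a, A, ha, hA, h1⟩ := energyRate_le (α := α) hζ hν hμ hκ hg
  obtain ⟨A', hA', h2⟩ := enstrophyRate_le hν hμ hg
  obtain ⟨R, hR⟩ := exists_bound_of_energy (T := T) ha (add_nonneg hA hA') (sq_nonneg ‖x₀‖)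
  refine ⟨√R, fun n τ h0 hT x hx0 hx hP => Real.le_sqrt_of_sq_le ?_⟩
  have hK : ∀ t ∈ Ioo 0 τ, scale.K (scale.L n (x t)) = x t := fun t ht => by
    rw [scale.K_L, hP t (Ioo_subset_Icc_self ht)]
  have hx0' : ‖x 0‖ ^ 2 ≤ ‖x₀‖ ^ 2 := by
    rw [hx0]
    gcongr
    exact scale.norm_P_le n x₀
  have hc := hx.continuousOn
  refine (norm_sq_le_enstrophy_add_energy _).trans (hR τ h0 hT (fun t => energy (x t))
    (fun t => enstrophy (x t)) _ _ ?_ ?_ (fun _ => energy_nonneg _) (fun _ => enstrophy_nonneg _)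
    (fun t ht => hasDerivAt_energy (hx.hasDerivAt t ht) (hP t (Ioo_subset_Icc_self ht)))
    (fun t ht => hasDerivAt_enstrophy (hx.hasDerivAt t ht)) (fun t ht => ?_) (fun t ht => ?_)
    ((energy_le _).trans hx0') ((enstrophy_le _).trans hx0'))
  · unfold energy
    fun_prop
  · unfold enstrophy
    fun_prop
  · have h := h1 (scale.L n (x t))
    rw [hK t ht] at h
    nlinarith [energy_nonneg (x t)]
  · have h := h2 (scale.L n (x t))
    rw [hK t ht] at h
    have h3 : 0 ≤ A * ((1 + energy (x t)) * (1 + enstrophy (x t)) ^ 2) :=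
      mul_nonneg hA (mul_nonneg (by linarith [energy_nonneg (x t)]) (sq_nonneg _))
    linarith

end State

/-! ### The Galerkin limit as a semi-strong solution -/

lemma IsTimeDeriv.clm_comp {X Y : Type*} [NormedAddCommGroup X] [NormedSpace ℝ X] [CompleteSpace X]
    [NormedAddCommGroup Y] [NormedSpace ℝ Y] [CompleteSpace Y] {T : ℝ} {G G' : ℝ → X}
    (h : IsTimeDeriv T G G') (hG : MemL2Time T G) (hG' : MemL2Time T G') (L : X →L[ℝ] Y) :
    IsTimeDeriv T (fun t => L (G t)) (fun t => L (G' t)) := by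
  intro η hη hc hs
  have key : ∀ {χ : ℝ → ℝ} {H : ℝ → X}, Continuous χ → HasCompactSupport χ → MemL2Time T H →
      ∫ t in Ioo 0 T, χ t • L (H t) = L (∫ t in Ioo 0 T, χ t • H t) := by
    intro χ H hχ hχc hH
    obtain ⟨C, hC⟩ := hχc.exists_bound_of_continuous hχ
    have hi : Integrable (fun t => χ t • H t) (volume.restrict (Ioo 0 T)) :=
      (hH.integrable (by norm_num)).bdd_smul C hχ.aestronglyMeasurable (Eventually.of_forall hC)
    rw [← L.integral_comp_comm hi]
    simp only [map_smul]
  rw [key (hη.continuous_deriv (by simp)) hc.deriv hG, key hη.continuous hc hG', h η hη hc hs, map_neg]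

lemma MemL2Time.clm_comp {X Y : Type*} [NormedAddCommGroup X] [NormedSpace ℝ X]
    [NormedAddCommGroup Y] [NormedSpace ℝ Y] {T : ℝ} {G : ℝ → X} (h : MemL2Time T G)
    (L : X →L[ℝ] Y) : MemL2Time T fun t => L (G t) :=
  L.comp_memLp' h

/-- The functional `ψ ↦ ∫ f (1 - Δ)^{1/2} ψ`. -/
noncomputable def rootHneg1 : L2 →L[ℝ] Hneg1 :=
  LinearMap.mkContinuous
    { toFun := fun f =>
        (innerSL ℝ f).comp besselH1.symm.toContinuousLinearEquiv.toContinuousLinearMap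
      map_add' := fun f h => by ext ψ; simp
      map_smul' := fun c f => by ext ψ; simp } 1 fun f => by
    rw [one_mul]
    refine ContinuousLinearMap.opNorm_le_bound _ (norm_nonneg f) fun ψ => ?_
    refine (norm_inner_le_norm f (besselH1.symm ψ)).trans_eq ?_
    rw [LinearIsometryEquiv.norm_map]

lemma rootHneg1_apply (f : L2) (ψ : H1) : rootHneg1 f ψ = inner ℝ f (besselH1.symm ψ) := rfl

/-- The abstract equation governs (1 - Δ)^{-1/2} θ; this functional undoes the smoothing and returns
θ itself, at the price of living in H^{-1}. -/
lemma rootHneg1_bessel (f : L2) : rootHneg1 (bessel f) = L2.toHneg1 f := by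
  ext ψ
  rw [rootHneg1_apply, inner_bessel_left, ← fn_besselH1, LinearIsometryEquiv.apply_symm_apply]
  rfl

/-- Since `besselH1` is an isometry, the L² product defining the left side is an H¹ product against
ψ, whose two halves are the terms on the right. -/
lemma rootHneg1_eq (f : L2) : rootHneg1 f = L2.toHneg1 (bessel f) + H1.negLap (besselH1 f) := by
  ext ψ
  have h := LinearIsometryEquiv.inner_map_map (𝕜 := ℝ) (E := L2) (E' := H1) besselH1 f
    (besselH1.symm ψ)
  rw [LinearIsometryEquiv.apply_symm_apply] at h
  rw [rootHneg1_apply, ← h]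
  exact inner_prod (besselH1 f).1 ψ.1

/-- `(1 - Δ)^{-1} : (L²)² → (H²)²`. -/
noncomputable def besselH2Vec : L2Vec →L[ℝ] H2Vec :=
  (PiLp.continuousLinearEquiv 2 ℝ fun _ : Fin 2 => H2).symm.toContinuousLinearMap.comp
    (ContinuousLinearMap.pi fun i => besselH2.comp (PiLp.proj 2 (fun _ : Fin 2 => L2) i))

/-- Three contributions, the function and its two first derivatives in H¹, each at most ‖f‖². -/
lemma norm_besselH2_sq_le (f : L2) : ‖besselH2 f‖ ^ 2 ≤ 3 * ‖f‖ ^ 2 := by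
  have h : ‖besselH2 f‖ ^ 2
      = ‖bessel (bessel f)‖ ^ 2 + ∑ j, ‖besselH1 (riesz j f)‖ ^ 2 := by
    change ‖(besselH2 f).1‖ ^ 2 = _
    rw [WithLp.prod_norm_sq_eq_of_L2, PiLp.norm_sq_eq_of_L2]
    rfl
  rw [h, Fin.sum_univ_two, LinearIsometryEquiv.norm_map, LinearIsometryEquiv.norm_map]
  have h1 : ‖bessel (bessel f)‖ ^ 2 ≤ ‖f‖ ^ 2 := by
    gcongr
    exact (norm_bessel_le _).trans (norm_bessel_le f)
  have h2 : ∀ j, ‖riesz j f‖ ^ 2 ≤ ‖f‖ ^ 2 := fun j => by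
    gcongr
    exact norm_riesz_le j f
  linarith [h2 0, h2 1]

lemma norm_besselH2Vec_le (w : L2Vec) : ‖besselH2Vec w‖ ≤ 2 * ‖w‖ := by
  refine abs_le_of_sq_le_sq' ?_ (by positivity) |>.2
  have e : ‖besselH2Vec w‖ ^ 2 = ∑ i, ‖besselH2 (w i)‖ ^ 2 :=
    PiLp.norm_sq_eq_of_L2 (fun _ : Fin 2 => H2) (besselH2Vec w)
  rw [e, mul_pow, norm_L2Vec_sq, Fin.sum_univ_two]
  have h := fun i => norm_besselH2_sq_le (w i)
  linarith [h 0, h 1, sq_nonneg ‖w 0‖, sq_nonneg ‖w 1‖]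

lemma memL2Time_besselH2Vec {T : ℝ} {w : ℝ → L2Vec} (hw : MemL2Time T w) :
    MemL2Time T fun t => besselH2Vec (w t) :=
  MemLp.of_le_mul hw (besselH2Vec.continuous.comp_aestronglyMeasurable hw.1)
    (Eventually.of_forall fun t => norm_besselH2Vec_le (w t))

lemma isAdvectionVec_adv (v w : L2Vec) :
    IsAdvectionVec (H1Vec.fn (besselVec (besselV v))) (besselVec (besselV w)) (adv v w) :=
  fun i => coeFn_adv v w i

lemma isAdvection_advScalar (v : L2Vec) (φ : L2) :
    IsAdvection (H1Vec.fn (besselVec (besselV v))) (H1.grad (besselH1 φ)) (advScalar v φ) :=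
  coeFn_advScalar v φ

lemma lap_besselH2Vec (w : L2Vec) :
    H2Vec.lap (besselH2Vec w) = besselV (besselV w) - w := by
  ext1 i
  exact lap_besselH2 (w i)

/-! ### The equations recovered from the abstract one -/

namespace State

lemma curl_besselVec (ξ : State) : curl (besselVec (besselV (mag ξ))) = bessel (vort ξ) := by
  rw [vort, map_sub, bessel_riesz, bessel_riesz]
  rfl

lemma coe_PH (w : L2Vec) : (PH w : L2Vec) = leray w := rfl

variable {ν μ κ g α ε : ℝ} {ζ : ℝ → ℝ}

/-- The term ν u inside `velForce` compensates for `visc` acting as ν (1 - Δ) instead of -ν Δ. The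
Laplacian of a solenoidal field is solenoidal, so P_σ leaves it alone. -/
lemma momentum_eq (ξ : State) :
    ((velForce ν g ξ - ν • vel ξ : HSpace) : L2Vec)
      - ν • leray (H2Vec.lap (besselH2Vec (vel ξ))) + leray (adv (vel ξ) (vel ξ))
    = leray (adv (mag ξ) (mag ξ)) + g • leray (buoyancy (bessel (temp ξ))) := by
  rw [lap_besselH2Vec, leray_eq_self (HSpace.sub_mem
    (isMultiplier_bessel.vecMap_mem (isMultiplier_bessel.vecMap_mem (vel ξ).2)) (vel ξ).2)]
  simp only [velForce, Submodule.coe_sub, Submodule.coe_add, Submodule.coe_smul, coe_PH, vel_K,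
    coe_solMap, map_add, map_sub, map_smul, smul_sub]
  abel

/-- The projector inside `magForce` acts trivially, by `adv_sub_adv_mem`, so the equation comes out
unprojected. -/
lemma magnetic_eq (ξ : State) :
    ((magForce μ ξ - μ • mag ξ : HSpace) : L2Vec) - μ • H2Vec.lap (besselH2Vec (mag ξ))
      + adv (vel ξ) (mag ξ) = adv (mag ξ) (vel ξ) := by
  rw [lap_besselH2Vec]
  simp only [magForce, Submodule.coe_sub, Submodule.coe_add, Submodule.coe_smul, coe_PH, mag_K,
    coe_solMap, smul_sub, leray_eq_self (adv_sub_adv_mem (vel ξ).2 (mag ξ).2)]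
  abel

lemma temperature_eq (hζ : IsCalming ε ζ) (ξ : State) :
    rootHneg1 (tempForce μ κ α hζ ξ - κ • temp ξ) + κ • H1.negLap (besselH1 (temp ξ))
      + L2.toHneg1 (advScalar (vel ξ) (temp ξ))
    = (α * μ) • L2.toHneg1 (hζ.heat (bessel (vort ξ))) := by
  simp only [tempForce, map_sub, map_add, map_smul, rootHneg1_bessel, temp_K,
    rootHneg1_eq (temp ξ), smul_add]
  abel

lemma memL2Time_rootHneg1 {T : ℝ} {f : ℝ → L2} (hf : MemL2Time T f) :
    MemL2Time T fun t => rootHneg1 (f t) := by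
  have h := hf.clm_comp (Y := Hneg1) rootHneg1
  exact h

lemma isTimeDeriv_rootHneg1 {T : ℝ} {f f' : ℝ → L2} (h : IsTimeDeriv T f f') (hf : MemL2Time T f)
    (hf' : MemL2Time T f') :
    IsTimeDeriv T (fun t => rootHneg1 (f t)) (fun t => rootHneg1 (f' t)) := by
  have h' := h.clm_comp (Y := Hneg1) hf hf' rootHneg1
  exact h'

/-- A solution of the abstract equation is a semi-strong solution. -/
theorem isSemiStrongSolution (hζ : IsCalming ε ζ) {T : ℝ} {u₀ b₀ : VSpace} {θ₀ : L2}
    {x ξ : ℝ → State} (hx : ContinuousOn x (Icc 0 T))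
    (hu₀ : besselVec (vel (x 0)) = u₀) (hb₀ : besselVec (mag (x 0)) = b₀) (hθ₀ : temp (x 0) = θ₀)
    (hξ : MemL2Time T ξ) (hK : ∀ᵐ t ∂volume.restrict (Ioo 0 T), scale.K (ξ t) = x t)
    (hF : MemL2Time T fun t => force ν μ κ g α hζ (ξ t))
    (hd : IsTimeDeriv T (fun t => scale.K (x t))
      fun t => force ν μ κ g α hζ (ξ t) - visc ν μ κ (ξ t)) :
    IsSemiStrongSolution ν μ κ g α ζ T u₀ b₀ θ₀
      (fun t => ⟨besselVec (vel (x t)), besselVec_mem (vel (x t)).2⟩)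
      (fun t => ⟨besselVec (mag (x t)), besselVec_mem (mag (x t)).2⟩) (fun t => temp (x t)) := by
  have hv : ∀ p : State →L[ℝ] HSpace, Continuous fun y => besselVec (p y) := fun p =>
    besselVec.continuous.comp (HSpace.subtypeL.continuous.comp p.continuous)
  have hKx : MemL2Time T fun t => scale.K (x t) :=
    memLp_of_continuousOn (scale.K.continuous.comp_continuousOn hx)
  have hR : MemL2Time T fun t => force ν μ κ g α hζ (ξ t) - visc ν μ κ (ξ t) :=
    hF.sub ((visc ν μ κ).comp_memLp' hξ)
  have hvel : ∀ᵐ t ∂volume.restrict (Ioo 0 T), (vel (x t) : L2Vec) = besselV (vel (ξ t)) := by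
    filter_upwards [hK] with t ht
    rw [← ht, vel_K, coe_solMap]
  have hmag : ∀ᵐ t ∂volume.restrict (Ioo 0 T), (mag (x t) : L2Vec) = besselV (mag (ξ t)) := by
    filter_upwards [hK] with t ht
    rw [← ht, mag_K, coe_solMap]
  have htemp : ∀ᵐ t ∂volume.restrict (Ioo 0 T), temp (x t) = bessel (temp (ξ t)) := by
    filter_upwards [hK] with t ht
    rw [← ht, temp_K]
  -- The regular representatives are read off from ξ: (1 - Δ)^{-1} of its first two components and
  -- (1 - Δ)^{-1/2} of the third. The time derivatives are the components of F(ξ) - N ξ, the last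
  -- one carried into H^{-1}.
  refine ⟨Topology.IsInducing.subtypeVal.continuousOn_iff.2 ((hv vel).comp_continuousOn hx),
    Topology.IsInducing.subtypeVal.continuousOn_iff.2 ((hv mag).comp_continuousOn hx),
    temp.continuous.comp_continuousOn hx, Subtype.ext hu₀, Subtype.ext hb₀, hθ₀,
    fun t => besselH2Vec (vel (ξ t)), fun t => besselH2Vec (mag (ξ t)),
    fun t => besselH1 (temp (ξ t)),
    fun t => velForce ν g (ξ t) - ν • vel (ξ t), fun t => magForce μ (ξ t) - μ • mag (ξ t),
    fun t => rootHneg1 (tempForce μ κ α hζ (ξ t) - κ • temp (ξ t)),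
    ⟨?_, ?_⟩, ⟨?_, ?_⟩, ⟨?_, ?_⟩, ⟨?_, ?_⟩, ⟨?_, ?_⟩, ⟨?_, ?_⟩, ?_, ?_, ?_⟩
  · exact memL2Time_besselH2Vec ((HSpace.subtypeL.comp vel).comp_memLp' hξ)
  · filter_upwards [hvel] with t ht
    rw [ht]
    rfl
  · exact memL2Time_besselH2Vec ((HSpace.subtypeL.comp mag).comp_memLp' hξ)
  · filter_upwards [hmag] with t ht
    rw [ht]
    rfl
  · exact (besselH1.toContinuousLinearEquiv.toContinuousLinearMap.comp temp).comp_memLp' hξ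
  · filter_upwards [htemp] with t ht
    rw [ht, fn_besselH1]
  · have h : MemL2Time T fun t => vel (force ν μ κ g α hζ (ξ t) - visc ν μ κ (ξ t)) :=
      vel.comp_memLp' hR
    simpa only [map_sub, force, vel_mk, vel_visc] using h
  · have h : IsTimeDeriv T (fun t => (vel (scale.K (x t)) : L2Vec))
        fun t => (vel (force ν μ κ g α hζ (ξ t) - visc ν μ κ (ξ t)) : L2Vec) :=
      hd.clm_comp hKx hR (HSpace.subtypeL.comp vel)
    simp only [map_sub, force, vel_mk, vel_visc, vel_K] at h
    exact h
  · have h : MemL2Time T fun t => mag (force ν μ κ g α hζ (ξ t) - visc ν μ κ (ξ t)) :=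
      mag.comp_memLp' hR
    simpa only [map_sub, force, mag_mk, mag_visc] using h
  · have h : IsTimeDeriv T (fun t => (mag (scale.K (x t)) : L2Vec))
        fun t => (mag (force ν μ κ g α hζ (ξ t) - visc ν μ κ (ξ t)) : L2Vec) :=
      hd.clm_comp hKx hR (HSpace.subtypeL.comp mag)
    simp only [map_sub, force, mag_mk, mag_visc, mag_K] at h
    exact h
  · have h : MemL2Time T fun t => temp (force ν μ κ g α hζ (ξ t) - visc ν μ κ (ξ t)) :=
      temp.comp_memLp' hR
    simp only [map_sub, force, temp_mk, temp_visc] at h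
    exact memL2Time_rootHneg1 h
  · have h := hd.clm_comp hKx hR temp
    simp only [map_sub, force, temp_mk, temp_visc, temp_K] at h
    have hm : MemL2Time T fun t => bessel (temp (x t)) := by
      simpa only [temp_K] using (show MemL2Time T fun t => temp (scale.K (x t)) from
        temp.comp_memLp' hKx)
    have hm' : MemL2Time T fun t => temp (force ν μ κ g α hζ (ξ t) - visc ν μ κ (ξ t)) :=
      temp.comp_memLp' hR
    simp only [map_sub, force, temp_mk, temp_visc] at hm'
    have h' := isTimeDeriv_rootHneg1 h hm hm'
    simpa only [rootHneg1_bessel] using h'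
  · filter_upwards [hvel, hmag, htemp] with t h1 h2 h3
    refine ⟨adv (vel (ξ t)) (vel (ξ t)), adv (mag (ξ t)) (mag (ξ t)), ?_, ?_, ?_⟩
    · rw [h1]; exact isAdvectionVec_adv _ _
    · rw [h2]; exact isAdvectionVec_adv _ _
    · rw [h3]; exact momentum_eq (ξ t)
  · filter_upwards [hvel, hmag] with t h1 h2
    refine ⟨adv (vel (ξ t)) (mag (ξ t)), adv (mag (ξ t)) (vel (ξ t)), ?_, ?_, magnetic_eq (ξ t)⟩
    · rw [h1, h2]; exact isAdvectionVec_adv _ _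
    · rw [h1, h2]; exact isAdvectionVec_adv _ _
  · filter_upwards [hvel, hmag] with t h1 h2
    refine ⟨advScalar (vel (ξ t)) (temp (ξ t)), hζ.heat (bessel (vort (ξ t))), ?_, ?_,
      temperature_eq hζ (ξ t)⟩
    · rw [h1]; exact isAdvection_advScalar _ _
    · rw [h2, IsCalmedOhmic, curl_besselVec]; exact hζ.coeFn_heat _

end State

end CalmedMHD

theorem mainTheorem1 (ν μ κ g α ε : ℝ) (hν : 0 < ν) (hμ : 0 < μ) (hκ : 0 < κ) (hg : 0 < g)
    (hε : 0 < ε) (ζ : ℝ → ℝ) (hζ : CalmedMHD.IsCalming ε ζ) (T : ℝ) (hT : 0 < T)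
    (u₀ b₀ : CalmedMHD.VSpace) (θ₀ : CalmedMHD.L2) :
    ∃ (u b : ℝ → CalmedMHD.VSpace) (θ : ℝ → CalmedMHD.L2),
      CalmedMHD.IsSemiStrongSolution ν μ κ g α ζ T u₀ b₀ θ₀ u b θ := by
  open CalmedMHD CalmedMHD.State in
  obtain ⟨v, hv, hvu⟩ := exists_besselVec u₀.2
  obtain ⟨w, hw, hwb⟩ := exists_besselVec b₀.2
  have hF := isTame_force ν μ κ g α hζ
  -- The initial state is (Λ^{1/2} u₀, Λ^{1/2} b₀, θ₀), which has exactly the regularity of the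
  -- phase space; the coercivity constant of the viscosities is the smallest of the three.
  obtain ⟨x, ξ, hx, hx0, hξ, hK, hFξ, hd⟩ := scale.exists_solution hF.isLipschitzOnBalls
    hF.isSubcritical (lt_min hν (lt_min hμ hκ)) (le_inner_visc ν μ κ) (P_visc ν μ κ) hT
    (mk ⟨v, hv⟩ ⟨w, hw⟩ θ₀) (exists_bound_flowLine hζ hν hμ hκ hg T _)
  exact ⟨_, _, _, isSemiStrongSolution hζ hx (by rw [hx0, vel_mk, hvu]) (by rw [hx0, mag_mk, hwb])
    (by rw [hx0, temp_mk]) hξ hK hFξ hd⟩
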